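/- Let $d\ge 1$ and let $(X_y)_{y\in\mathbb Z^d}$ be a stationary collection of real random variables with mean zero, finite variance and with densities, satisfying the FKG inequalities: for every finite subcollection, $\mathrm{Cov}(F,G)\ge 0$ for all coordinatewise increasing functions $F,G$ of it (whenever $F$, $G$ are measurable and square integrable). For $u\in\mathbb Z_{>0}^d$ put $B_u=\{y\in\mathbb Z^d: 1\le y_i\le u_i \text{ for all } i\}$ and $|u|=|B_u|=\prod_i u_i$. For each $\tau\ge 0$ let $(Z^{(\tau)}_y)_{y\in\mathbb Z^d}$ be $N(0,\tau)$ variables, independent of $(X_y)$ and of each other, and let $$V_u^{(\tau)}=\frac1{\sqrt{|u|}}\sum_{y\in B_u}\bigl(X_y+Z^{(\tau)}_y\bigr).$$ For a random variable $U$ with variance $\sigma^2$ and continuously differentiable density $f$ let $J_{\rm st}(U)=\sigma^2\,\mathbb E\bigl[(f'(U)/f(U))^2\bigr]-1$, and let $\kappa(n,\tau)=\sup_{|u|\ge n}J_{\rm st}(V_u^{(\tau)})$ for $\tau>0$. Assume 1. (finite susceptibility) $\sum_{y\in\mathbb Z^d}\mathrm{Cov}(X_0,X_y)<\infty$; 2.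 for some $n$, $\int_0^\infty \frac{\kappa(n,\tau)}{1+\tau}\,d\tau<\infty$. Let $\tau\ge 0$. Let $g_u$ be the density of $V_u^{(\tau)}$, let $\sigma_u^2=\mathrm{Var}(V_u^{(\tau)})$, let $\varphi_{\sigma_u^2}$ be the density of $N(0,\sigma_u^2)$, and let $D$ be relative entropy (with value $\infty$ if $V_u^{(\tau)}$ has no density, which can only occur for $\tau=0$). Then $$D(g_u\,\|\,\varphi_{\sigma_u^2})\to 0\quad\text{as } |u|\to\infty$$ (equivalently, the relative entropy of $V_u^{(\tau)}/\sigma_u$ from the standard normal tends to $0$) if and only if uniform integrability holds: there is a function $\psi$ with $\psi(R)\to0$ as $R\to\infty$ such that, for all $u$ and all $R$, $$\mathbb E\bigl[(V_u^{(\tau)})^2\,\mathbf 1(|V_u^{(\tau)}|\ge R\sigma_u)\bigr]\le \sigma_u^2\,\psi(R).$$ -/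

import Mathlib

open MeasureTheory ProbabilityTheory Filter Topology
open scoped NNReal ENNReal

noncomputable section

namespace FKGEntropy

variable {Ω : Type*} [MeasurableSpace Ω]

/-- The collection `X` satisfies the FKG inequalities: for every finite subcollection, any two
coordinatewise increasing (Borel) functions of it have nonnegative covariance, whenever they are
square integrable (so that the covariance exists). -/
def IsFKG {ι : Type*} (X : ι → Ω → ℝ) (P : Measure Ω) : Prop :=
  ∀ (s : Finset ι) (F G : (s → ℝ) → ℝ),
    Monotone F → Monotone G → Measurable F → Measurable G →
    MemLp (fun ω => F (fun i => X i ω)) 2 P →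
    MemLp (fun ω => G (fun i => X i ω)) 2 P →
    0 ≤ cov[fun ω => F (fun i => X i ω), fun ω => G (fun i => X i ω); P]

/-- Stationarity of a field on `ℤ^d`: all translates have the same joint law. -/
def IsStationary {d : ℕ} (X : (Fin d → ℤ) → Ω → ℝ) (P : Measure Ω) : Prop :=
  ∀ h : Fin d → ℤ,
    P.map (fun ω (y : Fin d → ℤ) => X (y + h) ω) = P.map (fun ω (y : Fin d → ℤ) => X y ω)

/-- The box `B_u = {y ∈ ℤ^d : 1 ≤ y_i ≤ u_i for all i}`, for a vector `u` of positive integers. -/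
def box {d : ℕ} (u : Fin d → ℕ+) : Finset (Fin d → ℤ) :=
  Finset.Icc (fun _ => 1) (fun i => ((u i : ℕ) : ℤ))

/-- The volume `|u| = ∏ i, u_i`. -/
def boxVol {d : ℕ} (u : Fin d → ℕ+) : ℕ := ∏ i, (u i : ℕ)

theorem card_box {d : ℕ} (u : Fin d → ℕ+) : (box u).card = boxVol u := by
  simp [box, boxVol, Pi.card_Icc]

/-- `(∑_{y ∈ B_u} Y_y) / √|u|`. -/
def normSum {d : ℕ} (Y : (Fin d → ℤ) → Ω → ℝ) (u : Fin d → ℕ+) (ω : Ω) : ℝ :=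
  (∑ y ∈ box u, Y y ω) / √(boxVol u : ℝ)

/-- For every `τ ≥ 0`, the variables `Z τ y` (`y ∈ ℤ^d`) are `N(0, τ)`, independent of each other
and (jointly) independent of the field `X`. -/
structure IsGaussianPerturbation {d : ℕ} (X : (Fin d → ℤ) → Ω → ℝ)
    (Z : ℝ≥0 → (Fin d → ℤ) → Ω → ℝ) (P : Measure Ω) : Prop where
  measurable : ∀ τ y, Measurable (Z τ y)
  law : ∀ τ y, P.map (Z τ y) = gaussianReal 0 τ
  iIndep : ∀ τ, iIndepFun (Z τ) P
  indep : ∀ τ, IndepFun (fun ω (y : Fin d → ℤ) => Z τ y ω) (fun ω (y : Fin d → ℤ) => X y ω) P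

/-- `V_u^{(τ)}`: the normalized box sum of the perturbed field `Y^{(τ)} = X + Z^{(τ)}`. -/
def V {d : ℕ} (X : (Fin d → ℤ) → Ω → ℝ) (Z : ℝ≥0 → (Fin d → ℤ) → Ω → ℝ)
    (τ : ℝ≥0) (u : Fin d → ℕ+) : Ω → ℝ :=
  normSum (fun y ω => X y ω + Z τ y ω) u

/-- `f` is a continuously differentiable probability density of the law `μ`. Such an `f` is
unique if it exists. -/
def IsC1Density (f : ℝ → ℝ) (μ : Measure ℝ) : Prop :=
  ContDiff ℝ 1 f ∧ (∀ x, 0 ≤ f x) ∧ μ = volume.withDensity (fun x => ENNReal.ofReal (f x))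

/-- Fisher information `∫ ρ² dμ`, with score `ρ = f' / f`, where `f` is the continuously
differentiable density of `μ`. The infimum runs over at most one `f`, and the
value is `∞` if there is no such density. -/
def fisherInfo (μ : Measure ℝ) : ℝ≥0∞ :=
  ⨅ (f : ℝ → ℝ) (_ : IsC1Density f μ), ∫⁻ x, ENNReal.ofReal ((deriv f x / f x) ^ 2) ∂μ

/-- Standardised Fisher information `σ² J - 1` of a random variable. For a variable of finite
nonzero variance `σ²` with a continuously differentiable density, `σ² J ≥ 1`, so that the
subtraction does not truncate. -/
def stdFisherInfo (U : Ω → ℝ) (P : Measure Ω) : ℝ≥0∞ :=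
  ENNReal.ofReal Var[U; P] * fisherInfo (P.map U) - 1

/-- `κ(n, τ) = sup_{|u| ≥ n} J_st(V_u^{(τ)})`. -/
def kappa {d : ℕ} (X : (Fin d → ℤ) → Ω → ℝ) (Z : ℝ≥0 → (Fin d → ℤ) → Ω → ℝ) (P : Measure Ω)
    (n : ℕ) (τ : ℝ≥0) : ℝ≥0∞ :=
  ⨆ (u : Fin d → ℕ+) (_ : n ≤ boxVol u), stdFisherInfo (V X Z τ u) P

/-- The class `C_ψ`: square integrable variables `U` of variance `σ²` such that
`E U² 1(|U| ≥ R σ) ≤ σ² ψ(R)` for all `R`. -/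
def InClass (ψ : ℝ → ℝ) (U : Ω → ℝ) (P : Measure Ω) : Prop :=
  MemLp U 2 P ∧
    ∀ R : ℝ, ∫ ω in {ω | R * √(Var[U; P]) ≤ |U ω|}, U ω ^ 2 ∂P ≤ Var[U; P] * ψ R

/-- Uniform integrability: there is one `ψ`, vanishing at infinity, such that
`V_u^{(τ)} ∈ C_ψ` for all `u`. -/
def UniformIntegrability {d : ℕ} (X : (Fin d → ℤ) → Ω → ℝ)
    (Z : ℝ≥0 → (Fin d → ℤ) → Ω → ℝ) (P : Measure Ω) (τ : ℝ≥0) : Prop :=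
  ∃ ψ : ℝ → ℝ, Tendsto ψ atTop (𝓝 0) ∧ ∀ u, InClass ψ (V X Z τ u) P

/-- `D(g ‖ φ)`, where `g` is the law (density) of `U` and `φ` the centred normal law with the same
variance as `U`. -/
def relEntropy (U : Ω → ℝ) (P : Measure Ω) : ℝ≥0∞ :=
  InformationTheory.klDiv (P.map U) (gaussianReal 0 Var[U; P].toNNReal)

end FKGEntropy

end

/-! The two implications use different tools: the heat flow for the first, entropy duality for the
second.

Uniform integrability implies small entropy. Adding an independent N(0, t) to `V X Z τ u` gives the
law of `V X Z (τ + t) u`. By the de Bruijn identity (`negEnt_sub_negEnt`), the relative entropy is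
at most the integral over t > 0 of the excess Fisher information J(t) - 1/(σ² + t), where J(t) is
the Fisher information after smoothing by N(0, t); a factor 1/2 is given away
(`klDiv_gaussianReal_le_lintegral`). The excess equals the standardised Fisher information divided
by σ² + t, so assumption 2 supplies an integrable majorant (`excess_fisher_V_le`), and dominated
convergence reduces everything to a fixed t > 0. At fixed t the smoothing kernel is bounded and
smooth, so weak convergence to a normal law forces the Fisher informations to converge
(`tendsto_excess_fisher`, by Fatou). What remains is a central limit theorem,
`tendsto_charFun_V_sub`. Cut the box into M slabs across its longest side. Newman's inequality for
FKG systems bounds the distance of the characteristic function from a product by the variance lost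
in the cutting, and finite susceptibility makes that loss negligible (`tendsto_variance_defect`). A
Lindeberg estimate on each slab, fed by uniform integrability, then yields the Gaussian.

Small entropy implies uniform integrability. The Gibbs inequality `integral_le_klDiv_add` with test
function x²/4 · 1(|x| ≥ R) bounds the normalised tail second moment by the entropy plus a Gaussian
integral that vanishes as R grows (`tailRatio_le_relEntropy`). Only finitely many boxes have volume
below a given bound, and each of them has vanishing tails by itself.

For τ = 0 no density of the box sums is needed: the entropy bound is proved after smoothing by N(0,
a) and passed to a → 0 through the dual description of relative entropy by bounded continuous
functions. -/

noncomputable section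

namespace FKGEntropy

section

/-! ### The heat kernel -/

/-- The density of `N(0, t)`. -/
def heat (t x : ℝ) : ℝ := (√(2 * Real.pi * t))⁻¹ * Real.exp (-x ^ 2 / (2 * t))

/-- The space derivative of `heat t`. -/
def heat1 (t x : ℝ) : ℝ := -(x / t) * heat t x

/-- The second space derivative of `heat t`. -/
def heat2 (t x : ℝ) : ℝ := (x ^ 2 / t ^ 2 - 1 / t) * heat t x

lemma heat_pos {t : ℝ} (ht : 0 < t) (x : ℝ) : 0 < heat t x := by
  unfold heat; positivity

lemma heat_nonneg (t x : ℝ) : 0 ≤ heat t x := by unfold heat; positivity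

lemma heat_eq_gaussianPDFReal {t : ℝ≥0} (x y : ℝ) :
    heat t (x - y) = gaussianPDFReal y t x := by
  simp [heat, gaussianPDFReal]

lemma measurable_heat : Measurable (fun p : ℝ × ℝ => heat p.1 p.2) := by
  unfold heat; fun_prop

lemma measurable_heat1 : Measurable (fun p : ℝ × ℝ => heat1 p.1 p.2) := by
  unfold heat1 heat; fun_prop

lemma measurable_heat2 : Measurable (fun p : ℝ × ℝ => heat2 p.1 p.2) := by
  unfold heat2 heat; fun_prop

lemma continuous_heat (t : ℝ) : Continuous (heat t) := by
  unfold heat; fun_prop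

lemma continuous_heat1 (t : ℝ) : Continuous (heat1 t) := by
  unfold heat1 heat; fun_prop

lemma continuous_heat2 (t : ℝ) : Continuous (heat2 t) := by
  unfold heat2 heat; fun_prop

lemma hasDerivAt_heat (t x : ℝ) : HasDerivAt (heat t) (heat1 t x) x := by
  have h : HasDerivAt (fun x : ℝ => -x ^ 2 / (2 * t)) (-(2 * x) / (2 * t)) x := by
    simpa using ((hasDerivAt_pow 2 x).neg.div_const (2 * t))
  refine (h.exp.const_mul (√(2 * Real.pi * t))⁻¹).congr_deriv ?_
  have : -(2 * x) / (2 * t) = -(x / t) := by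
    rw [neg_div, mul_div_mul_left _ _ two_ne_zero]
  rw [this]; unfold heat1 heat; ring

lemma hasDerivAt_heat1 (t x : ℝ) : HasDerivAt (heat1 t) (heat2 t x) x := by
  have h : HasDerivAt (fun x : ℝ => -(x / t)) (-(1 / t)) x :=
    ((hasDerivAt_id x).div_const t).neg
  refine (h.mul (hasDerivAt_heat t x)).congr_deriv ?_
  unfold heat2 heat1; ring

lemma hasDerivAt_heat_time {t : ℝ} (ht : 0 < t) (x : ℝ) :
    HasDerivAt (fun t => heat t x) (heat2 t x / 2) t := by
  have hpos : 0 < 2 * Real.pi * t := by positivity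
  have h1 : HasDerivAt (fun t : ℝ => 2 * Real.pi * t) (2 * Real.pi) t := by
    simpa using (hasDerivAt_id t).const_mul (2 * Real.pi)
  have h2 := (h1.sqrt hpos.ne').inv (Real.sqrt_pos.2 hpos).ne'
  have h3 : HasDerivAt (fun t : ℝ => -x ^ 2 / (2 * t)) (x ^ 2 / (2 * t ^ 2)) t := by
    have h4 : HasDerivAt (fun t : ℝ => 2 * t) 2 t := by
      simpa using (hasDerivAt_id t).const_mul (2 : ℝ)
    refine ((hasDerivAt_const t (-x ^ 2)).div h4 (by positivity)).congr_deriv ?_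
    field_simp; ring
  refine (h2.mul h3.exp).congr_deriv ?_
  unfold heat2 heat
  simp only [Pi.inv_apply]
  rw [Real.sq_sqrt hpos.le]
  field_simp
  ring

/-- Uniformly in `t ∈ [a, b]`, the kernel and its derivatives are dominated by `heat (2 * b)`. -/
lemma exists_heat_bound {a b : ℝ} (ha : 0 < a) (hab : a ≤ b) :
    ∃ C : ℝ, 0 < C ∧ ∀ t ∈ Set.Icc a b, ∀ x, heat t x ≤ C * heat (2 * b) x ∧
      |heat1 t x| ≤ C * heat (2 * b) x ∧ |heat2 t x| ≤ C * heat (2 * b) x := by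
  have hb : 0 < b := ha.trans_le hab
  set A : ℝ := (√(2 * Real.pi * a))⁻¹ * √(2 * Real.pi * (2 * b)) with hA
  have hA0 : 0 < A := by positivity
  -- the basic exponential comparison
  have key : ∀ t ∈ Set.Icc a b, ∀ x, heat t x * (1 + x ^ 2 / (4 * b)) ≤ A * heat (2 * b) x := by
    intro t ht x
    have ht0 : 0 < t := ha.trans_le ht.1
    have e1 : Real.exp (-x ^ 2 / (2 * t)) * (1 + x ^ 2 / (4 * b)) ≤
        Real.exp (-x ^ 2 / (2 * (2 * b))) := by
      have : -x ^ 2 / (2 * t) ≤ -x ^ 2 / (2 * b) := by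
        rw [neg_div, neg_div, neg_le_neg_iff]
        gcongr
        exact ht.2
      have h4 : 1 + x ^ 2 / (4 * b) ≤ Real.exp (x ^ 2 / (4 * b)) := by
        linarith [Real.add_one_le_exp (x ^ 2 / (4 * b))]
      calc _ ≤ Real.exp (-x ^ 2 / (2 * b)) * Real.exp (x ^ 2 / (4 * b)) := by gcongr
        _ = _ := by
          rw [← Real.exp_add]; congr 1; field_simp; ring
    have e2 : (√(2 * Real.pi * t))⁻¹ ≤ (√(2 * Real.pi * a))⁻¹ := by
      gcongr; exact ht.1
    have e3 : A * heat (2 * b) x = (√(2 * Real.pi * a))⁻¹ * Real.exp (-x ^ 2 / (2 * (2 * b))) := by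
      have : √(2 * Real.pi * (2 * b)) ≠ 0 := by positivity
      rw [hA]; unfold heat; field_simp
    rw [e3]; unfold heat; rw [mul_assoc]
    gcongr
  -- Each summand of `B` pays for the polynomial prefactor of one of the three kernels. The growth
  -- is absorbed by the factor 1 + x²/(4b), which is what doubling the variance leaves over in
  -- `key`.
  set B : ℝ := 1 + (1 + 4 * b) / a + (4 * b / a ^ 2 + 1 / a) with hB
  have hB0 : 0 < B := by positivity
  refine ⟨A * B, by positivity, fun t ht x => ?_⟩
  have ht0 : 0 < t := ha.trans_le ht.1
  have hk := key t ht x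
  have h0 := heat_nonneg t x
  have hle : ∀ q : ℝ, q ≤ B * (1 + x ^ 2 / (4 * b)) → q * heat t x ≤ A * B * heat (2 * b) x := by
    intro q hq
    calc q * heat t x ≤ B * (1 + x ^ 2 / (4 * b)) * heat t x := by gcongr
      _ = B * (heat t x * (1 + x ^ 2 / (4 * b))) := by ring
      _ ≤ B * (A * heat (2 * b) x) := by gcongr
      _ = _ := by ring
  have hx2 : x ^ 2 = 4 * b * (x ^ 2 / (4 * b)) := by field_simp
  set w := x ^ 2 / (4 * b) with hw
  have hw0 : 0 ≤ w := by positivity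
  have p1 : 0 ≤ (1 + 4 * b) / a := by positivity
  have p2 : 0 ≤ 4 * b / a ^ 2 + 1 / a := by positivity
  refine ⟨?_, ?_, ?_⟩
  · have := hle 1 (by nlinarith [mul_nonneg (add_nonneg p1 p2) hw0])
    simpa using this
  · unfold heat1
    rw [abs_mul, abs_of_nonneg h0, abs_neg, abs_div, abs_of_pos ht0]
    refine hle _ ?_
    have : |x| ≤ 1 + x ^ 2 := by nlinarith [sq_abs x, abs_nonneg x, sq_nonneg (|x| - 1)]
    calc |x| / t ≤ (1 + x ^ 2) / a := by gcongr; exact ht.1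
      _ = 1 / a + 4 * b / a * w := by rw [hx2]; ring
      _ ≤ (1 + 4 * b) / a * (1 + w) := by
        have q1 : 0 ≤ 1 / a * w := by positivity
        have q2 : 0 ≤ 4 * b / a := by positivity
        have : (1 + 4 * b) / a * (1 + w) = 1 / a + 4 * b / a * w + (1 / a * w + 4 * b / a) := by
          ring
        linarith
      _ ≤ _ := by
        rw [hB]; gcongr; linarith
  · unfold heat2
    rw [abs_mul, abs_of_nonneg h0]
    refine hle _ ?_
    calc |x ^ 2 / t ^ 2 - 1 / t| ≤ |x ^ 2 / t ^ 2| + |1 / t| := abs_sub _ _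
      _ = x ^ 2 / t ^ 2 + 1 / t := by rw [abs_of_nonneg, abs_of_nonneg] <;> positivity
      _ ≤ x ^ 2 / a ^ 2 + 1 / a := by
        have := ht.1
        gcongr
      _ = 4 * b / a ^ 2 * w + 1 / a := by rw [hx2]; ring
      _ ≤ (4 * b / a ^ 2 + 1 / a) * (1 + w) := by
        have q1 : 0 ≤ 1 / a * w := by positivity
        have q2 : 0 ≤ 4 * b / a ^ 2 := by positivity
        nlinarith
      _ ≤ _ := by
        rw [hB]; exact mul_le_mul_of_nonneg_right (by linarith) (by positivity)

lemma heat_le {t : ℝ} (ht : 0 ≤ t) (x : ℝ) : heat t x ≤ (√(2 * Real.pi * t))⁻¹ := by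
  unfold heat
  refine mul_le_of_le_one_right (by positivity) ?_
  rw [Real.exp_le_one_iff, neg_div, neg_nonpos]; positivity

lemma exists_heat_bound_const {a b : ℝ} (ha : 0 < a) (hab : a ≤ b) :
    ∃ C : ℝ, 0 < C ∧ ∀ t ∈ Set.Icc a b, ∀ x, |heat t x| ≤ C ∧ |heat1 t x| ≤ C ∧
      |heat2 t x| ≤ C := by
  obtain ⟨C, hC, h⟩ := exists_heat_bound ha hab
  have hb : 0 < b := ha.trans_le hab
  refine ⟨C * (√(2 * Real.pi * (2 * b)))⁻¹, by positivity, fun t ht x => ?_⟩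
  obtain ⟨h1, h2, h3⟩ := h t ht x
  have h4 := mul_le_mul_of_nonneg_left (heat_le (by positivity : 0 ≤ 2 * b) x) hC.le
  rw [abs_of_nonneg (heat_nonneg t x)]
  exact ⟨h1.trans h4, h2.trans h4, h3.trans h4⟩

end

section

/-! ### Gaussian smoothing of a probability measure -/

/-- The density of `μ ∗ N(0, t)`. -/
def sm (μ : Measure ℝ) (t x : ℝ) : ℝ := ∫ y, heat t (x - y) ∂μ

/-- The space derivative of `sm μ t`. -/
def sm1 (μ : Measure ℝ) (t x : ℝ) : ℝ := ∫ y, heat1 t (x - y) ∂μ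

/-- The second space derivative of `sm μ t`. -/
def sm2 (μ : Measure ℝ) (t x : ℝ) : ℝ := ∫ y, heat2 t (x - y) ∂μ

lemma sm_nonneg (μ : Measure ℝ) (t x : ℝ) : 0 ≤ sm μ t x :=
  integral_nonneg fun _ => heat_nonneg _ _

section Smoothing

variable (μ : Measure ℝ) [IsProbabilityMeasure μ]

lemma integrable_heat {t : ℝ} (ht : 0 < t) (x : ℝ) :
    Integrable (fun y => heat t (x - y)) μ := by
  obtain ⟨C, -, h⟩ := exists_heat_bound_const ht le_rfl
  exact Integrable.of_bound ((continuous_heat t).comp (by fun_prop)).aestronglyMeasurable C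
    (.of_forall fun y => (h t ⟨le_rfl, le_rfl⟩ _).1)

lemma integrable_heat1 {t : ℝ} (ht : 0 < t) (x : ℝ) :
    Integrable (fun y => heat1 t (x - y)) μ := by
  obtain ⟨C, -, h⟩ := exists_heat_bound_const ht le_rfl
  exact Integrable.of_bound ((continuous_heat1 t).comp (by fun_prop)).aestronglyMeasurable C
    (.of_forall fun y => (h t ⟨le_rfl, le_rfl⟩ _).2.1)

lemma integrable_heat2 {t : ℝ} (ht : 0 < t) (x : ℝ) :
    Integrable (fun y => heat2 t (x - y)) μ := by
  obtain ⟨C, -, h⟩ := exists_heat_bound_const ht le_rfl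
  exact Integrable.of_bound ((continuous_heat2 t).comp (by fun_prop)).aestronglyMeasurable C
    (.of_forall fun y => (h t ⟨le_rfl, le_rfl⟩ _).2.2)

lemma sm_pos {t : ℝ} (ht : 0 < t) (x : ℝ) : 0 < sm μ t x := by
  refine (integral_pos_iff_support_of_nonneg (fun y => heat_nonneg t _)
    (integrable_heat μ ht x)).2 ?_
  have : Function.support (fun y => heat t (x - y)) = Set.univ := by
    ext y; simp [(heat_pos ht (x - y)).ne']
  simp [this]

lemma measurable_sm : Measurable (fun p : ℝ × ℝ => sm μ p.1 p.2) := by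
  refine StronglyMeasurable.measurable ?_
  refine StronglyMeasurable.integral_prod_right
    (f := fun (p : ℝ × ℝ) (y : ℝ) => heat p.1 (p.2 - y)) ?_
  exact (measurable_heat.comp (f := fun q : (ℝ × ℝ) × ℝ => (q.1.1, q.1.2 - q.2))
    (by fun_prop)).stronglyMeasurable

lemma measurable_sm1 : Measurable (fun p : ℝ × ℝ => sm1 μ p.1 p.2) := by
  refine StronglyMeasurable.measurable ?_
  refine StronglyMeasurable.integral_prod_right
    (f := fun (p : ℝ × ℝ) (y : ℝ) => heat1 p.1 (p.2 - y)) ?_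
  exact (measurable_heat1.comp (f := fun q : (ℝ × ℝ) × ℝ => (q.1.1, q.1.2 - q.2))
    (by fun_prop)).stronglyMeasurable

lemma measurable_sm2 : Measurable (fun p : ℝ × ℝ => sm2 μ p.1 p.2) := by
  refine StronglyMeasurable.measurable ?_
  refine StronglyMeasurable.integral_prod_right
    (f := fun (p : ℝ × ℝ) (y : ℝ) => heat2 p.1 (p.2 - y)) ?_
  exact (measurable_heat2.comp (f := fun q : (ℝ × ℝ) × ℝ => (q.1.1, q.1.2 - q.2))
    (by fun_prop)).stronglyMeasurable

lemma hasDerivAt_sm {t : ℝ} (ht : 0 < t) (x : ℝ) : HasDerivAt (sm μ t) (sm1 μ t x) x := by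
  obtain ⟨C, -, h⟩ := exists_heat_bound_const ht le_rfl
  refine (hasDerivAt_integral_of_dominated_loc_of_deriv_le (bound := fun _ => C)
    (F := fun x y => heat t (x - y)) (F' := fun x y => heat1 t (x - y)) univ_mem
    (.of_forall fun x => ?_) (integrable_heat μ ht x) ?_ ?_ (integrable_const _) ?_).2
  · exact ((continuous_heat t).comp (by fun_prop)).aestronglyMeasurable
  · exact ((continuous_heat1 t).comp (by fun_prop)).aestronglyMeasurable
  · exact .of_forall fun y z _ => (h t ⟨le_rfl, le_rfl⟩ _).2.1
  · exact .of_forall fun y z _ => (hasDerivAt_heat t (z - y)).comp_sub_const z y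

lemma hasDerivAt_sm1 {t : ℝ} (ht : 0 < t) (x : ℝ) : HasDerivAt (sm1 μ t) (sm2 μ t x) x := by
  obtain ⟨C, -, h⟩ := exists_heat_bound_const ht le_rfl
  refine (hasDerivAt_integral_of_dominated_loc_of_deriv_le (bound := fun _ => C)
    (F := fun x y => heat1 t (x - y)) (F' := fun x y => heat2 t (x - y)) univ_mem
    (.of_forall fun x => ?_) (integrable_heat1 μ ht x) ?_ ?_ (integrable_const _) ?_).2
  · exact ((continuous_heat1 t).comp (by fun_prop)).aestronglyMeasurable
  · exact ((continuous_heat2 t).comp (by fun_prop)).aestronglyMeasurable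
  · exact .of_forall fun y z _ => (h t ⟨le_rfl, le_rfl⟩ _).2.2
  · exact .of_forall fun y z _ => (hasDerivAt_heat1 t (z - y)).comp_sub_const z y

/-- The heat equation ∂ₜ = ½ ∂ₓₓ, inherited from the kernel; its second derivative is bounded
uniformly for times in [t/2, 2t], which allows differentiation under the integral. -/
lemma hasDerivAt_sm_time {t : ℝ} (ht : 0 < t) (x : ℝ) :
    HasDerivAt (fun t => sm μ t x) (sm2 μ t x / 2) t := by
  obtain ⟨C, hC, h⟩ := exists_heat_bound_const (half_pos ht) (by linarith : t / 2 ≤ 2 * t)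
  have hs : Set.Icc (t / 2) (2 * t) ∈ 𝓝 t := Icc_mem_nhds (by linarith) (by linarith)
  have := (hasDerivAt_integral_of_dominated_loc_of_deriv_le (bound := fun _ => C) (μ := μ)
    (F := fun t y => heat t (x - y)) (F' := fun t y => heat2 t (x - y) / 2) hs
    (.of_forall fun t => ?_) (integrable_heat μ ht x) ?_ ?_ (integrable_const _) ?_).2
  · rwa [integral_div] at this
  · exact ((continuous_heat t).comp (by fun_prop)).aestronglyMeasurable
  · exact (((continuous_heat2 t).comp (by fun_prop)).div_const 2).aestronglyMeasurable
  · refine .of_forall fun y z hz => ?_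
    rw [norm_div, Real.norm_eq_abs, Real.norm_eq_abs, abs_two]
    have := (h z hz (x - y)).2.2
    linarith
  · exact .of_forall fun y z hz => hasDerivAt_heat_time (by linarith [hz.1]) (x - y)

/-- The majorant is again a smoothed density, at a later time, so it keeps unit mass and, when μ has
one, a finite second moment. This makes it usable as a dominating function on a whole time interval.
-/
lemma exists_sm_bound {a b : ℝ} (ha : 0 < a) (hab : a ≤ b) :
    ∃ C : ℝ, 0 < C ∧ ∀ t ∈ Set.Icc a b, ∀ x, sm μ t x ≤ C * sm μ (2 * b) x ∧
      |sm1 μ t x| ≤ C * sm μ (2 * b) x ∧ |sm2 μ t x| ≤ C * sm μ (2 * b) x := by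
  obtain ⟨C, hC, h⟩ := exists_heat_bound ha hab
  have hb : 0 < 2 * b := by linarith
  refine ⟨C, hC, fun t ht x => ?_⟩
  have hi : Integrable (fun y => C * heat (2 * b) (x - y)) μ := (integrable_heat μ hb x).const_mul C
  have he : C * sm μ (2 * b) x = ∫ y, C * heat (2 * b) (x - y) ∂μ := (integral_const_mul _ _).symm
  rw [he]
  refine ⟨integral_mono (integrable_heat μ (ha.trans_le ht.1) x) hi fun y => (h t ht _).1, ?_, ?_⟩
  · exact norm_integral_le_of_norm_le (f := fun y => heat1 t (x - y)) hi
      (.of_forall fun y => (h t ht _).2.1)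
  · exact norm_integral_le_of_norm_le (f := fun y => heat2 t (x - y)) hi
      (.of_forall fun y => (h t ht _).2.2)

open scoped MeasureTheory in
lemma conv_gaussianReal_eq_withDensity {t : ℝ≥0} (ht : t ≠ 0) :
    μ ∗ gaussianReal 0 t = volume.withDensity (fun x => ENNReal.ofReal (sm μ t x)) := by
  have ht' : (0 : ℝ) < t := NNReal.coe_pos.2 (pos_iff_ne_zero.2 ht)
  ext s hs
  rw [withDensity_apply _ hs, ← lintegral_indicator_one hs,
    Measure.lintegral_conv (measurable_one.indicator hs)]
  have e1 : ∀ y : ℝ, ∫⁻ z, s.indicator (1 : ℝ → ℝ≥0∞) (y + z) ∂gaussianReal 0 t =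
      ∫⁻ x in s, ENNReal.ofReal (heat t (x - y)) := by
    intro y
    have h1 : ∫⁻ z, s.indicator (1 : ℝ → ℝ≥0∞) (y + z) ∂gaussianReal 0 t =
        ∫⁻ x, s.indicator (1 : ℝ → ℝ≥0∞) x ∂(gaussianReal 0 t).map (y + ·) :=
      (lintegral_map (measurable_one.indicator hs) (by fun_prop)).symm
    rw [h1, gaussianReal_map_const_add, lintegral_indicator_one hs, zero_add,
      gaussianReal_apply _ ht]
    simp only [heat_eq_gaussianPDFReal, gaussianPDF]
  simp_rw [e1]
  rw [lintegral_lintegral_swap]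
  · refine lintegral_congr fun x => ?_
    rw [sm, ofReal_integral_eq_lintegral_ofReal (integrable_heat μ ht' x)
      (.of_forall fun y => heat_nonneg _ _)]
  · refine Measurable.aemeasurable ?_
    exact (measurable_heat.comp (f := fun q : ℝ × ℝ => ((t : ℝ), q.2 - q.1))
      (by fun_prop)).ennreal_ofReal

/-- Cauchy–Schwarz in the form of a nonnegative square: with l = f'/f, the integrand ((x - y)/t +
l)² times the kernel is nonnegative. The right side has total integral 1/t, so the Fisher
information is at most 1/t, and the gap between the two sides is a nonnegative function to which
Fatou applies later. -/
lemma sm1_sq_div_sm_le {t : ℝ} (ht : 0 < t) (x : ℝ) :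
    sm1 μ t x ^ 2 / sm μ t x ≤ sm2 μ t x + sm μ t x / t := by
  set l := sm1 μ t x / sm μ t x with hl
  have hpos := sm_pos μ ht x
  have i0 := integrable_heat μ ht x
  have i1 := integrable_heat1 μ ht x
  have i2 := integrable_heat2 μ ht x
  have key : 0 ≤ ∫ y, (heat2 t (x - y) + heat t (x - y) / t - 2 * l * heat1 t (x - y) +
      l ^ 2 * heat t (x - y)) ∂μ := by
    refine integral_nonneg fun y => ?_
    have : heat2 t (x - y) + heat t (x - y) / t - 2 * l * heat1 t (x - y) +
      l ^ 2 * heat t (x - y) = ((x - y) / t + l) ^ 2 * heat t (x - y) := by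
      unfold heat2 heat1; ring
    simp only [Pi.zero_apply, this]
    exact mul_nonneg (sq_nonneg _) (heat_nonneg _ _)
  rw [integral_add (by fun_prop) (by fun_prop), integral_sub (by fun_prop) (by fun_prop),
    integral_add (by fun_prop) (by fun_prop), integral_div, integral_const_mul,
    integral_const_mul] at key
  change 0 ≤ sm2 μ t x + sm μ t x / t - 2 * l * sm1 μ t x + l ^ 2 * sm μ t x at key
  have : - (2 * l * sm1 μ t x) + l ^ 2 * sm μ t x = - (sm1 μ t x ^ 2 / sm μ t x) := by
    rw [hl]; field_simp; ring
  linarith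

end Smoothing

end

section

/-! ### Moments and integrability of smoothed densities -/

section Moments

variable (μ : Measure ℝ) [IsProbabilityMeasure μ]

lemma memLp_id_conv {ν : Measure ℝ} [IsProbabilityMeasure ν]
    (hμ : MemLp id 2 μ) (hν : MemLp id 2 ν) : MemLp id 2 (μ ∗ ν) := by
  have h : MemLp (fun p : ℝ × ℝ => p.1 + p.2) 2 (μ.prod ν) := by
    refine MemLp.add (f := fun p : ℝ × ℝ => p.1) (g := fun p : ℝ × ℝ => p.2) ?_ ?_
    · exact hμ.comp_fst ν
    · exact hν.comp_snd μ
  rw [Measure.conv]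
  exact (memLp_map_measure_iff (by fun_prop) (by fun_prop)).2 h

lemma integral_sq_conv {ν : Measure ℝ} [IsProbabilityMeasure ν]
    (hμ : MemLp id 2 μ) (hν : MemLp id 2 ν) (hν0 : ∫ x, x ∂ν = 0) :
    ∫ x, x ^ 2 ∂(μ ∗ ν) = ∫ x, x ^ 2 ∂μ + ∫ x, x ^ 2 ∂ν := by
  have iν : Integrable (fun x : ℝ => x) ν := hν.integrable one_le_two
  have iν2 : Integrable (fun x : ℝ => x ^ 2) ν := hν.integrable_sq
  have ic : Integrable (fun x : ℝ => x ^ 2) (μ ∗ ν) := (memLp_id_conv μ hμ hν).integrable_sq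
  rw [integral_conv ic]
  have : ∀ x : ℝ, ∫ y, (x + y) ^ 2 ∂ν = x ^ 2 + ∫ y, y ^ 2 ∂ν := by
    intro x
    have e : ∀ y : ℝ, (x + y) ^ 2 = x ^ 2 + 2 * x * y + y ^ 2 := fun y => by ring
    simp_rw [e]
    have i1 : Integrable (fun y : ℝ => 2 * x * y) ν := iν.const_mul _
    have i2 : Integrable (fun y : ℝ => x ^ 2 + 2 * x * y) ν := (integrable_const _).add i1
    rw [integral_add i2 iν2, integral_add (integrable_const _) i1, integral_const_mul, hν0]
    simp
  simp_rw [this]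
  have iμ2 : Integrable (fun x : ℝ => x ^ 2) μ := hμ.integrable_sq
  rw [integral_add iμ2 (integrable_const _)]
  simp

lemma integral_sq_gaussianReal (t : ℝ≥0) : ∫ x, x ^ 2 ∂gaussianReal 0 t = t := by
  have h := variance_fun_id_gaussianReal (μ := 0) (v := t)
  rw [variance_eq_integral (by fun_prop)] at h
  simpa using h

lemma integral_sq_conv_gaussianReal (hμ : MemLp id 2 μ) (t : ℝ≥0) :
    ∫ x, x ^ 2 ∂(μ ∗ gaussianReal 0 t) = ∫ x, x ^ 2 ∂μ + t := by
  rw [integral_sq_conv μ hμ (memLp_id_gaussianReal' 2 (by simp)) (by simp),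
    integral_sq_gaussianReal]

lemma integrable_sm_mul_iff {t : ℝ} (ht : 0 < t) (g : ℝ → ℝ) :
    Integrable (fun x => sm μ t x * g x) ↔ Integrable g (μ ∗ gaussianReal 0 t.toNNReal) := by
  have ht' : t.toNNReal ≠ 0 := by simpa using ht
  rw [conv_gaussianReal_eq_withDensity μ ht', Real.coe_toNNReal _ ht.le]
  have hm : Measurable (sm μ t) := (measurable_sm μ).comp measurable_prodMk_left
  rw [integrable_withDensity_iff_integrable_smul₀' hm.ennreal_ofReal.aemeasurable
    (.of_forall fun _ => ENNReal.ofReal_lt_top)]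
  simp only [ENNReal.toReal_ofReal (sm_nonneg μ t _), smul_eq_mul]

lemma integral_sm_mul {t : ℝ} (ht : 0 < t) (g : ℝ → ℝ) :
    ∫ x, sm μ t x * g x = ∫ x, g x ∂(μ ∗ gaussianReal 0 t.toNNReal) := by
  have ht' : t.toNNReal ≠ 0 := by simpa using ht
  rw [conv_gaussianReal_eq_withDensity μ ht', Real.coe_toNNReal _ ht.le]
  have hm : Measurable (sm μ t) := (measurable_sm μ).comp measurable_prodMk_left
  rw [integral_withDensity_eq_integral_toReal_smul₀ hm.ennreal_ofReal.aemeasurable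
    (.of_forall fun _ => ENNReal.ofReal_lt_top)]
  simp only [ENNReal.toReal_ofReal (sm_nonneg μ t _), smul_eq_mul]

lemma integrable_sm {t : ℝ} (ht : 0 < t) : Integrable (sm μ t) := by
  have := (integrable_sm_mul_iff μ ht (fun _ => 1)).2 (integrable_const _)
  simpa using this

lemma integral_sm {t : ℝ} (ht : 0 < t) : ∫ x, sm μ t x = 1 := by
  have := integral_sm_mul μ ht (fun _ => 1)
  simpa using this

lemma integrable_sm_mul_sq (hμ : MemLp id 2 μ) {t : ℝ} (ht : 0 < t) :
    Integrable (fun x => sm μ t x * (1 + x ^ 2)) := by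
  rw [integrable_sm_mul_iff μ ht]
  exact (integrable_const _).add
    (memLp_id_conv μ hμ (memLp_id_gaussianReal' 2 (by simp))).integrable_sq

/-- The logarithm of the smoothed density grows at most quadratically, locally uniformly in time. -/
lemma exists_abs_log_sm_le {a b : ℝ} (ha : 0 < a) (hab : a ≤ b) :
    ∃ C : ℝ, 0 < C ∧ ∀ t ∈ Set.Icc a b, ∀ x, |Real.log (sm μ t x)| ≤ C * (1 + x ^ 2) := by
  have hb : 0 < b := ha.trans_le hab
  -- More than half of the mass lies in a compact interval. The kernels centred there bound the
  -- density below by a Gaussian in x, hence its logarithm below by a quadratic; the maximum of the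
  -- kernel gives the upper bound.
  obtain ⟨K, hK⟩ : ∃ K : ℕ, 1 / 2 < μ (Set.Icc (-(K : ℝ)) K) := by
    have hmono : Monotone (fun K : ℕ => Set.Icc (-(K : ℝ)) K) := by
      intro i j hij
      have : (i : ℝ) ≤ j := by exact_mod_cast hij
      exact Set.Icc_subset_Icc (by linarith) this
    have hU : ⋃ K : ℕ, Set.Icc (-(K : ℝ)) K = Set.univ := by
      refine Set.eq_univ_of_forall fun x => ?_
      obtain ⟨n, hn⟩ := exists_nat_ge |x|
      exact Set.mem_iUnion.2 ⟨n, abs_le.1 hn⟩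
    have := tendsto_measure_iUnion_atTop (μ := μ) hmono
    rw [hU, measure_univ] at this
    exact ((this.eventually (lt_mem_nhds (by simp : (1 / 2 : ℝ≥0∞) < 1))).exists)
  have hK' : 1 / 2 ≤ μ.real (Set.Icc (-(K : ℝ)) K) := by
    have := (ENNReal.toReal_le_toReal (by simp) (measure_ne_top _ _)).2 hK.le
    simpa [Measure.real] using this
  set c : ℝ := 1 / 2 * (√(2 * Real.pi * b))⁻¹ with hc
  have hc0 : 0 < c := by positivity
  have lower : ∀ t ∈ Set.Icc a b, ∀ x, c * Real.exp (-(x ^ 2 + K ^ 2) / a) ≤ sm μ t x := by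
    intro t ht x
    have ht0 : 0 < t := ha.trans_le ht.1
    have h1 : ∀ y ∈ Set.Icc (-(K : ℝ)) K,
        (√(2 * Real.pi * b))⁻¹ * Real.exp (-(x ^ 2 + K ^ 2) / a) ≤ heat t (x - y) := by
      intro y hy
      unfold heat
      have hy2 : y ^ 2 ≤ (K : ℝ) ^ 2 := sq_le_sq' hy.1 hy.2
      have e1 : (√(2 * Real.pi * b))⁻¹ ≤ (√(2 * Real.pi * t))⁻¹ := by gcongr; exact ht.2
      have e2 : -(x ^ 2 + K ^ 2) / a ≤ -(x - y) ^ 2 / (2 * t) := by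
        rw [neg_div, neg_div, neg_le_neg_iff]
        calc (x - y) ^ 2 / (2 * t) ≤ (2 * (x ^ 2 + K ^ 2)) / (2 * t) := by
              gcongr; nlinarith [sq_nonneg (x + y)]
          _ = (x ^ 2 + K ^ 2) / t := by rw [mul_div_mul_left _ _ two_ne_zero]
          _ ≤ _ := by gcongr; exact ht.1
      gcongr
    calc c * Real.exp (-(x ^ 2 + K ^ 2) / a)
        = 1 / 2 * ((√(2 * Real.pi * b))⁻¹ * Real.exp (-(x ^ 2 + K ^ 2) / a)) := by rw [hc]; ring
      _ ≤ μ.real (Set.Icc (-(K : ℝ)) K) *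
          ((√(2 * Real.pi * b))⁻¹ * Real.exp (-(x ^ 2 + K ^ 2) / a)) := by gcongr
      _ = ∫ y in Set.Icc (-(K : ℝ)) K,
          ((√(2 * Real.pi * b))⁻¹ * Real.exp (-(x ^ 2 + K ^ 2) / a)) ∂μ := by
          rw [setIntegral_const, smul_eq_mul]
      _ ≤ ∫ y in Set.Icc (-(K : ℝ)) K, heat t (x - y) ∂μ :=
          setIntegral_mono_on (integrable_const _) (integrable_heat μ ht0 x).integrableOn
            measurableSet_Icc h1
      _ ≤ sm μ t x := setIntegral_le_integral (integrable_heat μ ht0 x)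
            (.of_forall fun y => heat_nonneg _ _)
  have upper : ∀ t ∈ Set.Icc a b, ∀ x, sm μ t x ≤ (√(2 * Real.pi * a))⁻¹ := by
    intro t ht x
    have ht0 : 0 < t := ha.trans_le ht.1
    calc sm μ t x ≤ ∫ y, (√(2 * Real.pi * a))⁻¹ ∂μ :=
          integral_mono (integrable_heat μ ht0 x) (integrable_const _) fun y =>
            (heat_le ht0.le _).trans (by gcongr; exact ht.1)
      _ = _ := by simp
  set U : ℝ := |Real.log (√(2 * Real.pi * a))⁻¹| with hU
  set L : ℝ := |Real.log c| with hL
  refine ⟨U + L + K ^ 2 / a + 1 / a, by positivity, fun t ht x => ?_⟩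
  have hp := sm_pos μ (ha.trans_le ht.1) x
  have h1 : Real.log (sm μ t x) ≤ U :=
    (Real.log_le_log hp (upper t ht x)).trans (le_abs_self _)
  have h2 : -L - (x ^ 2 + K ^ 2) / a ≤ Real.log (sm μ t x) := by
    have := Real.log_le_log (by positivity) (lower t ht x)
    rw [Real.log_mul hc0.ne' (Real.exp_pos _).ne', Real.log_exp, neg_div] at this
    linarith [neg_abs_le (Real.log c)]
  have q1 : 0 ≤ U := abs_nonneg _
  have q2 : 0 ≤ L := abs_nonneg _
  have q3 : 0 ≤ (K : ℝ) ^ 2 / a := by positivity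
  have q4 : 0 ≤ 1 / a := by positivity
  have q5 := sq_nonneg x
  have q6 : (x ^ 2 + K ^ 2) / a = 1 / a * x ^ 2 + K ^ 2 / a := by ring
  have q7 : (U + L + K ^ 2 / a + 1 / a) * (1 + x ^ 2) = U + L + K ^ 2 / a + 1 / a * x ^ 2 +
    (1 / a + (U + L + K ^ 2 / a) * x ^ 2) := by ring
  have q8 : 0 ≤ (U + L + K ^ 2 / a) * x ^ 2 := by positivity
  have q9 : 0 ≤ 1 / a * x ^ 2 := by positivity
  rw [q6] at h2
  rw [q7, abs_le]
  constructor <;> linarith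

end Moments

end

section

/-! ### The de Bruijn identity -/

/-- The Fisher information of `μ ∗ N(0, t)`. -/
def fisher (μ : Measure ℝ) (t : ℝ) : ℝ := ∫ x, sm1 μ t x ^ 2 / sm μ t x

/-- Minus the differential entropy of `μ ∗ N(0, t)`. -/
def negEnt (μ : Measure ℝ) (t : ℝ) : ℝ := ∫ x, sm μ t x * Real.log (sm μ t x)

section DeBruijn

variable (μ : Measure ℝ) [IsProbabilityMeasure μ]

lemma continuous_sm1 {t : ℝ} (ht : 0 < t) : Continuous (sm1 μ t) :=
  continuous_iff_continuousAt.2 fun x => (hasDerivAt_sm1 μ ht x).continuousAt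

lemma measurable_sm_right (t : ℝ) : Measurable (sm μ t) :=
  (measurable_sm μ).comp measurable_prodMk_left

lemma measurable_sm1_right (t : ℝ) : Measurable (sm1 μ t) :=
  (measurable_sm1 μ).comp measurable_prodMk_left

lemma measurable_sm2_right (t : ℝ) : Measurable (sm2 μ t) :=
  (measurable_sm2 μ).comp measurable_prodMk_left

lemma integrable_sm1 {t : ℝ} (ht : 0 < t) : Integrable (sm1 μ t) := by
  obtain ⟨C, -, h⟩ := exists_sm_bound μ ht le_rfl
  exact ((integrable_sm μ (by positivity : 0 < 2 * t)).const_mul C).mono'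
    (measurable_sm1_right μ t).aestronglyMeasurable
    (.of_forall fun x => (h t ⟨le_rfl, le_rfl⟩ x).2.1)

lemma integrable_sm2 {t : ℝ} (ht : 0 < t) : Integrable (sm2 μ t) := by
  obtain ⟨C, -, h⟩ := exists_sm_bound μ ht le_rfl
  exact ((integrable_sm μ (by positivity : 0 < 2 * t)).const_mul C).mono'
    (measurable_sm2_right μ t).aestronglyMeasurable
    (.of_forall fun x => (h t ⟨le_rfl, le_rfl⟩ x).2.2)

lemma integral_sm2 {t : ℝ} (ht : 0 < t) : ∫ x, sm2 μ t x = 0 :=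
  integral_eq_zero_of_hasDerivAt_of_integrable (hasDerivAt_sm1 μ ht) (integrable_sm2 μ ht)
    (integrable_sm1 μ ht)

lemma integrable_sm1_sq_div_sm {t : ℝ} (ht : 0 < t) :
    Integrable (fun x => sm1 μ t x ^ 2 / sm μ t x) := by
  refine ((integrable_sm2 μ ht).add ((integrable_sm μ ht).div_const t)).mono'
    (((measurable_sm1_right μ t).pow_const 2).div
      (measurable_sm_right μ t)).aestronglyMeasurable (.of_forall fun x => ?_)
  rw [Real.norm_of_nonneg (div_nonneg (sq_nonneg _) (sm_nonneg μ t x))]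
  exact sm1_sq_div_sm_le μ ht x

/-- Functions dominated by `(1 + x²)` times a smoothed density are integrable. -/
lemma integrable_of_log_bound (hμ : MemLp id 2 μ) {t C D : ℝ} (ht : 0 < t) (hC : 0 < C)
    {g k : ℝ → ℝ} (hg : Measurable g) (hk : Measurable k)
    (hgb : ∀ x, |g x| ≤ C * (1 + x ^ 2)) (hkb : ∀ x, |k x| ≤ D * sm μ t x) :
    Integrable (fun x => g x * k x) := by
  refine ((integrable_sm_mul_sq μ hμ ht).const_mul (C * D)).mono'
    (hg.mul hk).aestronglyMeasurable (.of_forall fun x => ?_)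
  rw [norm_mul]
  calc ‖g x‖ * ‖k x‖ ≤ (C * (1 + x ^ 2)) * (D * sm μ t x) := by
        gcongr
        · exact hgb x
        · exact hkb x
    _ = _ := by ring

lemma abs_one_add_log_le {C x l : ℝ} (h : |l| ≤ C * (1 + x ^ 2)) :
    |l + 1| ≤ (C + 1) * (1 + x ^ 2) := by
  calc |l + 1| ≤ |l| + |(1 : ℝ)| := abs_add_le _ _
    _ ≤ C * (1 + x ^ 2) + 1 := by rw [abs_one]; gcongr
    _ ≤ _ := by nlinarith [sq_nonneg x]

lemma integrable_sm_mul_log (hμ : MemLp id 2 μ) {t : ℝ} (ht : 0 < t) :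
    Integrable (fun x => sm μ t x * Real.log (sm μ t x)) := by
  obtain ⟨C, hC, h⟩ := exists_abs_log_sm_le μ ht le_rfl
  have hm := measurable_sm_right μ t
  have := integrable_of_log_bound (D := 1) μ hμ ht hC hm.log hm (h t ⟨le_rfl, le_rfl⟩)
    (fun x => by rw [one_mul, abs_of_nonneg (sm_nonneg μ t x)])
  simpa only [mul_comm] using this

/-- Integration by parts moves one derivative from f'' to log f. No boundary terms survive because
all the products are integrable. The summand 1 comes from differentiating f log f and does not
affect the integral. -/
lemma integral_log_mul_sm2 (hμ : MemLp id 2 μ) {t : ℝ} (ht : 0 < t) :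
    ∫ x, (Real.log (sm μ t x) + 1) * sm2 μ t x = - fisher μ t := by
  obtain ⟨C, hC, h⟩ := exists_abs_log_sm_le μ ht le_rfl
  obtain ⟨D, hD, h'⟩ := exists_sm_bound μ ht le_rfl
  have hm := measurable_sm_right μ t
  have h1 : ∀ x, |Real.log (sm μ t x) + 1| ≤ (C + 1) * (1 + x ^ 2) := fun x =>
    abs_one_add_log_le (h t ⟨le_rfl, le_rfl⟩ x)
  have h2t : 0 < 2 * t := by positivity
  have hd : ∀ x, HasDerivAt (fun x => Real.log (sm μ t x) + 1) (sm1 μ t x / sm μ t x) x := fun x =>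
    ((hasDerivAt_sm μ ht x).log (sm_pos μ ht x).ne').add_const 1
  have e : ∀ x, sm1 μ t x / sm μ t x * sm1 μ t x = sm1 μ t x ^ 2 / sm μ t x := fun x => by ring
  have := integral_mul_deriv_eq_deriv_mul_of_integrable (fun x _ => hd x)
    (fun x _ => hasDerivAt_sm1 μ ht x)
    (integrable_of_log_bound μ hμ h2t (by positivity) (hm.log.add_const 1)
      (measurable_sm2_right μ t) h1 (fun x => (h' t ⟨le_rfl, le_rfl⟩ x).2.2))
    (by
      simp only [Pi.mul_def, e]
      exact integrable_sm1_sq_div_sm μ ht)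
    (integrable_of_log_bound μ hμ h2t (by positivity) (hm.log.add_const 1)
      (measurable_sm1_right μ t) h1 (fun x => (h' t ⟨le_rfl, le_rfl⟩ x).2.1))
  rw [this]
  simp only [e, fisher]

/-- The **de Bruijn identity**, in integrated form. -/
lemma negEnt_sub_negEnt (hμ : MemLp id 2 μ) {a b : ℝ} (ha : 0 < a) (hab : a ≤ b) :
    IntervalIntegrable (fisher μ) volume a b ∧
    negEnt μ a - negEnt μ b = (∫ t in a..b, fisher μ t) / 2 := by
  have hb : 0 < b := ha.trans_le hab
  obtain ⟨C, hC, h⟩ := exists_abs_log_sm_le μ ha hab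
  obtain ⟨D, hD, h'⟩ := exists_sm_bound μ ha hab
  -- By the heat equation, F is the time derivative of f log f. Integrating it over [a, b] × ℝ in
  -- both orders gives the entropy difference and the integrated Fisher information.
  set F : ℝ × ℝ → ℝ := fun p => (Real.log (sm μ p.2 p.1) + 1) * (sm2 μ p.2 p.1 / 2) with hF
  have hFm : Measurable F := by
    have m1 := (measurable_sm μ).comp (measurable_swap (α := ℝ) (β := ℝ))
    have m2 := (measurable_sm2 μ).comp (measurable_swap (α := ℝ) (β := ℝ))
    have m3 := (m1.log.add_const 1).mul (m2.div_const 2)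
    exact m3
  have hFb : ∀ x, ∀ t ∈ Set.Icc a b, |F (x, t)| ≤ (C + 1) * D * (sm μ (2 * b) x * (1 + x ^ 2)) := by
    intro x t ht
    have q1 := abs_one_add_log_le (h t ht x)
    have q2 := (h' t ht x).2.2
    simp only [hF]
    rw [abs_mul, abs_div, abs_two]
    have q3 : |sm2 μ t x| / 2 ≤ D * sm μ (2 * b) x := by
      have := abs_nonneg (sm2 μ t x); linarith
    calc _ ≤ ((C + 1) * (1 + x ^ 2)) * (D * sm μ (2 * b) x) := by gcongr
      _ = _ := by ring
  have hint : Integrable F (volume.prod (volume.restrict (Set.Ioc a b))) := by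
    have hg : Integrable (fun p : ℝ × ℝ => (C + 1) * D * (sm μ (2 * b) p.1 * (1 + p.1 ^ 2)))
        (volume.prod (volume.restrict (Set.Ioc a b))) :=
      ((integrable_sm_mul_sq μ hμ (by positivity : 0 < 2 * b)).const_mul _).comp_fst _
    refine hg.mono' hFm.aestronglyMeasurable ?_
    rw [← Measure.restrict_univ (μ := (volume : Measure ℝ)), Measure.restrict_restrict (by simp),
      Set.inter_univ, Measure.prod_restrict]
    filter_upwards [ae_restrict_mem (MeasurableSet.univ.prod measurableSet_Ioc)] with p hp
    exact hFb p.1 p.2 (Set.Ioc_subset_Icc_self hp.2)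
  have hx : ∀ x, ∫ t in a..b, F (x, t) =
      sm μ b x * Real.log (sm μ b x) - sm μ a x * Real.log (sm μ a x) := by
    intro x
    refine intervalIntegral.integral_eq_sub_of_hasDerivAt
      (f := fun t => sm μ t x * Real.log (sm μ t x)) (fun t ht => ?_) ?_
    · rw [Set.uIcc_of_le hab] at ht
      have ht0 := ha.trans_le ht.1
      have hd := hasDerivAt_sm_time μ ht0 x
      refine (hd.mul (hd.log (sm_pos μ ht0 x).ne')).congr_deriv ?_
      have := (sm_pos μ ht0 x).ne'
      simp only [hF]
      field_simp
    · rw [intervalIntegrable_iff_integrableOn_Ioc_of_le hab]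
      refine IntegrableOn.of_bound (by simp)
        (hFm.comp (by fun_prop : Measurable fun t : ℝ => (x, t))).aestronglyMeasurable
        ((C + 1) * D * (sm μ (2 * b) x * (1 + x ^ 2))) ?_
      filter_upwards [ae_restrict_mem measurableSet_Ioc] with t ht
      exact hFb x t (Set.Ioc_subset_Icc_self ht)
  have ht : ∀ t ∈ Set.Ioc a b, ∫ x, F (x, t) = - fisher μ t / 2 := by
    intro t ht
    have := integral_log_mul_sm2 μ hμ (ha.trans ht.1)
    simp only [hF, ← mul_div_assoc]
    rw [integral_div, this]
  constructor
  · rw [intervalIntegrable_iff_integrableOn_Ioc_of_le hab]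
    have := (hint.integral_prod_right).const_mul (-2)
    refine IntegrableOn.congr_fun this (fun t htt => ?_) measurableSet_Ioc
    simp only [ht t htt]; ring
  · have hsw := integral_integral_swap (f := fun x t => F (x, t)) hint
    simp_rw [← intervalIntegral.integral_of_le hab, hx] at hsw
    rw [integral_sub (integrable_sm_mul_log μ hμ hb) (integrable_sm_mul_log μ hμ ha),
      intervalIntegral.integral_of_le hab, setIntegral_congr_fun measurableSet_Ioc ht,
      ← intervalIntegral.integral_of_le hab, intervalIntegral.integral_div,
      intervalIntegral.integral_neg] at hsw
    unfold negEnt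
    linarith

end DeBruijn

end

section

/-! ### Fisher information and relative entropy of smoothed measures -/

section Entropy

/-- Densities of one law agree almost everywhere, and continuous functions that agree almost
everywhere are equal. Hence the infimum in `fisherInfo` is over at most one function. -/
lemma IsC1Density.unique {f g : ℝ → ℝ} {ν : Measure ℝ} (hf : IsC1Density f ν)
    (hg : IsC1Density g ν) [IsFiniteMeasure ν] : f = g := by
  have hfm : Measurable f := hf.1.continuous.measurable
  have hgm : Measurable g := hg.1.continuous.measurable
  have h : volume.withDensity (fun x => ENNReal.ofReal (f x)) =
      volume.withDensity (fun x => ENNReal.ofReal (g x)) := hf.2.2.symm.trans hg.2.2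
  have hfin : ∫⁻ x, ENNReal.ofReal (f x) ≠ ∞ := by
    have := hf.2.2 ▸ (measure_ne_top ν Set.univ)
    rwa [withDensity_apply _ MeasurableSet.univ, Measure.restrict_univ] at this
  have hae := (withDensity_eq_iff hfm.ennreal_ofReal.aemeasurable
    hgm.ennreal_ofReal.aemeasurable hfin).1 h
  refine (Continuous.ae_eq_iff_eq volume hf.1.continuous hg.1.continuous).1 ?_
  filter_upwards [hae] with x hx
  exact (ENNReal.ofReal_eq_ofReal_iff (hf.2.1 x) (hg.2.1 x)).1 hx

variable (μ : Measure ℝ) [IsProbabilityMeasure μ]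

lemma isC1Density_sm {t : ℝ≥0} (ht : t ≠ 0) :
    IsC1Density (sm μ t) (μ ∗ gaussianReal 0 t) := by
  have ht' : (0 : ℝ) < t := NNReal.coe_pos.2 (pos_iff_ne_zero.2 ht)
  refine ⟨?_, sm_nonneg μ t, conv_gaussianReal_eq_withDensity μ ht⟩
  have hd : deriv (sm μ t) = sm1 μ t := funext fun x => (hasDerivAt_sm μ ht' x).deriv
  rw [contDiff_one_iff_deriv, hd]
  exact ⟨fun x => (hasDerivAt_sm μ ht' x).differentiableAt, continuous_sm1 μ ht'⟩

lemma fisherInfo_conv_gaussianReal {t : ℝ≥0} (ht : t ≠ 0) :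
    fisherInfo (μ ∗ gaussianReal 0 t) = ENNReal.ofReal (fisher μ t) := by
  have ht' : (0 : ℝ) < t := NNReal.coe_pos.2 (pos_iff_ne_zero.2 ht)
  have hC := isC1Density_sm μ ht
  have hval : ∫⁻ x, ENNReal.ofReal ((deriv (sm μ t) x / sm μ t x) ^ 2) ∂(μ ∗ gaussianReal 0 t) =
      ENNReal.ofReal (fisher μ t) := by
    have hm := measurable_sm_right μ t
    have hm1 := measurable_sm1_right μ t
    have hd : deriv (sm μ t) = sm1 μ t := funext fun x => (hasDerivAt_sm μ ht' x).deriv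
    have hm2 : Measurable (fun x => ENNReal.ofReal ((sm1 μ t x / sm μ t x) ^ 2)) :=
      ((hm1.div hm).pow_const 2).ennreal_ofReal
    rw [conv_gaussianReal_eq_withDensity μ ht, hd, lintegral_withDensity_eq_lintegral_mul _
      hm.ennreal_ofReal hm2, fisher,
      ofReal_integral_eq_lintegral_ofReal (integrable_sm1_sq_div_sm μ ht')
        (.of_forall fun x => div_nonneg (sq_nonneg _) (sm_nonneg μ t x))]
    refine lintegral_congr fun x => ?_
    simp only [Pi.mul_apply]
    rw [← ENNReal.ofReal_mul (sm_nonneg μ t x)]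
    congr 1
    have := (sm_pos μ ht' x).ne'
    field_simp
  rw [fisherInfo]
  refine le_antisymm ((iInf₂_le (sm μ t) hC).trans_eq hval) (le_iInf₂ fun f hf => ?_)
  rw [hf.unique hC, hval]

lemma log_heat {t : ℝ} (ht : 0 < t) (z : ℝ) :
    Real.log (heat t z) = -(Real.log (2 * Real.pi * t) / 2) - z ^ 2 / (2 * t) := by
  have hpos : 0 < 2 * Real.pi * t := by positivity
  unfold heat
  rw [Real.log_mul (by positivity) (Real.exp_pos _).ne', Real.log_exp, Real.log_inv,
    Real.log_sqrt hpos.le]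
  ring

/-- Smoothing by `N(0, t)` produces at least the entropy of `N(0, t)`. -/
lemma negEnt_le (hμ : MemLp id 2 μ) {t : ℝ} (ht : 0 < t) :
    negEnt μ t ≤ -(Real.log (2 * Real.pi * t) / 2) - 1 / 2 := by
  set c := Real.log (2 * Real.pi * t) / 2 with hc
  have hpt : ∀ x, sm μ t x * Real.log (sm μ t x) ≤
      -(c + 1 / 2) * sm μ t x - t / 2 * sm2 μ t x := by
    intro x
    set b := sm μ t x with hb
    have hb0 : 0 < b := sm_pos μ ht x
    have i0 := integrable_heat μ ht x
    have i2 := integrable_heat2 μ ht x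
    -- This is log(b/a) ≤ b/a - 1 for the kernel value a against its average b, so integrating in y
    -- reproduces Jensen's inequality for r log r. The quadratic term of log a is expressed through
    -- `heat2`, whose contribution integrates to zero in x.
    have hy : ∀ y, heat t (x - y) * (Real.log b + 1) - b ≤
        -(c + 1 / 2) * heat t (x - y) - t / 2 * heat2 t (x - y) := by
      intro y
      have ha := heat_pos ht (x - y)
      set a := heat t (x - y) with haa
      have h1 : Real.log (b / a) ≤ b / a - 1 := Real.log_le_sub_one_of_pos (by positivity)
      rw [Real.log_div hb0.ne' ha.ne', haa, log_heat ht, ← haa, ← hc] at h1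
      have h2 : heat2 t (x - y) = ((x - y) ^ 2 / t ^ 2 - 1 / t) * a := rfl
      have h3 : t / 2 * heat2 t (x - y) = ((x - y) ^ 2 / (2 * t) - 1 / 2) * a := by
        rw [h2]; field_simp
      have h4 := mul_le_mul_of_nonneg_left h1 ha.le
      have h5 : a * (b / a - 1) = b - a := by field_simp
      rw [h5] at h4
      rw [h3]
      linarith
    have hI := integral_mono (μ := μ) ((i0.mul_const (Real.log b + 1)).sub (integrable_const b))
      ((i0.const_mul (-(c + 1 / 2))).sub (i2.const_mul (t / 2))) hy
    simp only [Pi.sub_apply] at hI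
    rw [integral_sub (i0.mul_const _) (integrable_const b),
      integral_sub (i0.const_mul _) (i2.const_mul _), integral_mul_const, integral_const_mul,
      integral_const_mul] at hI
    change b * (Real.log b + 1) - ∫ _, b ∂μ ≤ -(c + 1 / 2) * b - t / 2 * sm2 μ t x at hI
    simp only [integral_const, probReal_univ, one_smul] at hI
    linarith
  have hI := integral_mono (integrable_sm_mul_log μ hμ ht)
    (((integrable_sm μ ht).const_mul (-(c + 1 / 2))).sub ((integrable_sm2 μ ht).const_mul (t / 2)))
    hpt
  simp only [Pi.sub_apply] at hI
  rw [integral_sub ((integrable_sm μ ht).const_mul _) ((integrable_sm2 μ ht).const_mul _),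
    integral_const_mul, integral_const_mul, integral_sm μ ht, integral_sm2 μ ht] at hI
  unfold negEnt
  linarith

/-- The logarithm of the Gaussian reference density is quadratic, so its mean under the smoothed law
depends only on the second moment s + a. Since this is also the variance of the reference law, the
relative entropy is the difference of two differential entropies. -/
lemma klDiv_conv_gaussianReal (hμ : MemLp id 2 μ) {s a : ℝ} (hs : ∫ x, x ^ 2 ∂μ = s)
    (hs0 : 0 ≤ s) (ha : 0 < a) :
    InformationTheory.klDiv (μ ∗ gaussianReal 0 a.toNNReal) (gaussianReal 0 (s + a).toNNReal) =
      ENNReal.ofReal (negEnt μ a + Real.log (2 * Real.pi * (s + a)) / 2 + 1 / 2) := by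
  have hsa : 0 < s + a := by positivity
  have ha' : a.toNNReal ≠ 0 := by simpa using ha
  have hsa' : (s + a).toNNReal ≠ 0 := by simpa using hsa
  set ρ := μ ∗ gaussianReal 0 a.toNNReal with hρ
  set γ := gaussianReal 0 (s + a).toNNReal with hγ
  have hfm := measurable_sm_right μ a
  have hhm : Measurable (heat (s + a)) := (continuous_heat _).measurable
  have hρd : ρ = volume.withDensity (fun x => ENNReal.ofReal (sm μ a x)) := by
    have := conv_gaussianReal_eq_withDensity μ ha'
    rwa [Real.coe_toNNReal _ ha.le] at this
  have hγd : γ = volume.withDensity (fun x => ENNReal.ofReal (heat (s + a) x)) := by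
    rw [hγ, gaussianReal_of_var_ne_zero _ hsa']
    congr 1; ext x
    rw [gaussianPDF, ← heat_eq_gaussianPDFReal, sub_zero, Real.coe_toNNReal _ hsa.le]
  have hrm : Measurable (fun x => ENNReal.ofReal (sm μ a x / heat (s + a) x)) :=
    (hfm.div hhm).ennreal_ofReal
  have hρg : ρ = γ.withDensity (fun x => ENNReal.ofReal (sm μ a x / heat (s + a) x)) := by
    rw [hρd, hγd, ← withDensity_mul _ hhm.ennreal_ofReal hrm]
    congr 1; ext x
    simp only [Pi.mul_apply]
    rw [← ENNReal.ofReal_mul (heat_nonneg _ _)]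
    congr 1
    have := (heat_pos hsa x).ne'
    field_simp
  have hac : ρ ≪ γ := by rw [hρg]; exact withDensity_absolutelyContinuous _ _
  have hrn : ρ.rnDeriv γ =ᵐ[γ] fun x => ENNReal.ofReal (sm μ a x / heat (s + a) x) := by
    rw [hρg]; exact Measure.rnDeriv_withDensity _ hrm
  set l : ℝ → ℝ := fun x => Real.log (sm μ a x) + (Real.log (2 * Real.pi * (s + a)) / 2 +
    x ^ 2 / (2 * (s + a))) with hl
  have hllr : llr ρ γ =ᵐ[ρ] l := by
    filter_upwards [hac.ae_le hrn] with x hx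
    rw [llr, hx, ENNReal.toReal_ofReal (div_nonneg (sm_nonneg _ _ _) (heat_nonneg _ _)),
      Real.log_div (sm_pos μ ha x).ne' (heat_pos hsa x).ne', log_heat hsa]
    simp only [hl]; ring
  have i1 : Integrable (fun x => Real.log (sm μ a x)) ρ :=
    (integrable_sm_mul_iff μ ha _).1 (integrable_sm_mul_log μ hμ ha)
  have i2 : Integrable (fun x : ℝ => x ^ 2) ρ :=
    (memLp_id_conv μ hμ (memLp_id_gaussianReal' 2 (by simp))).integrable_sq
  have i3 : Integrable (fun x : ℝ => x ^ 2 / (2 * (s + a))) ρ := i2.div_const _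
  have i4 : Integrable (fun x : ℝ => Real.log (2 * Real.pi * (s + a)) / 2 +
    x ^ 2 / (2 * (s + a))) ρ := (integrable_const _).add i3
  have il : Integrable l ρ := i1.add i4
  rw [InformationTheory.klDiv_of_ac_of_integrable hac (il.congr hllr.symm), integral_congr_ae hllr]
  congr 1
  simp only [hl]
  have e3 : ∫ x, x ^ 2 / (2 * (s + a)) ∂ρ = (s + a) / (2 * (s + a)) := by
    rw [integral_div, integral_sq_conv_gaussianReal μ hμ, hs, Real.coe_toNNReal _ ha.le]
  rw [integral_add i1 i4, integral_add (integrable_const _) i3, e3, hρ,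
    ← integral_sm_mul μ ha (fun x => Real.log (sm μ a x))]
  simp only [integral_const, probReal_univ, one_smul, negEnt]
  field_simp
  ring

/-- Run the flow from a to b. The term 1/(s + t) is the Fisher information of the matching Gaussian
and integrates to a logarithm, while `negEnt_le` bounds the entropy left at time b by log(1 +
s/b)/2, which vanishes as b → ∞. -/
lemma klDiv_conv_le_lintegral (hμ : MemLp id 2 μ) {s a : ℝ} (hs : ∫ x, x ^ 2 ∂μ = s)
    (hs0 : 0 ≤ s) (ha : 0 < a) :
    InformationTheory.klDiv (μ ∗ gaussianReal 0 a.toNNReal) (gaussianReal 0 (s + a).toNNReal) ≤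
      ∫⁻ t in Set.Ioi 0, ENNReal.ofReal (fisher μ t - 1 / (s + t)) := by
  have hsa : 0 < s + a := by positivity
  have main : ∀ b, a ≤ b →
      InformationTheory.klDiv (μ ∗ gaussianReal 0 a.toNNReal) (gaussianReal 0 (s + a).toNNReal) ≤
      ENNReal.ofReal (Real.log (1 + s / b) / 2) +
        ∫⁻ t in Set.Ioi 0, ENNReal.ofReal (fisher μ t - 1 / (s + t)) := by
    intro b hab
    have hb : 0 < b := ha.trans_le hab
    have hsb : 0 < s + b := by positivity
    obtain ⟨hfi, hdb⟩ := negEnt_sub_negEnt μ hμ ha hab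
    have hne := negEnt_le μ hμ hb
    have hd : ∀ t ∈ Set.uIcc a b, HasDerivAt (fun t => Real.log (s + t)) (1 / (s + t)) t := by
      intro t ht
      rw [Set.uIcc_of_le hab] at ht
      have : 0 < s + t := by linarith [ht.1]
      exact ((hasDerivAt_id t).const_add s).log this.ne'
    have hci : IntervalIntegrable (fun t => 1 / (s + t)) volume a b := by
      refine ContinuousOn.intervalIntegrable fun t ht => ?_
      rw [Set.uIcc_of_le hab] at ht
      have : s + t ≠ 0 := by linarith [ht.1]
      exact ContinuousAt.continuousWithinAt (by fun_prop (disch := assumption))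
    have hlog := intervalIntegral.integral_eq_sub_of_hasDerivAt hd hci
    have hsub := intervalIntegral.integral_sub hfi hci
    rw [klDiv_conv_gaussianReal μ hμ hs hs0 ha]
    have hle : negEnt μ a + Real.log (2 * Real.pi * (s + a)) / 2 + 1 / 2 ≤
        Real.log (1 + s / b) / 2 + (∫ t in a..b, (fisher μ t - 1 / (s + t))) / 2 := by
      have e1 : 1 + s / b = (s + b) / b := by field_simp; ring
      rw [e1, Real.log_div hsb.ne' hb.ne']
      rw [Real.log_mul (by positivity) hsa.ne']
      rw [Real.log_mul (by positivity) hb.ne'] at hne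
      linarith
    refine (ENNReal.ofReal_le_ofReal hle).trans (ENNReal.ofReal_add_le.trans ?_)
    gcongr
    calc ENNReal.ofReal ((∫ t in a..b, (fisher μ t - 1 / (s + t))) / 2)
        ≤ ENNReal.ofReal (∫ t in a..b, (fisher μ t - 1 / (s + t))) := by
          rcases le_or_gt 0 (∫ t in a..b, (fisher μ t - 1 / (s + t))) with h | h
          · exact ENNReal.ofReal_le_ofReal (by linarith)
          · rw [ENNReal.ofReal_of_nonpos (by linarith)]; simp
      _ ≤ ∫⁻ t in Set.Ioc a b, ENNReal.ofReal (fisher μ t - 1 / (s + t)) := by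
          rw [intervalIntegral.integral_of_le hab, integral_eq_lintegral_pos_part_sub_lintegral_neg_part
            ((intervalIntegrable_iff_integrableOn_Ioc_of_le hab).1 (hfi.sub hci))]
          refine ENNReal.ofReal_le_of_le_toReal (sub_le_self _ ENNReal.toReal_nonneg)
      _ ≤ _ := lintegral_mono_set fun t ht => ha.trans ht.1
  have hlim : Tendsto (fun b : ℝ => ENNReal.ofReal (Real.log (1 + s / b) / 2) +
        ∫⁻ t in Set.Ioi 0, ENNReal.ofReal (fisher μ t - 1 / (s + t))) atTop
      (𝓝 (0 + ∫⁻ t in Set.Ioi 0, ENNReal.ofReal (fisher μ t - 1 / (s + t)))) := by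
    refine Tendsto.add ?_ tendsto_const_nhds
    have h1 : Tendsto (fun b : ℝ => 1 + s / b) atTop (𝓝 (1 + 0)) :=
      tendsto_const_nhds.add (tendsto_const_nhds.div_atTop tendsto_id)
    have h2 := ((h1.log (by norm_num)).div_const 2)
    simp only [add_zero, Real.log_one, zero_div] at h2
    simpa using ENNReal.tendsto_ofReal h2
  rw [zero_add] at hlim
  exact ge_of_tendsto hlim ((eventually_ge_atTop a).mono main)

end Entropy

end

section

/-! ### Variational characterisation of relative entropy -/

section Variational

/-- Fenchel–Young: r log r + 1 - r and exp h - 1 are convex conjugates, with equality at h = log r.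
-/
lemma mul_le_klFun_add_exp {r : ℝ} (hr : 0 ≤ r) (h : ℝ) :
    r * h ≤ InformationTheory.klFun r + (Real.exp h - 1) := by
  rw [InformationTheory.klFun_apply]
  rcases hr.eq_or_lt with rfl | hr
  · simp [Real.exp_nonneg]
  · have h1 := Real.add_one_le_exp (h - Real.log r)
    have h2 : Real.exp h = r * Real.exp (h - Real.log r) := by
      rw [Real.exp_sub, Real.exp_log hr]; field_simp
    have h3 := mul_le_mul_of_nonneg_left h1 hr.le
    rw [h2]; linarith

variable {α : Type*} [MeasurableSpace α] {μ ν : Measure α} [IsProbabilityMeasure μ]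
  [IsProbabilityMeasure ν]

/-- The **Gibbs variational inequality**, in its linearised form. -/
lemma integral_le_klDiv_add (hkl : InformationTheory.klDiv μ ν ≠ ∞) {h : α → ℝ}
    (hμ : Integrable h μ) (hν : Integrable (fun x => Real.exp (h x)) ν) :
    ∫ x, h x ∂μ ≤ (InformationTheory.klDiv μ ν).toReal + ∫ x, (Real.exp (h x) - 1) ∂ν := by
  obtain ⟨hac, hint⟩ := InformationTheory.klDiv_ne_top_iff.1 hkl
  have hk := (InformationTheory.integrable_klFun_rnDeriv_iff hac).2 hint
  have he : Integrable (fun x => Real.exp (h x) - 1) ν := hν.sub (integrable_const _)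
  rw [InformationTheory.toReal_klDiv_eq_integral_klFun hac, ← integral_add hk he,
    ← integral_rnDeriv_smul hac]
  refine integral_mono ((integrable_rnDeriv_smul_iff hac).2 hμ) (hk.add he) fun x => ?_
  exact mul_le_klFun_add_exp ENNReal.toReal_nonneg (h x)

lemma abs_exp_sub_exp_le {N x y : ℝ} (hx : x ≤ N) (hy : y ≤ N) :
    |Real.exp x - Real.exp y| ≤ Real.exp N * |x - y| := by
  wlog hxy : y ≤ x generalizing x y
  · rw [abs_sub_comm, abs_sub_comm x]; exact this hy hx (le_of_not_ge hxy)
  rw [abs_of_nonneg (sub_nonneg.2 (Real.exp_le_exp.2 hxy)), abs_of_nonneg (sub_nonneg.2 hxy)]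
  have h1 : Real.exp y = Real.exp x * Real.exp (y - x) := by rw [← Real.exp_add]; congr 1; ring
  have h2 := Real.add_one_le_exp (y - x)
  have h3 := mul_le_mul_of_nonneg_left h2 (Real.exp_pos x).le
  have h4 := mul_le_mul_of_nonneg_right (Real.exp_le_exp.2 hx) (sub_nonneg.2 hxy)
  rw [h1]; linarith

/-- If the variational inequality holds for bounded measurable functions, it bounds the
relative entropy. -/
lemma klDiv_le_of_forall_measurable {C : ℝ}
    (H : ∀ (N : ℕ) (h : α → ℝ), Measurable h → (∀ x, |h x| ≤ N) →
      ∫ x, h x ∂μ ≤ C + ∫ x, (Real.exp (h x) - 1) ∂ν) :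
    InformationTheory.klDiv μ ν ≤ ENNReal.ofReal C := by
  have hac : μ ≪ ν := by
    refine Measure.AbsolutelyContinuous.mk fun s hs hνs => ?_
    by_contra hne
    have hpos : 0 < μ.real s := ENNReal.toReal_pos hne (measure_ne_top _ _)
    -- On a ν-null set s the test function N · 1ₛ costs nothing under ν, so the hypothesis would
    -- give N μ(s) ≤ C for every N.
    obtain ⟨N, hN⟩ := exists_nat_gt (C / μ.real s)
    have h1 := H N (s.indicator fun _ => (N : ℝ)) (measurable_const.indicator hs) (fun x => by
      by_cases hx : x ∈ s <;> simp [hx])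
    have h2 : ∫ x, (Real.exp (s.indicator (fun _ => (N : ℝ)) x) - 1) ∂ν = 0 := by
      refine integral_eq_zero_of_ae ?_
      have : ∀ᵐ x ∂ν, x ∉ s := measure_eq_zero_iff_ae_notMem.1 hνs
      filter_upwards [this] with x hx
      simp [hx]
    rw [h2, integral_indicator_const _ hs, smul_eq_mul] at h1
    rw [div_lt_iff₀ hpos] at hN
    linarith
  set r : α → ℝ := fun x => (μ.rnDeriv ν x).toReal with hr
  have hrm : Measurable r := (Measure.measurable_rnDeriv _ _).ennreal_toReal
  have hr0 : ∀ x, 0 ≤ r x := fun x => ENNReal.toReal_nonneg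
  -- the truncated logarithm of the density
  set h : ℕ → α → ℝ := fun N x => if r x = 0 then -(N : ℝ) else
    max (-(N : ℝ)) (min N (Real.log (r x))) with hh
  have hhm : ∀ N, Measurable (h N) := fun N =>
    Measurable.ite (measurableSet_eq_fun hrm measurable_const) measurable_const
      (measurable_const.max (measurable_const.min hrm.log))
  have hhb : ∀ N x, |h N x| ≤ N := by
    intro N x
    have : (0 : ℝ) ≤ N := Nat.cast_nonneg N
    simp only [hh]
    split_ifs
    · simp
    · exact abs_le.2 ⟨le_max_left _ _, max_le (by linarith) (min_le_left _ _)⟩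
  set G : ℕ → α → ℝ := fun N x => r x * h N x - (Real.exp (h N x) - 1) with hG
  -- Nonnegativity is what Fatou needs. Where r > 0 the truncated value c lies between 0 and log r,
  -- so r c ≥ c exp c ≥ exp c - 1. Points with r = 0 have their own branch because `Real.log 0` is
  -- 0, whereas the truncation there should be -N.
  have hGnn : ∀ N x, 0 ≤ G N x := by
    intro N x
    have hN : (0 : ℝ) ≤ N := Nat.cast_nonneg N
    simp only [hG, hh]
    split_ifs with h0
    · have : Real.exp (-(N : ℝ)) ≤ 1 := Real.exp_le_one_iff.2 (by linarith)
      rw [h0]; linarith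
    · have hpos : 0 < r x := lt_of_le_of_ne (hr0 x) (Ne.symm h0)
      set c := max (-(N : ℝ)) (min N (Real.log (r x))) with hc
      have h1 := Real.add_one_le_exp (-c)
      have hec : Real.exp (-c) * Real.exp c = 1 := by rw [← Real.exp_add]; simp
      have h2 : (1 - c) * Real.exp c ≤ 1 := by
        rw [← hec]; gcongr; linarith
      have h3 : Real.exp c * c ≤ r x * c := by
        rcases le_total 0 (Real.log (r x)) with hl | hl
        · have c0 : 0 ≤ c := le_max_of_le_right (le_min hN hl)
          have : c ≤ Real.log (r x) := max_le (by linarith) (min_le_right _ _)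
          have : Real.exp c ≤ r x := by
            rw [← Real.exp_log hpos]; exact Real.exp_le_exp.2 this
          exact mul_le_mul_of_nonneg_right this c0
        · have c0 : c ≤ 0 := max_le (by linarith) ((min_le_right _ _).trans hl)
          have : Real.log (r x) ≤ c := le_max_of_le_right (le_min (hl.trans hN) le_rfl)
          have : r x ≤ Real.exp c := by
            rw [← Real.exp_log hpos]; exact Real.exp_le_exp.2 this
          exact mul_le_mul_of_nonpos_right this c0
      linarith
  have hGlim : ∀ x, Tendsto (fun N => G N x) atTop (𝓝 (InformationTheory.klFun (r x))) := by
    intro x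
    by_cases h0 : r x = 0
    · have : ∀ N, G N x = 1 - Real.exp (-(N : ℝ)) := fun N => by simp [hG, hh, h0]
      simp only [this, h0, InformationTheory.klFun_zero]
      have : Tendsto (fun N : ℕ => Real.exp (-(N : ℝ))) atTop (𝓝 0) :=
        Real.tendsto_exp_neg_atTop_nhds_zero.comp tendsto_natCast_atTop_atTop
      simpa using tendsto_const_nhds.sub this
    · refine tendsto_const_nhds.congr' ?_
      obtain ⟨N₀, hN₀⟩ := exists_nat_ge |Real.log (r x)|
      filter_upwards [eventually_ge_atTop N₀] with N hN
      have hN' : |Real.log (r x)| ≤ N := hN₀.trans (by exact_mod_cast hN)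
      have hN2 := abs_le.1 hN'
      simp only [hG, hh, h0, if_false]
      rw [min_eq_right hN2.2, max_eq_right hN2.1,
        Real.exp_log (lt_of_le_of_ne (hr0 x) (Ne.symm h0)), InformationTheory.klFun_apply]
      ring
  have hGle : ∀ N, ∫⁻ x, ENNReal.ofReal (G N x) ∂ν ≤ ENNReal.ofReal C := by
    intro N
    have hiμ : Integrable (h N) μ := Integrable.of_bound (hhm N).aestronglyMeasurable N
      (.of_forall (hhb N))
    have i1 : Integrable (fun x => r x * h N x) ν := (integrable_rnDeriv_smul_iff hac).2 hiμ
    have i2 : Integrable (fun x => Real.exp (h N x) - 1) ν := by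
      refine Integrable.sub ?_ (integrable_const _)
      refine Integrable.of_bound (hhm N).exp.aestronglyMeasurable (Real.exp N)
        (.of_forall fun x => ?_)
      rw [Real.norm_of_nonneg (Real.exp_nonneg _)]
      exact Real.exp_le_exp.2 (abs_le.1 (hhb N x)).2
    have iG : Integrable (G N) ν := i1.sub i2
    rw [← ofReal_integral_eq_lintegral_ofReal iG (.of_forall (hGnn N))]
    refine ENNReal.ofReal_le_ofReal ?_
    simp only [hG]
    have e : ∫ x, r x * h N x ∂ν = ∫ x, h N x ∂μ := integral_rnDeriv_smul hac
    rw [integral_sub i1 i2, e]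
    linarith [H N (h N) (hhm N) (hhb N)]
  rw [InformationTheory.klDiv_eq_lintegral_klFun_of_ac hac]
  calc ∫⁻ x, ENNReal.ofReal (InformationTheory.klFun (r x)) ∂ν
      = ∫⁻ x, liminf (fun N => ENNReal.ofReal (G N x)) atTop ∂ν :=
        lintegral_congr fun x => ((ENNReal.tendsto_ofReal (hGlim x)).liminf_eq).symm
    _ ≤ liminf (fun N => ∫⁻ x, ENNReal.ofReal (G N x) ∂ν) atTop :=
        lintegral_liminf_le fun N =>
          ((hrm.mul (hhm N)).sub ((hhm N).exp.sub measurable_const)).ennreal_ofReal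
    _ ≤ ENNReal.ofReal C := by
        refine liminf_le_of_le (by isBoundedDefault) fun b hb => ?_
        obtain ⟨N, hN⟩ := hb.exists
        exact hN.trans (hGle N)

end Variational

/-- If the variational inequality holds for bounded continuous functions, it bounds the
relative entropy. -/
lemma klDiv_le_of_forall_continuous {μ ν : Measure ℝ} [IsProbabilityMeasure μ]
    [IsProbabilityMeasure ν] {C : ℝ}
    (H : ∀ (N : ℕ) (h : ℝ → ℝ), Continuous h → (∀ x, |h x| ≤ N) →
      ∫ x, h x ∂μ ≤ C + ∫ x, (Real.exp (h x) - 1) ∂ν) :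
    InformationTheory.klDiv μ ν ≤ ENNReal.ofReal C := by
  refine klDiv_le_of_forall_measurable fun N h hm hb => ?_
  refine le_of_forall_pos_le_add fun ε hε => ?_
  -- An L¹ error δ costs δ on the μ side and exp(N) δ on the ν side; together they make exactly ε.
  set δ : ℝ := ε / (1 + Real.exp N) with hδ
  have hδ0 : 0 < δ := by positivity
  have hi : ∀ {ρ : Measure ℝ} [IsFiniteMeasure ρ] {k : ℝ → ℝ}, Measurable k → (∀ x, |k x| ≤ N) →
      Integrable k ρ := fun hk hkb => Integrable.of_bound hk.aestronglyMeasurable N (.of_forall hkb)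
  have hmem : MemLp h 1 (μ + ν) := memLp_one_iff_integrable.2 (hi hm hb)
  obtain ⟨g, hg, -⟩ := hmem.exists_boundedContinuous_eLpNorm_sub_le (by simp)
    (ε := ENNReal.ofReal δ) (by simpa using hδ0)
  -- Clipping to [-N, N] restores the bound required by `H` and makes exp Lipschitz with constant
  -- exp N. Since h already takes values there, clipping can only bring g closer to h.
  set k : ℝ → ℝ := fun x => max (-(N : ℝ)) (min N (g x)) with hk
  have hN0 : (0 : ℝ) ≤ N := Nat.cast_nonneg N
  have hkc : Continuous k := continuous_const.max (continuous_const.min g.continuous)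
  have hkb : ∀ x, |k x| ≤ N := fun x =>
    abs_le.2 ⟨le_max_left _ _, max_le (by linarith) (min_le_left _ _)⟩
  have hkh : ∀ x, |h x - k x| ≤ |h x - g x| := by
    intro x
    obtain ⟨h1, h2⟩ := abs_le.1 (hb x)
    simp only [hk]
    rcases le_total (g x) (-N) with q | q
    · rw [min_eq_right (by linarith), max_eq_left q, abs_of_nonneg (by linarith),
        abs_of_nonneg (by linarith)]; linarith
    rcases le_total (g x) N with q' | q'
    · rw [min_eq_right q', max_eq_right q]
    · rw [min_eq_left q', max_eq_right (by linarith), abs_of_nonpos (by linarith),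
        abs_of_nonpos (by linarith)]; linarith
  have hgi : Integrable (fun x => h x - g x) (μ + ν) :=
    (hi hm hb).sub (g.integrable _)
  have hsmall : ∫ x, |h x - g x| ∂(μ + ν) ≤ δ := by
    rw [eLpNorm_one_eq_lintegral_enorm] at hg
    have e := integral_norm_eq_lintegral_enorm hgi.1
    simp only [Real.norm_eq_abs] at e
    rw [e]
    exact ENNReal.toReal_le_of_le_ofReal hδ0.le hg
  have hpart : ∀ {ρ : Measure ℝ} [IsProbabilityMeasure ρ], ρ ≤ μ + ν →
      ∫ x, |h x - k x| ∂ρ ≤ δ := by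
    intro ρ _ hρ
    have hgi' : Integrable (fun x => h x - g x) ρ := hgi.mono_measure hρ
    calc ∫ x, |h x - k x| ∂ρ ≤ ∫ x, |h x - g x| ∂ρ :=
          integral_mono ((hi hm hb).sub (hi hkc.measurable hkb)).abs hgi'.abs hkh
      _ ≤ ∫ x, |h x - g x| ∂(μ + ν) :=
          integral_mono_measure hρ (.of_forall fun x => abs_nonneg _) hgi.abs
      _ ≤ δ := hsmall
  have hμ1 : ∫ x, h x ∂μ ≤ ∫ x, k x ∂μ + δ := by
    have i1 : Integrable h μ := hi hm hb
    have i2 : Integrable k μ := hi hkc.measurable hkb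
    have := (le_abs_self _).trans (abs_integral_le_integral_abs (f := fun x => h x - k x) (μ := μ))
    rw [integral_sub i1 i2] at this
    linarith [hpart (ρ := μ) (Measure.le_add_right le_rfl)]
  have hie : ∀ {k : ℝ → ℝ}, Measurable k → (∀ x, |k x| ≤ N) →
      Integrable (fun x => Real.exp (k x) - 1) ν := by
    intro k hk hkb
    refine Integrable.sub (Integrable.of_bound hk.exp.aestronglyMeasurable (Real.exp N)
      (.of_forall fun x => ?_)) (integrable_const _)
    rw [Real.norm_of_nonneg (Real.exp_nonneg _)]
    exact Real.exp_le_exp.2 (abs_le.1 (hkb x)).2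
  have hν1 : ∫ x, (Real.exp (k x) - 1) ∂ν ≤ ∫ x, (Real.exp (h x) - 1) ∂ν + Real.exp N * δ := by
    have iab : Integrable (fun x => Real.exp N * |h x - k x|) ν :=
      ((hi hm hb).sub (hi hkc.measurable hkb)).abs.const_mul _
    have hle : ∫ x, (Real.exp (k x) - 1) ∂ν ≤
        ∫ x, ((Real.exp (h x) - 1) + Real.exp N * |h x - k x|) ∂ν := by
      refine integral_mono (hie hkc.measurable hkb) ((hie hm hb).add iab) fun x => ?_
      have := (le_abs_self _).trans (abs_exp_sub_exp_le (abs_le.1 (hkb x)).2 (abs_le.1 (hb x)).2)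
      rw [abs_sub_comm] at this
      simp only
      linarith
    rw [integral_add (hie hm hb) iab, integral_const_mul] at hle
    have := mul_le_mul_of_nonneg_left (hpart (ρ := ν) (Measure.le_add_left le_rfl))
      (Real.exp_pos N).le
    linarith
  have hδε : δ + Real.exp N * δ = ε := by rw [hδ]; field_simp
  linarith [H N k hkc hkb]

end

section

/-! ### Entropy bounded by Fisher information; convergence of Fisher information -/

lemma tendsto_integral_of_tendsto_charFun {μ : ℕ → Measure ℝ} [∀ n, IsProbabilityMeasure (μ n)]
    {ν : Measure ℝ} [IsProbabilityMeasure ν]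
    (h : ∀ s, Tendsto (fun n => charFun (μ n) s) atTop (𝓝 (charFun ν s)))
    {f : ℝ → ℝ} (hf : Continuous f) {C : ℝ} (hC : ∀ x, |f x| ≤ C) :
    Tendsto (fun n => ∫ x, f x ∂μ n) atTop (𝓝 (∫ x, f x ∂ν)) := by
  let μ' : ℕ → ProbabilityMeasure ℝ := fun n => ⟨μ n, inferInstance⟩
  let ν' : ProbabilityMeasure ℝ := ⟨ν, inferInstance⟩
  have h1 : Tendsto μ' atTop (𝓝 ν') := ProbabilityMeasure.tendsto_iff_tendsto_charFun.2 h
  exact ProbabilityMeasure.tendsto_iff_forall_integral_tendsto.1 h1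
    (BoundedContinuousFunction.ofNormedAddCommGroup f hf C hC)

lemma charFun_gaussianReal_zero (v : ℝ≥0) (s : ℝ) :
    charFun (gaussianReal 0 v) s = Complex.exp (-(v * s ^ 2 / 2)) := by
  rw [charFun_gaussianReal]; simp

/-- The relative entropy from the normal law is bounded by the integrated excess Fisher
information along the heat flow. -/
theorem klDiv_gaussianReal_le_lintegral (μ : Measure ℝ) [IsProbabilityMeasure μ]
    (hμ : MemLp id 2 μ) {s : ℝ} (hs : ∫ x, x ^ 2 ∂μ = s) (hs0 : 0 ≤ s) :
    InformationTheory.klDiv μ (gaussianReal 0 s.toNNReal) ≤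
      ∫⁻ t in Set.Ioi 0, ENNReal.ofReal (fisher μ t - 1 / (s + t)) := by
  set K := ∫⁻ t in Set.Ioi 0, ENNReal.ofReal (fisher μ t - 1 / (s + t)) with hK
  by_cases hKt : K = ∞
  · rw [hKt]; exact le_top
  rw [← ENNReal.ofReal_toReal hKt]
  refine klDiv_le_of_forall_continuous fun N h hc hb => ?_
  -- For each fixed bounded continuous test function, the Gibbs inequality holds for the law
  -- smoothed by N(0, a n), with the bound K independent of n, and both sides converge as a n → 0.
  -- This is lower semicontinuity of relative entropy.
  set a : ℕ → ℝ := fun n => 1 / ((n : ℝ) + 1) with ha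
  have ha0 : ∀ n, 0 < a n := fun n => by simp only [ha]; positivity
  have hal : Tendsto a atTop (𝓝 0) := tendsto_one_div_add_atTop_nhds_zero_nat
  have l1 : Tendsto (fun n => ∫ x, h x ∂(μ ∗ gaussianReal 0 (a n).toNNReal)) atTop
      (𝓝 (∫ x, h x ∂μ)) := by
    refine tendsto_integral_of_tendsto_charFun (fun u => ?_) hc hb
    have : ∀ n, charFun (μ ∗ gaussianReal 0 (a n).toNNReal) u =
        charFun μ u * Complex.exp (-((a n : ℂ) * u ^ 2 / 2)) := by
      intro n
      rw [charFun_conv, charFun_gaussianReal_zero]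
      simp [(ha0 n).le]
    simp_rw [this]
    have h2 : Tendsto (fun n => Complex.exp (-((a n : ℂ) * u ^ 2 / 2))) atTop
        (𝓝 (Complex.exp (-((0 : ℝ) * u ^ 2 / 2)))) := by
      have : Continuous fun x : ℝ => Complex.exp (-((x : ℂ) * u ^ 2 / 2)) := by fun_prop
      exact (this.tendsto 0).comp hal
    simpa using tendsto_const_nhds.mul h2
  have hec : Continuous fun x => Real.exp (h x) - 1 := by fun_prop
  have heb : ∀ x, |Real.exp (h x) - 1| ≤ Real.exp N + 1 := by
    intro x
    have := Real.exp_le_exp.2 (abs_le.1 (hb x)).2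
    have h0 := Real.exp_pos (h x)
    rw [abs_le]; constructor <;> linarith
  have l2 : Tendsto (fun n => ∫ x, (Real.exp (h x) - 1) ∂(gaussianReal 0 (s + a n).toNNReal)) atTop
      (𝓝 (∫ x, (Real.exp (h x) - 1) ∂(gaussianReal 0 s.toNNReal))) := by
    refine tendsto_integral_of_tendsto_charFun (fun u => ?_) hec heb
    simp_rw [charFun_gaussianReal_zero]
    have : Continuous fun x : ℝ => Complex.exp (-(((s + x).toNNReal : ℂ) * u ^ 2 / 2)) := by
      have h3 : Continuous fun x : ℝ => (((s + x).toNNReal : ℝ≥0) : ℝ) := by fun_prop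
      have h4 : Continuous fun x : ℝ => ((((s + x).toNNReal : ℝ≥0) : ℝ) : ℂ) :=
        Complex.continuous_ofReal.comp h3
      have h5 := (((h4.mul continuous_const).div_const 2).neg).cexp (f := fun x : ℝ =>
        -(((((s + x).toNNReal : ℝ≥0) : ℝ) : ℂ) * u ^ 2 / 2))
      exact h5
    have h6 := (this.tendsto 0).comp hal
    simpa [Function.comp_def] using h6
  refine le_of_tendsto_of_tendsto' l1 (l2.const_add K.toReal) fun n => ?_
  have hle := klDiv_conv_le_lintegral μ hμ hs hs0 (ha0 n)
  rw [← hK] at hle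
  have hne := ne_top_of_le_ne_top hKt hle
  have := integral_le_klDiv_add hne
    (Integrable.of_bound hc.aestronglyMeasurable N (.of_forall hb))
    (h := h) (Integrable.of_bound (C := Real.exp N) (by fun_prop : Continuous fun x =>
      Real.exp (h x)).aestronglyMeasurable (.of_forall fun x => by
        rw [Real.norm_of_nonneg (Real.exp_nonneg _)]
        exact Real.exp_le_exp.2 (abs_le.1 (hb x)).2))
  have h7 := (ENNReal.toReal_le_toReal hne hKt).2 hle
  linarith

lemma measurable_fisher (μ : Measure ℝ) [IsProbabilityMeasure μ] : Measurable (fisher μ) := by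
  refine StronglyMeasurable.measurable ?_
  refine StronglyMeasurable.integral_prod_right
    (f := fun (t : ℝ) (x : ℝ) => sm1 μ t x ^ 2 / sm μ t x) ?_
  exact (((measurable_sm1 μ).pow_const 2).div (measurable_sm μ)).stronglyMeasurable

/-- For a point mass the square in `sm1_sq_div_sm_le` vanishes, so that bound is an equality and the
value 1/t can be read off. -/
lemma fisher_dirac {t : ℝ} (ht : 0 < t) : fisher (Measure.dirac 0) t = 1 / t := by
  have e : ∀ x, sm1 (Measure.dirac 0) t x ^ 2 / sm (Measure.dirac 0) t x =
      sm2 (Measure.dirac 0) t x + sm (Measure.dirac 0) t x / t := by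
    intro x
    have := (heat_pos ht x).ne'
    simp only [sm1, sm, sm2, integral_dirac, sub_zero]
    simp only [heat1, heat2]
    field_simp
    ring
  rw [fisher]
  simp_rw [e]
  rw [integral_add (integrable_sm2 _ ht) ((integrable_sm _ ht).div_const t), integral_sm2 _ ht,
    integral_div, integral_sm _ ht, zero_add]

lemma fisher_nonneg (μ : Measure ℝ) (t : ℝ) : 0 ≤ fisher μ t :=
  integral_nonneg fun x => div_nonneg (sq_nonneg _) (sm_nonneg μ t x)

/-- N(0, v) smoothed to time t and a point mass smoothed to time v + t are the same law, which
reduces the claim to `fisher_dirac`. -/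
lemma fisher_gaussianReal (v : ℝ≥0) {t : ℝ} (ht : 0 < t) :
    fisher (gaussianReal 0 v) t = 1 / (v + t) := by
  have hvt : (0 : ℝ) < v + t := by positivity
  have h1 := fisherInfo_conv_gaussianReal (gaussianReal 0 v) (t := t.toNNReal) (by simpa using ht)
  have h2 := fisherInfo_conv_gaussianReal (Measure.dirac (0 : ℝ)) (t := v + t.toNNReal)
    (by simp [ht])
  rw [gaussianReal_conv_gaussianReal, Real.coe_toNNReal _ ht.le] at h1
  rw [Measure.dirac_zero_conv, NNReal.coe_add, Real.coe_toNNReal _ ht.le, fisher_dirac hvt] at h2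
  rw [add_zero] at h1
  rw [h1] at h2
  exact (ENNReal.ofReal_eq_ofReal_iff (fisher_nonneg _ _) (by positivity)).1 h2

/-- Gaussian smoothing turns weak convergence to a normal law into convergence of the Fisher
information. -/
lemma tendsto_excess_fisher {μ : ℕ → Measure ℝ} [∀ n, IsProbabilityMeasure (μ n)] {v : ℝ≥0}
    (hv : v ≠ 0) (h : ∀ s, Tendsto (fun n => charFun (μ n) s) atTop
      (𝓝 (charFun (gaussianReal 0 v) s))) {s : ℕ → ℝ} (hs : Tendsto s atTop (𝓝 v))
    {t : ℝ} (ht : 0 < t) :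
    Tendsto (fun n => ENNReal.ofReal (fisher (μ n) t - 1 / (s n + t))) atTop (𝓝 0) := by
  set γ := gaussianReal 0 v with hγ
  have hv0 : (0 : ℝ) < v := NNReal.coe_pos.2 (pos_iff_ne_zero.2 hv)
  obtain ⟨C, -, hb⟩ := exists_heat_bound_const ht le_rfl
  have hb' := hb t ⟨le_rfl, le_rfl⟩
  have c0 : ∀ x, Tendsto (fun n => sm (μ n) t x) atTop (𝓝 (sm γ t x)) := fun x =>
    tendsto_integral_of_tendsto_charFun h ((continuous_heat t).comp (by fun_prop))
      fun y => (hb' (x - y)).1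
  have c1 : ∀ x, Tendsto (fun n => sm1 (μ n) t x) atTop (𝓝 (sm1 γ t x)) := fun x =>
    tendsto_integral_of_tendsto_charFun h ((continuous_heat1 t).comp (by fun_prop))
      fun y => (hb' (x - y)).2.1
  have c2 : ∀ x, Tendsto (fun n => sm2 (μ n) t x) atTop (𝓝 (sm2 γ t x)) := fun x =>
    tendsto_integral_of_tendsto_charFun h ((continuous_heat2 t).comp (by fun_prop))
      fun y => (hb' (x - y)).2.2
  -- The Cauchy–Schwarz gap: nonnegative, of total integral 1/t minus the Fisher information, and
  -- pointwise continuous under weak convergence. Fatou for g is upper semicontinuity of the Fisher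
  -- information, the only direction needed because `ENNReal.ofReal` discards negative excess.
  set g : Measure ℝ → ℝ → ℝ := fun ρ x => sm2 ρ t x + sm ρ t x / t - sm1 ρ t x ^ 2 / sm ρ t x
    with hg
  have hgl : ∀ x, Tendsto (fun n => g (μ n) x) atTop (𝓝 (g γ x)) := fun x =>
    ((c2 x).add ((c0 x).div_const t)).sub (((c1 x).pow 2).div (c0 x) (sm_pos γ ht x).ne')
  have hgi : ∀ (ρ : Measure ℝ) [IsProbabilityMeasure ρ],
      ∫⁻ x, ENNReal.ofReal (g ρ x) = ENNReal.ofReal (1 / t - fisher ρ t) := by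
    intro ρ _
    have i1 : Integrable (fun x => sm2 ρ t x + sm ρ t x / t) :=
      (integrable_sm2 ρ ht).add ((integrable_sm ρ ht).div_const t)
    have i2 := integrable_sm1_sq_div_sm ρ ht
    have i3 : Integrable (g ρ) := i1.sub i2
    rw [← ofReal_integral_eq_lintegral_ofReal i3
      (.of_forall fun x => sub_nonneg.2 (sm1_sq_div_sm_le ρ ht x))]
    simp only [hg]
    rw [integral_sub i1 i2, integral_add (integrable_sm2 ρ ht) ((integrable_sm ρ ht).div_const t),
      integral_sm2 ρ ht, integral_div, integral_sm ρ ht, zero_add, fisher]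
  have hfatou : ENNReal.ofReal (1 / t - 1 / (v + t)) ≤
      liminf (fun n => ENNReal.ofReal (1 / t - fisher (μ n) t)) atTop := by
    rw [← fisher_gaussianReal v ht, ← hgi γ]
    simp_rw [← hgi]
    calc ∫⁻ x, ENNReal.ofReal (g γ x)
        = ∫⁻ x, liminf (fun n => ENNReal.ofReal (g (μ n) x)) atTop :=
          lintegral_congr fun x => ((ENNReal.tendsto_ofReal (hgl x)).liminf_eq).symm
      _ ≤ _ := lintegral_liminf_le fun n => by
          have m0 := measurable_sm_right (μ n) t
          have m1 := measurable_sm1_right (μ n) t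
          have m2 := measurable_sm2_right (μ n) t
          exact ((m2.add (m0.div_const t)).sub ((m1.pow_const 2).div m0)).ennreal_ofReal
  have hL : 0 < 1 / t - 1 / (v + t) := by
    rw [sub_pos]; exact one_div_lt_one_div_of_lt ht (by linarith)
  have hvt : (v : ℝ) + t ≠ 0 := by positivity
  have hs' : Tendsto (fun n => 1 / (s n + t)) atTop (𝓝 (1 / (v + t))) :=
    tendsto_const_nhds.div (hs.add_const t) hvt
  have key : ∀ ε > 0, ∀ᶠ n in atTop, fisher (μ n) t - 1 / (s n + t) ≤ ε := by
    intro ε hε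
    have h1 : ENNReal.ofReal (1 / t - 1 / (v + t) - ε / 2) < ENNReal.ofReal (1 / t - 1 / (v + t)) :=
      (ENNReal.ofReal_lt_ofReal_iff hL).2 (by linarith)
    have h2 := eventually_lt_of_lt_liminf (h1.trans_le hfatou)
    have h3 := hs'.eventually (lt_mem_nhds (by linarith : 1 / (v + t) - ε / 2 < 1 / (v + t)))
    filter_upwards [h2, h3] with n hn hn'
    have : 1 / t - 1 / (v + t) - ε / 2 < 1 / t - fisher (μ n) t := by
      by_contra hcon
      exact absurd hn (not_lt.2 (ENNReal.ofReal_le_ofReal (not_lt.1 hcon)))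
    linarith
  rw [ENNReal.tendsto_nhds_zero]
  intro ε hε
  by_cases hεt : ε = ∞
  · exact .of_forall fun n => hεt ▸ le_top
  filter_upwards [key ε.toReal (ENNReal.toReal_pos hε.ne' hεt)] with n hn
  exact ENNReal.ofReal_le_of_le_toReal hn

end

section

/-! ### Newman's inequality for characteristic functions of FKG systems -/

section Newman

variable {Ω : Type*} [MeasurableSpace Ω] {P : Measure Ω}

lemma charFun_map_eq_integral {Y : Ω → ℝ} (hY : AEMeasurable Y P) (r : ℝ) :
    charFun (P.map Y) r = ∫ ω, Complex.exp (r * Y ω * Complex.I) ∂P := by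
  rw [charFun_apply_real, integral_map hY (by fun_prop)]

lemma charFun_map_eq_cos_add_sin [IsProbabilityMeasure P] {Y : Ω → ℝ} (hY : AEMeasurable Y P) (r : ℝ) :
    charFun (P.map Y) r = (∫ ω, Real.cos (r * Y ω) ∂P : ℝ) +
      (∫ ω, Real.sin (r * Y ω) ∂P : ℝ) * Complex.I := by
  rw [charFun_map_eq_integral hY]
  have hc : Integrable (fun ω => Real.cos (r * Y ω)) P :=
    Integrable.of_bound (by fun_prop) 1 (.of_forall fun ω => Real.abs_cos_le_one _)
  have hs : Integrable (fun ω => Real.sin (r * Y ω)) P :=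
    Integrable.of_bound (by fun_prop) 1 (.of_forall fun ω => Real.abs_sin_le_one _)
  have e : ∀ ω, Complex.exp (r * Y ω * Complex.I) =
      (Real.cos (r * Y ω) : ℂ) + (Real.sin (r * Y ω) : ℂ) * Complex.I := by
    intro ω; rw [Complex.exp_mul_I]; push_cast; rfl
  simp_rw [e]
  rw [integral_add hc.ofReal (hs.ofReal.mul_const _), integral_mul_const,
    integral_complex_ofReal, integral_complex_ofReal]

variable {ι : Type*} {X : ι → Ω → ℝ}

/-- Both sums are written as functions of the coordinates in A ∪ B with weights 0 and 1, hence
increasing. The two index sets may overlap. -/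
lemma IsFKG.cov_comp_sum_nonneg (hX : IsFKG X P) (A B : Finset ι) {p q : ℝ → ℝ}
    (hp : Monotone p) (hq : Monotone q)
    (hpL : MemLp (fun ω => p (∑ y ∈ A, X y ω)) 2 P)
    (hqL : MemLp (fun ω => q (∑ y ∈ B, X y ω)) 2 P) :
    0 ≤ cov[fun ω => p (∑ y ∈ A, X y ω), fun ω => q (∑ y ∈ B, X y ω); P] := by
  classical
  set s := A ∪ B with hs
  have key : ∀ D : Finset ι, D ⊆ s → ∀ ω, ∑ i : s, (if (i : ι) ∈ D then X i ω else 0) =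
      ∑ y ∈ D, X y ω := by
    intro D hD ω
    rw [Finset.sum_coe_sort s (fun i => if i ∈ D then X i ω else 0), Finset.sum_ite_mem,
      Finset.inter_eq_right.2 hD]
  have hmono : ∀ D : Finset ι, Monotone fun x : s → ℝ => ∑ i : s, (if (i : ι) ∈ D then x i else 0) := by
    intro D x y hxy
    refine Finset.sum_le_sum fun i _ => ?_
    split_ifs
    · exact hxy i
    · exact le_rfl
  have hmeas : ∀ D : Finset ι,
      Measurable fun x : s → ℝ => ∑ i : s, (if (i : ι) ∈ D then x i else 0) := by
    intro D
    refine Finset.measurable_sum _ fun i _ => ?_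
    split_ifs <;> fun_prop
  have := hX s (fun x => p (∑ i : s, (if (i : ι) ∈ A then x i else 0)))
    (fun x => q (∑ i : s, (if (i : ι) ∈ B then x i else 0)))
    (hp.comp (hmono A)) (hq.comp (hmono B)) (hp.measurable.comp (hmeas A))
    (hq.measurable.comp (hmeas B))
  simp only [key A Finset.subset_union_left, key B Finset.subset_union_right] at this
  exact this hpL hqL

/-- Covariances of Lipschitz functions of partial sums of an FKG system are controlled by the
covariance of the sums. -/
lemma IsFKG.abs_cov_lipschitz_le [IsProbabilityMeasure P] (hX : IsFKG X P) (hL : ∀ y, MemLp (X y) 2 P) (A B : Finset ι)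
    {f g : ℝ → ℝ} {K : ℝ} (hf : ∀ x y, x ≤ y → |f y - f x| ≤ K * (y - x))
    (hg : ∀ x y, x ≤ y → |g y - g x| ≤ K * (y - x))
    (hfL : MemLp (fun ω => f (∑ y ∈ A, X y ω)) 2 P)
    (hgL : MemLp (fun ω => g (∑ y ∈ B, X y ω)) 2 P) :
    |cov[fun ω => f (∑ y ∈ A, X y ω), fun ω => g (∑ y ∈ B, X y ω); P]| ≤
      K ^ 2 * cov[fun ω => ∑ y ∈ A, X y ω, fun ω => ∑ y ∈ B, X y ω; P] := by
  have hS : ∀ D : Finset ι, MemLp (fun ω => K * ∑ y ∈ D, X y ω) 2 P := fun D =>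
    (memLp_finsetSum D fun y _ => hL y).const_mul K
  have mono_add : ∀ {k : ℝ → ℝ}, (∀ x y, x ≤ y → |k y - k x| ≤ K * (y - x)) →
      Monotone fun x => K * x + k x := fun hk x y hxy => by
    have := (abs_le.1 (hk x y hxy)).1
    simp only; linarith
  have mono_sub : ∀ {k : ℝ → ℝ}, (∀ x y, x ≤ y → |k y - k x| ≤ K * (y - x)) →
      Monotone fun x => K * x - k x := fun hk x y hxy => by
    have := (abs_le.1 (hk x y hxy)).2
    simp only; linarith
  -- K S ± f(S) is increasing in S when f is K-Lipschitz. Of the four resulting FKG inequalities,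
  -- adding the two with equal signs and the two with opposite signs cancels the mixed terms and
  -- bounds the covariance from below and from above.
  set SA : Ω → ℝ := fun ω => K * ∑ y ∈ A, X y ω with hSA
  set SB : Ω → ℝ := fun ω => K * ∑ y ∈ B, X y ω with hSB
  set fA : Ω → ℝ := fun ω => f (∑ y ∈ A, X y ω) with hfA
  set gB : Ω → ℝ := fun ω => g (∑ y ∈ B, X y ω) with hgB
  have h1 : 0 ≤ cov[SA + fA, SB + gB; P] :=
    hX.cov_comp_sum_nonneg A B (mono_add hf) (mono_add hg) ((hS A).add hfL) ((hS B).add hgL)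
  have h2 : 0 ≤ cov[SA - fA, SB - gB; P] :=
    hX.cov_comp_sum_nonneg A B (mono_sub hf) (mono_sub hg) ((hS A).sub hfL) ((hS B).sub hgL)
  have h3 : 0 ≤ cov[SA + fA, SB - gB; P] :=
    hX.cov_comp_sum_nonneg A B (mono_add hf) (mono_sub hg) ((hS A).add hfL) ((hS B).sub hgL)
  have h4 : 0 ≤ cov[SA - fA, SB + gB; P] :=
    hX.cov_comp_sum_nonneg A B (mono_sub hf) (mono_add hg) ((hS A).sub hfL) ((hS B).add hgL)
  rw [covariance_add_left (hS A) hfL ((hS B).add hgL), covariance_add_right (hS A) (hS B) hgL,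
    covariance_add_right hfL (hS B) hgL] at h1
  rw [covariance_sub_left (hS A) hfL ((hS B).sub hgL), covariance_sub_right (hS A) (hS B) hgL,
    covariance_sub_right hfL (hS B) hgL] at h2
  rw [covariance_add_left (hS A) hfL ((hS B).sub hgL), covariance_sub_right (hS A) (hS B) hgL,
    covariance_sub_right hfL (hS B) hgL] at h3
  rw [covariance_sub_left (hS A) hfL ((hS B).add hgL), covariance_add_right (hS A) (hS B) hgL,
    covariance_add_right hfL (hS B) hgL] at h4
  have e : cov[SA, SB; P] =
      K ^ 2 * cov[fun ω => ∑ y ∈ A, X y ω, fun ω => ∑ y ∈ B, X y ω; P] := by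
    rw [hSA, hSB, covariance_const_mul_left, covariance_const_mul_right]; ring
  rw [← e, abs_le]
  constructor <;> linarith

lemma abs_cos_sub_cos_le (r x y : ℝ) (hxy : x ≤ y) :
    |Real.cos (r * y) - Real.cos (r * x)| ≤ |r| * (y - x) := by
  have := Real.abs_cos_sub_cos_le (r * y) (r * x)
  rwa [← mul_sub, abs_mul, abs_of_nonneg (sub_nonneg.2 hxy)] at this

lemma abs_sin_sub_sin_le (r x y : ℝ) (hxy : x ≤ y) :
    |Real.sin (r * y) - Real.sin (r * x)| ≤ |r| * (y - x) := by
  have := Real.abs_sin_sub_sin_le (r * y) (r * x)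
  rwa [← mul_sub, abs_mul, abs_of_nonneg (sub_nonneg.2 hxy)] at this

/-- **Newman's inequality** for two partial sums of an FKG system. -/
lemma IsFKG.norm_charFun_add_sub_mul_le [IsProbabilityMeasure P] (hX : IsFKG X P) (hm : ∀ y, Measurable (X y))
    (hL : ∀ y, MemLp (X y) 2 P) (A B : Finset ι) (r : ℝ) :
    ‖charFun (P.map fun ω => ∑ y ∈ A, X y ω + ∑ y ∈ B, X y ω) r -
        charFun (P.map fun ω => ∑ y ∈ A, X y ω) r * charFun (P.map fun ω => ∑ y ∈ B, X y ω) r‖ ≤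
      4 * r ^ 2 * cov[fun ω => ∑ y ∈ A, X y ω, fun ω => ∑ y ∈ B, X y ω; P] := by
  have mA : Measurable fun ω => ∑ y ∈ A, X y ω := Finset.measurable_sum _ fun y _ => hm y
  have mB : Measurable fun ω => ∑ y ∈ B, X y ω := Finset.measurable_sum _ fun y _ => hm y
  have mAB : Measurable fun ω => ∑ y ∈ A, X y ω + ∑ y ∈ B, X y ω := mA.add mB
  have lc : ∀ {Y : Ω → ℝ}, Measurable Y → MemLp (fun ω => Real.cos (r * Y ω)) 2 P := fun hY =>
    MemLp.of_bound (by fun_prop) 1 (.of_forall fun ω => Real.abs_cos_le_one _)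
  have ls : ∀ {Y : Ω → ℝ}, Measurable Y → MemLp (fun ω => Real.sin (r * Y ω)) 2 P := fun hY =>
    MemLp.of_bound (by fun_prop) 1 (.of_forall fun ω => Real.abs_sin_le_one _)
  -- The real and the imaginary part of the difference are each a combination of two of these four
  -- covariances, which accounts for the constant 4.
  have hcc := hX.abs_cov_lipschitz_le hL A B (abs_cos_sub_cos_le r) (abs_cos_sub_cos_le r)
    (lc mA) (lc mB)
  have hss := hX.abs_cov_lipschitz_le hL A B (abs_sin_sub_sin_le r) (abs_sin_sub_sin_le r)
    (ls mA) (ls mB)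
  have hcs := hX.abs_cov_lipschitz_le hL A B (abs_cos_sub_cos_le r) (abs_sin_sub_sin_le r)
    (lc mA) (ls mB)
  have hsc := hX.abs_cov_lipschitz_le hL A B (abs_sin_sub_sin_le r) (abs_cos_sub_cos_le r)
    (ls mA) (lc mB)
  rw [sq_abs] at hcc hss hcs hsc
  rw [covariance_eq_sub (lc mA) (lc mB)] at hcc
  rw [covariance_eq_sub (ls mA) (ls mB)] at hss
  rw [covariance_eq_sub (lc mA) (ls mB)] at hcs
  rw [covariance_eq_sub (ls mA) (lc mB)] at hsc
  have icc := (lc mA).integrable_mul (lc mB)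
  have iss := (ls mA).integrable_mul (ls mB)
  have ics := (lc mA).integrable_mul (ls mB)
  have isc := (ls mA).integrable_mul (lc mB)
  rw [charFun_map_eq_cos_add_sin mAB.aemeasurable, charFun_map_eq_cos_add_sin mA.aemeasurable,
    charFun_map_eq_cos_add_sin mB.aemeasurable]
  have e1 : ∫ ω, Real.cos (r * (∑ y ∈ A, X y ω + ∑ y ∈ B, X y ω)) ∂P =
      ∫ ω, ((fun ω => Real.cos (r * ∑ y ∈ A, X y ω)) * fun ω => Real.cos (r * ∑ y ∈ B, X y ω)) ω ∂P -
      ∫ ω, ((fun ω => Real.sin (r * ∑ y ∈ A, X y ω)) * fun ω => Real.sin (r * ∑ y ∈ B, X y ω)) ω ∂P := by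
    rw [← integral_sub icc iss]
    refine integral_congr_ae (.of_forall fun ω => ?_)
    simp only [Pi.mul_apply, mul_add, Real.cos_add]
  have e2 : ∫ ω, Real.sin (r * (∑ y ∈ A, X y ω + ∑ y ∈ B, X y ω)) ∂P =
      ∫ ω, ((fun ω => Real.sin (r * ∑ y ∈ A, X y ω)) * fun ω => Real.cos (r * ∑ y ∈ B, X y ω)) ω ∂P +
      ∫ ω, ((fun ω => Real.cos (r * ∑ y ∈ A, X y ω)) * fun ω => Real.sin (r * ∑ y ∈ B, X y ω)) ω ∂P := by
    rw [← integral_add isc ics]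
    refine integral_congr_ae (.of_forall fun ω => ?_)
    simp only [Pi.mul_apply, mul_add, Real.sin_add]
  rw [e1, e2]
  set c := cov[fun ω => ∑ y ∈ A, X y ω, fun ω => ∑ y ∈ B, X y ω; P]
  refine (Complex.norm_le_abs_re_add_abs_im _).trans ?_
  simp only [Complex.sub_re, Complex.sub_im, Complex.add_re, Complex.add_im, Complex.mul_re,
    Complex.mul_im, Complex.ofReal_re, Complex.ofReal_im, Complex.I_re, Complex.I_im, mul_zero,
    mul_one, add_zero, zero_add, sub_self]
  rw [abs_le] at hcc hss hcs hsc
  have q1 := hcc.1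
  have q2 := hcc.2
  have q3 := hss.1
  have q4 := hss.2
  have q5 := hcs.1
  have q6 := hcs.2
  have q7 := hsc.1
  have q8 := hsc.2
  have t1 : ∀ {x y a : ℝ}, |x| ≤ 2 * a → |y| ≤ 2 * a → |x| + |y| ≤ 4 * a := by
    intro x y a hx hy; linarith
  rw [mul_assoc]
  refine t1 ?_ ?_ <;> rw [abs_le] <;> constructor <;> linarith

end Newman

end

section

/-! ### Box sums of a stationary FKG field -/

section Boxes

variable {d : ℕ}

/-- The box `∏ᵢ {1, …, nᵢ}`, where sides are allowed to be empty. -/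
def gbox (n : Fin d → ℕ) : Finset (Fin d → ℤ) := Finset.Icc (fun _ => 1) (fun i => (n i : ℤ))

lemma mem_gbox {n : Fin d → ℕ} {y : Fin d → ℤ} : y ∈ gbox n ↔ ∀ k, 1 ≤ y k ∧ y k ≤ n k := by
  simp only [gbox, Finset.mem_Icc, Pi.le_def, forall_and]

/-- The first a layers in direction i are split from the remaining b, which form a translate of a
box. By stationarity the translate has the same law, so slabs can be peeled off one at a time. -/
lemma gbox_update_add (n : Fin d → ℕ) (i : Fin d) (a b : ℕ) :
    ∃ h : Disjoint (gbox (Function.update n i a))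
      ((gbox (Function.update n i b)).map (addRightEmbedding (Pi.single i (a : ℤ)))),
    gbox (Function.update n i (a + b)) = (gbox (Function.update n i a)).disjUnion
      ((gbox (Function.update n i b)).map (addRightEmbedding (Pi.single i (a : ℤ)))) h := by
  have hm : ∀ y, y ∈ (gbox (Function.update n i b)).map (addRightEmbedding (Pi.single i (a : ℤ))) ↔
      y - Pi.single i (a : ℤ) ∈ gbox (Function.update n i b) := by
    intro y
    simp only [Finset.mem_map, addRightEmbedding_apply]
    constructor
    · rintro ⟨z, hz, rfl⟩; simpa using hz
    · intro h; exact ⟨_, h, by simp⟩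
  refine ⟨?_, ?_⟩
  · rw [Finset.disjoint_left]
    intro y hy hy'
    rw [hm] at hy'
    have h1 := mem_gbox.1 hy i
    have h2 := mem_gbox.1 hy' i
    simp at h1 h2
    omega
  · ext y
    rw [Finset.mem_disjUnion, hm, mem_gbox, mem_gbox, mem_gbox]
    have split : ∀ c : ℕ, ∀ z : Fin d → ℤ, (∀ k, 1 ≤ z k ∧ z k ≤ (Function.update n i c k : ℕ)) ↔
        (1 ≤ z i ∧ z i ≤ c) ∧ ∀ k, k ≠ i → 1 ≤ z k ∧ z k ≤ n k := by
      intro c z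
      constructor
      · intro h
        refine ⟨by simpa using h i, fun k hk => by simpa [hk] using h k⟩
      · rintro ⟨h1, h2⟩ k
        by_cases hk : k = i
        · subst hk; simpa using h1
        · simpa [hk] using h2 k hk
    rw [split, split, split]
    set w : Fin d → ℤ := y - Pi.single i (a : ℤ) with hw
    have e : ∀ k, k ≠ i → w k = y k := by
      intro k hk; simp [hw, hk]
    have e' : w i = y i - a := by simp [hw]
    have hall : (∀ k, k ≠ i → 1 ≤ w k ∧ w k ≤ n k) ↔ ∀ k, k ≠ i → 1 ≤ y k ∧ y k ≤ n k :=
      forall₂_congr fun k hk => by rw [e k hk]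
    rw [hall, e', ← or_and_right]
    refine and_congr_left fun _ => ?_
    push_cast
    omega

/-- The number of `y` with `y` and `y + h` both in the box `gbox n`. -/
def overlap (n : Fin d → ℕ) (h : Fin d → ℤ) : ℕ := ∏ k, (n k - (h k).natAbs)

lemma card_filter_gbox (n : Fin d → ℕ) (h : Fin d → ℤ) :
    ((gbox n).filter fun y => y + h ∈ gbox n).card = overlap n h := by
  have : (gbox n).filter (fun y => y + h ∈ gbox n) =
      Finset.Icc (fun k => max 1 (1 - h k)) (fun k => min (n k : ℤ) (n k - h k)) := by
    ext y
    simp only [Finset.mem_filter, mem_gbox, Finset.mem_Icc, Pi.le_def, Pi.add_apply,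
      ← forall_and]
    refine forall_congr' fun k => ?_
    omega
  rw [this, Pi.card_Icc, overlap]
  refine Finset.prod_congr rfl fun k _ => ?_
  rw [Int.card_Icc]
  omega

lemma overlap_le (n : Fin d → ℕ) (h : Fin d → ℤ) : overlap n h ≤ ∏ k, n k :=
  Finset.prod_le_prod' fun _ _ => Nat.sub_le _ _

end Boxes

variable {Ω : Type*} [MeasurableSpace Ω] {P : Measure Ω} {d : ℕ}

/-- A centred stationary square-integrable FKG field with finite susceptibility. -/
structure IsFKGField (X : (Fin d → ℤ) → Ω → ℝ) (P : Measure Ω) : Prop where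
  meas : ∀ y, Measurable (X y)
  memLp : ∀ y, MemLp (X y) 2 P
  mean : ∀ y, ∫ ω, X y ω ∂P = 0
  stat : IsStationary X P
  fkg : IsFKG X P
  susc : Summable (fun y : Fin d → ℤ => cov[X 0, X y; P])

/-- The sum of the field over `gbox n`. -/
def boxSum (X : (Fin d → ℤ) → Ω → ℝ) (n : Fin d → ℕ) (ω : Ω) : ℝ := ∑ y ∈ gbox n, X y ω

namespace IsFKGField

variable {X : (Fin d → ℤ) → Ω → ℝ}

lemma identDistrib (hX : IsFKGField X P) (h : Fin d → ℤ) {g : ((Fin d → ℤ) → ℝ) → ℝ}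
    (hg : Measurable g) :
    IdentDistrib (fun ω => g fun y => X (y + h) ω) (fun ω => g fun y => X y ω) P P := by
  have m1 : Measurable fun ω (y : Fin d → ℤ) => X (y + h) ω := measurable_pi_lambda _ fun y => hX.meas _
  have m2 : Measurable fun ω (y : Fin d → ℤ) => X y ω := measurable_pi_lambda _ fun y => hX.meas _
  refine ⟨(hg.comp m1).aemeasurable, (hg.comp m2).aemeasurable, ?_⟩
  have h1 := Measure.map_map (μ := P) hg m1
  have h2 := Measure.map_map (μ := P) hg m2
  rw [hX.stat h, h2] at h1
  exact h1.symm

lemma measurable_boxSum (hX : IsFKGField X P) (n : Fin d → ℕ) : Measurable (boxSum X n) :=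
  Finset.measurable_sum _ fun y _ => hX.meas y

lemma memLp_boxSum (hX : IsFKGField X P) (n : Fin d → ℕ) : MemLp (boxSum X n) 2 P :=
  memLp_finsetSum _ fun y _ => hX.memLp y

lemma cov_nonneg (hX : IsFKGField X P) (y z : Fin d → ℤ) : 0 ≤ cov[X y, X z; P] := by
  have := hX.fkg.cov_comp_sum_nonneg {y} {z} (p := id) (q := id) monotone_id monotone_id
    (by simpa using hX.memLp y) (by simpa using hX.memLp z)
  simpa using this

variable [IsProbabilityMeasure P]

lemma integral_boxSum (hX : IsFKGField X P) (n : Fin d → ℕ) : ∫ ω, boxSum X n ω ∂P = 0 := by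
  unfold boxSum
  rw [integral_finsetSum _ fun y _ => (hX.memLp y).integrable one_le_two]
  exact Finset.sum_eq_zero fun y _ => hX.mean y

lemma cov_eq (hX : IsFKGField X P) (y z : Fin d → ℤ) : cov[X y, X z; P] = cov[X 0, X (z - y); P] := by
  rw [covariance_eq_sub (hX.memLp _) (hX.memLp _), covariance_eq_sub (hX.memLp _) (hX.memLp _),
    hX.mean y, hX.mean 0, zero_mul, zero_mul, sub_zero, sub_zero]
  have := (hX.identDistrib y (g := fun x => x 0 * x (z - y)) (by fun_prop)).integral_eq
  simpa using this

/-- Newman's inequality along one coordinate direction. -/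
lemma norm_charFun_boxSum_sub_le (hX : IsFKGField X P) (n : Fin d → ℕ) (i : Fin d) (a q : ℕ)
    (r : ℝ) (m : ℕ) :
    ‖charFun (P.map (boxSum X (Function.update n i (a + m * q)))) r -
      charFun (P.map (boxSum X (Function.update n i a))) r *
        charFun (P.map (boxSum X (Function.update n i q))) r ^ m‖ ≤
      2 * r ^ 2 * (Var[boxSum X (Function.update n i (a + m * q)); P] -
        Var[boxSum X (Function.update n i a); P] -
          m * Var[boxSum X (Function.update n i q); P]) := by
  induction m with
  | zero => simp
  | succ m ih =>
    set b := a + m * q with hb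
    have hsucc : a + (m + 1) * q = b + q := by rw [hb]; ring
    rw [hsucc]
    obtain ⟨hdis, hun⟩ := gbox_update_add n i b q
    set A := gbox (Function.update n i b) with hA
    set B := (gbox (Function.update n i q)).map (addRightEmbedding (Pi.single i (b : ℤ))) with hB
    have hsum : boxSum X (Function.update n i (b + q)) =
        fun ω => ∑ y ∈ A, X y ω + ∑ y ∈ B, X y ω := by
      ext ω; rw [boxSum, hun, Finset.sum_disjUnion]
    have hid : IdentDistrib (fun ω => ∑ y ∈ B, X y ω) (boxSum X (Function.update n i q)) P P := by
      have := hX.identDistrib (Pi.single i (b : ℤ))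
        (g := fun x => ∑ y ∈ gbox (Function.update n i q), x y)
        (Finset.measurable_sum _ fun y _ => measurable_pi_apply y)
      simp only [hB, Finset.sum_map, addRightEmbedding_apply]
      exact this
    have hLA : MemLp (fun ω => ∑ y ∈ A, X y ω) 2 P := memLp_finsetSum _ fun y _ => hX.memLp y
    have hLB : MemLp (fun ω => ∑ y ∈ B, X y ω) 2 P := memLp_finsetSum _ fun y _ => hX.memLp y
    have hN := hX.fkg.norm_charFun_add_sub_mul_le hX.meas hX.memLp A B r
    -- The variance increment contains twice the covariance, so Newman's constant 4 becomes 2 and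
    -- the bounds telescope along the induction.
    have hV : Var[boxSum X (Function.update n i (b + q)); P] =
        Var[boxSum X (Function.update n i b); P] +
          2 * cov[fun ω => ∑ y ∈ A, X y ω, fun ω => ∑ y ∈ B, X y ω; P] +
          Var[boxSum X (Function.update n i q); P] := by
      rw [hsum, variance_fun_add hLA hLB, hid.variance_eq]; rfl
    rw [hid.map_eq, ← hsum] at hN
    change ‖_ - charFun (P.map (boxSum X (Function.update n i b))) r * _‖ ≤ _ at hN
    set φb := charFun (P.map (boxSum X (Function.update n i b))) r
    set φq := charFun (P.map (boxSum X (Function.update n i q))) r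
    set φa := charFun (P.map (boxSum X (Function.update n i a))) r
    set φ := charFun (P.map (boxSum X (Function.update n i (b + q)))) r
    have hq1 : ‖φq‖ ≤ 1 := by
      have : IsProbabilityMeasure (P.map (boxSum X (Function.update n i q))) :=
        Measure.isProbabilityMeasure_map (hX.measurable_boxSum _).aemeasurable
      exact norm_charFun_le_one r
    have h1 : φ - φa * φq ^ (m + 1) = (φ - φb * φq) + (φb - φa * φq ^ m) * φq := by ring
    rw [h1]
    refine (norm_add_le _ _).trans ?_
    have h2 : ‖(φb - φa * φq ^ m) * φq‖ ≤ ‖φb - φa * φq ^ m‖ := by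
      rw [norm_mul]; exact mul_le_of_le_one_right (norm_nonneg _) hq1
    rw [hV]
    push_cast
    linarith

/-- Group the pairs of sites by their difference h; each h occurs `overlap n h` times. Only finitely
many h have nonzero overlap, so the sum is effectively finite. -/
lemma variance_boxSum (hX : IsFKGField X P) (n : Fin d → ℕ) :
    Summable (fun h => cov[X 0, X h; P] * overlap n h) ∧
    Var[boxSum X n; P] = ∑' h, cov[X 0, X h; P] * overlap n h := by
  set c : (Fin d → ℤ) → ℝ := fun h => cov[X 0, X h; P] with hc
  have h1 : Var[boxSum X n; P] = ∑ y ∈ gbox n, ∑ z ∈ gbox n, c (z - y) := by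
    unfold boxSum
    rw [variance_fun_sum' fun y _ => hX.memLp y]
    exact Finset.sum_congr rfl fun y _ => Finset.sum_congr rfl fun z _ => hX.cov_eq y z
  have h2 : ∀ y, ∑ z ∈ gbox n, c (z - y) = ∑' h, (if y + h ∈ gbox n then c h else 0) ∧
      Summable (fun h => if y + h ∈ gbox n then c h else 0) := by
    intro y
    have hsum := hasSum_sum_of_ne_finset_zero (L := .unconditional _) (s := gbox n)
      (f := fun z => if z ∈ gbox n then c (z - y) else 0) (fun z hz => by simp [hz])
    have h3 := (Equiv.addLeft y).hasSum_iff.2 hsum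
    have e : ((fun z => if z ∈ gbox n then c (z - y) else 0) ∘ (Equiv.addLeft y)) =
        fun h => if y + h ∈ gbox n then c h else 0 := by
      ext h; simp
    rw [e] at h3
    refine ⟨?_, h3.summable⟩
    rw [h3.tsum_eq]
    exact Finset.sum_congr rfl fun z hz => by simp [hz]
  have h3 : ∀ h, ∑ y ∈ gbox n, (if y + h ∈ gbox n then c h else 0) = c h * overlap n h := by
    intro h
    rw [← Finset.sum_filter, Finset.sum_const, card_filter_gbox, nsmul_eq_mul, mul_comm]
  constructor
  · exact (summable_sum fun y _ => (h2 y).2).congr fun h => h3 h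
  · rw [h1, Finset.sum_congr rfl fun y _ => (h2 y).1, ← Summable.tsum_finsetSum fun y _ => (h2 y).2]
    exact tsum_congr h3

end IsFKGField

end

section

/-! ### Asymptotic additivity of the variance -/

section Longest

variable {d : ℕ} [Nonempty (Fin d)]

/-- A direction in which the box is longest. -/
def longest (u : Fin d → ℕ+) : Fin d := Classical.choose (Finite.exists_max u)

lemma le_longest (u : Fin d → ℕ+) (k : Fin d) : u k ≤ u (longest u) :=
  Classical.choose_spec (Finite.exists_max u) k

/-- The length of the longest side of the box. -/
def side (u : Fin d → ℕ+) : ℕ := u (longest u)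

lemma boxVol_le_side_pow (u : Fin d → ℕ+) : boxVol u ≤ side u ^ d := by
  calc boxVol u ≤ ∏ _k : Fin d, side u :=
        Finset.prod_le_prod' fun k _ => PNat.coe_le_coe _ _ |>.2 (le_longest u k)
    _ = _ := by simp

/-- Large volume forces only the longest side to be large, the others may stay bounded. This is why
boxes are cut in that direction alone. -/
lemma tendsto_side : Tendsto (side (d := d)) (comap boxVol atTop) atTop := by
  rw [tendsto_atTop]
  intro K
  have h : ∀ᶠ u in comap (boxVol (d := d)) atTop, K ^ d + 1 ≤ boxVol u :=
    tendsto_comap.eventually (eventually_ge_atTop _)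
  filter_upwards [h] with u hu
  by_contra hlt
  have := (boxVol_le_side_pow u).trans (Nat.pow_le_pow_left (not_le.1 hlt).le d)
  omega

end Longest

section Overlap

variable {d : ℕ}

/-- The sides of the box as natural numbers. -/
def sides (u : Fin d → ℕ+) (k : Fin d) : ℕ := u k

lemma boxVol_pos (u : Fin d → ℕ+) : 0 < boxVol u := Finset.prod_pos fun k _ => (u k).pos

/-- In direction i each truncated difference is within |hᵢ| of its side length, and the remainder a
is at most M, so cutting changes that factor by at most M(1 + |hᵢ|). Relative to the volume the
change is O(1/nᵢ) for fixed h. -/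
lemma abs_overlap_sub_le (n : Fin d → ℕ) (i : Fin d) (h : Fin d → ℤ) {a q M : ℕ}
    (hM : 0 < M) (hn : n i = a + M * q) (ha : a ≤ M) :
    |(overlap n h : ℝ) - M * overlap (Function.update n i q) h| * n i ≤
      M * (1 + (h i).natAbs) * ∏ k, (n k : ℝ) := by
  have h1 : overlap n h = (n i - (h i).natAbs) *
      ∏ k ∈ Finset.univ.erase i, (n k - (h k).natAbs) :=
    (Finset.mul_prod_erase _ _ (Finset.mem_univ i)).symm
  have h2 : overlap (Function.update n i q) h = (q - (h i).natAbs) *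
      ∏ k ∈ Finset.univ.erase i, (n k - (h k).natAbs) := by
    rw [overlap, ← Finset.mul_prod_erase _ _ (Finset.mem_univ i), Function.update_self]
    congr 1
    refine Finset.prod_congr rfl fun k hk => ?_
    rw [Function.update_of_ne (Finset.ne_of_mem_erase hk)]
  have h3 : ∏ k, n k = n i * ∏ k ∈ Finset.univ.erase i, n k :=
    (Finset.mul_prod_erase _ _ (Finset.mem_univ i)).symm
  have h4 : ∏ k ∈ Finset.univ.erase i, (n k - (h k).natAbs) ≤ ∏ k ∈ Finset.univ.erase i, n k :=
    Finset.prod_le_prod' fun _ _ => Nat.sub_le _ _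
  set w := ∏ k ∈ Finset.univ.erase i, (n k - (h k).natAbs)
  set W := ∏ k ∈ Finset.univ.erase i, n k
  set b := (h i).natAbs
  have h5 : |((n i - b : ℕ) : ℝ) - M * ((q - b : ℕ) : ℝ)| ≤ M * (1 + b) := by
    have t1 : ((n i - b : ℕ) : ℝ) ≤ n i := by exact_mod_cast Nat.sub_le _ _
    have t2 : (n i : ℝ) - b ≤ ((n i - b : ℕ) : ℝ) := by
      have : n i ≤ (n i - b) + b := by omega
      have : (n i : ℝ) ≤ ((n i - b : ℕ) : ℝ) + b := by exact_mod_cast this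
      linarith
    have t3 : ((q - b : ℕ) : ℝ) ≤ q := by exact_mod_cast Nat.sub_le _ _
    have t4 : (q : ℝ) - b ≤ ((q - b : ℕ) : ℝ) := by
      have : q ≤ (q - b) + b := by omega
      have : (q : ℝ) ≤ ((q - b : ℕ) : ℝ) + b := by exact_mod_cast this
      linarith
    have t5 : (n i : ℝ) = a + M * q := by exact_mod_cast hn
    have t6 : (a : ℝ) ≤ M := by exact_mod_cast ha
    have t7 : (1 : ℝ) ≤ M := by exact_mod_cast hM
    have t8 : (0 : ℝ) ≤ b := Nat.cast_nonneg b
    have t9 : (0 : ℝ) ≤ a := Nat.cast_nonneg a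
    rw [abs_le]; constructor <;> nlinarith
  have h6 : (∏ k, (n k : ℝ)) = n i * W := by exact_mod_cast h3
  rw [h1, h2, h6]
  push_cast
  have h7 : (w : ℝ) ≤ W := by exact_mod_cast h4
  have h8 : ((n i - b : ℕ) : ℝ) * w - M * (((q - b : ℕ) : ℝ) * w) =
      (((n i - b : ℕ) : ℝ) - M * ((q - b : ℕ) : ℝ)) * w := by ring
  rw [h8, abs_mul, abs_of_nonneg (a := (w : ℝ)) (Nat.cast_nonneg w)]
  calc _ ≤ M * (1 + (b : ℝ)) * W * n i := by gcongr
    _ = _ := by ring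

end Overlap

variable {Ω : Type*} [MeasurableSpace Ω] {P : Measure Ω} {d : ℕ}

namespace IsFKGField

variable {X : (Fin d → ℤ) → Ω → ℝ} [IsProbabilityMeasure P]

lemma variance_boxSum_le (hX : IsFKGField X P) (n : Fin d → ℕ) :
    Var[boxSum X n; P] ≤ (∑' h, cov[X 0, X h; P]) * ∏ k, (n k : ℝ) := by
  obtain ⟨hs, he⟩ := hX.variance_boxSum n
  rw [he, ← tsum_mul_right]
  refine hs.tsum_le_tsum (fun h => ?_) (hX.susc.mul_right _)
  refine mul_le_mul_of_nonneg_left ?_ (hX.cov_nonneg _ _)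
  exact_mod_cast overlap_le n h

/-- Covariances are nonnegative, so the term h = 0 alone is a lower bound. It keeps the normalised
variances uniformly away from zero. -/
lemma le_variance_boxSum (hX : IsFKGField X P) (n : Fin d → ℕ) :
    Var[X 0; P] * ∏ k, (n k : ℝ) ≤ Var[boxSum X n; P] := by
  obtain ⟨hs, he⟩ := hX.variance_boxSum n
  rw [he]
  have := hs.le_tsum 0 fun h _ => mul_nonneg (hX.cov_nonneg _ _) (Nat.cast_nonneg _)
  rw [covariance_self (hX.meas 0).aemeasurable] at this
  simpa [overlap] using this

variable [Nonempty (Fin d)]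

/-- Cutting a large box into `M` equal slabs across its longest side loses a negligible part of
the variance. -/
lemma tendsto_variance_defect (hX : IsFKGField X P) {M : ℕ} (hM : 0 < M) :
    Tendsto (fun u : Fin d → ℕ+ => (Var[boxSum X (sides u); P] -
      M * Var[boxSum X (Function.update (sides u) (longest u) (side u / M)); P]) / boxVol u)
      (comap boxVol atTop) (𝓝 0) := by
  set c : (Fin d → ℤ) → ℝ := fun h => cov[X 0, X h; P] with hc
  set n' : (Fin d → ℕ+) → Fin d → ℕ := fun u => Function.update (sides u) (longest u) (side u / M)
    with hn'
  set f : (Fin d → ℕ+) → (Fin d → ℤ) → ℝ := fun u h =>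
    c h * (((overlap (sides u) h : ℝ) - M * overlap (n' u) h) / boxVol u) with hf
  have hvol : ∀ u : Fin d → ℕ+, ∏ k, (sides u k : ℝ) = boxVol u := fun u => by
    simp [boxVol, sides]
  have hpos : ∀ u : Fin d → ℕ+, (0 : ℝ) < boxVol u := fun u => by exact_mod_cast boxVol_pos u
  have hfe : ∀ u, (Var[boxSum X (sides u); P] - M * Var[boxSum X (n' u); P]) / boxVol u =
      ∑' h, f u h := by
    intro u
    obtain ⟨s1, e1⟩ := hX.variance_boxSum (sides u)
    obtain ⟨s2, e2⟩ := hX.variance_boxSum (n' u)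
    rw [e1, e2, ← tsum_mul_left, ← s1.tsum_sub (s2.mul_left _), ← tsum_div_const]
    refine tsum_congr fun h => ?_
    simp only [hf, hc]; ring
  have hbound : ∀ u h, |f u h| * side u ≤ c h * (M * (1 + (∑ k, (h k).natAbs : ℕ))) := by
    intro u h
    have h1 := abs_overlap_sub_le (sides u) (longest u) h (a := side u % M) (q := side u / M) hM
      (Nat.mod_add_div _ _).symm (Nat.mod_lt _ hM).le
    rw [hvol] at h1
    have hle : ((h (longest u)).natAbs : ℝ) ≤ (∑ k, (h k).natAbs : ℕ) := by
      exact_mod_cast Finset.single_le_sum (f := fun k => (h k).natAbs) (fun _ _ => Nat.zero_le _)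
        (Finset.mem_univ (longest u))
    simp only [hf]
    rw [abs_mul, abs_of_nonneg (hX.cov_nonneg 0 h), mul_assoc]
    refine mul_le_mul_of_nonneg_left ?_ (hX.cov_nonneg 0 h)
    rw [abs_div, abs_of_pos (hpos u), div_mul_eq_mul_div, div_le_iff₀ (hpos u)]
    refine h1.trans ?_
    have := (hpos u).le
    gcongr
  refine Tendsto.congr (fun u => (hfe u).symm) ?_
  rw [show (0 : ℝ) = ∑' _h : Fin d → ℤ, (0 : ℝ) by simp]
  -- The overlap of the box and M times that of a slab both lie between 0 and |u|, so the summable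
  -- covariances dominate. For fixed h the term is O(1/side) by `hbound`.
  refine tendsto_tsum_of_dominated_convergence (bound := c) hX.susc (fun h => ?_)
    (.of_forall fun u h => ?_)
  · have hs : Tendsto (fun u : Fin d → ℕ+ => (side u : ℝ)) (comap boxVol atTop) atTop :=
      tendsto_natCast_atTop_atTop.comp tendsto_side
    have h2 : Tendsto (fun u : Fin d → ℕ+ => c h * (M * (1 + (∑ k, (h k).natAbs : ℕ))) / (side u : ℝ))
        (comap boxVol atTop) (𝓝 0) := tendsto_const_nhds.div_atTop hs
    refine squeeze_zero_norm' ?_ h2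
    filter_upwards [hs.eventually_gt_atTop 0] with u hu
    rw [le_div_iff₀ hu]
    exact hbound u h
  · simp only [hf]
    rw [norm_mul, Real.norm_of_nonneg (hX.cov_nonneg 0 h)]
    refine mul_le_of_le_one_right (hX.cov_nonneg 0 h) ?_
    rw [Real.norm_eq_abs, abs_div, abs_of_pos (hpos u), div_le_one (hpos u)]
    have t1 : (overlap (sides u) h : ℝ) ≤ boxVol u := by
      rw [← hvol]; exact_mod_cast overlap_le _ _
    have t2 : (M : ℝ) * overlap (n' u) h ≤ boxVol u := by
      have q1 := overlap_le (n' u) h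
      have q2 : M * ∏ k, n' u k ≤ boxVol u := by
        have e1 : ∏ k, n' u k = (side u / M) * ∏ k ∈ Finset.univ.erase (longest u), sides u k := by
          rw [← Finset.mul_prod_erase _ _ (Finset.mem_univ (longest u)), hn']
          simp only [Function.update_self]
          congr 1
          refine Finset.prod_congr rfl fun k hk => ?_
          rw [Function.update_of_ne (Finset.ne_of_mem_erase hk)]
        have e2 : boxVol u = side u * ∏ k ∈ Finset.univ.erase (longest u), sides u k :=
          (Finset.mul_prod_erase _ _ (Finset.mem_univ (longest u))).symm
        rw [e1, e2, ← mul_assoc]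
        exact Nat.mul_le_mul_right _ (Nat.mul_div_le _ _)
      exact_mod_cast (Nat.mul_le_mul_left M q1).trans q2
    have t3 : (0 : ℝ) ≤ overlap (sides u) h := Nat.cast_nonneg _
    have t4 : (0 : ℝ) ≤ M * overlap (n' u) h := by positivity
    rw [abs_le]; constructor <;> linarith

end IsFKGField

end

section

/-! ### The law of the perturbed box sums -/

lemma normSum_eq {Ω : Type*} {d : ℕ} (Y : (Fin d → ℤ) → Ω → ℝ) (u : Fin d → ℕ+) :
    normSum Y u = fun ω => (√(boxVol u : ℝ))⁻¹ * boxSum Y (sides u) ω := by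
  ext ω
  rw [normSum, div_eq_inv_mul]
  rfl

variable {Ω : Type*} [MeasurableSpace Ω] {P : Measure Ω} {d : ℕ}

lemma charFun_normSum (Y : (Fin d → ℤ) → Ω → ℝ) (hY : ∀ y, Measurable (Y y)) (u : Fin d → ℕ+)
    (s : ℝ) : charFun (P.map (normSum Y u)) s =
      charFun (P.map (boxSum Y (sides u))) (s / √(boxVol u : ℝ)) := by
  have hm : Measurable (boxSum Y (sides u)) := Finset.measurable_sum _ fun y _ => hY y
  rw [normSum_eq, charFun_map_mul_comp hm.aemeasurable, ← div_eq_inv_mul]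

lemma measurable_normSum {Y : (Fin d → ℤ) → Ω → ℝ} (hY : ∀ y, Measurable (Y y))
    (u : Fin d → ℕ+) : Measurable (normSum Y u) :=
  (Finset.measurable_sum _ fun y _ => hY y).div_const _

section Perturbation

variable {X : (Fin d → ℤ) → Ω → ℝ} {Z : ℝ≥0 → (Fin d → ℤ) → Ω → ℝ}

lemma measurable_V (hZ : IsGaussianPerturbation X Z P) (hX : ∀ y, Measurable (X y)) (τ : ℝ≥0)
    (u : Fin d → ℕ+) : Measurable (V X Z τ u) :=
  measurable_normSum (fun y => (hX y).add (hZ.measurable τ y)) u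

lemma memLp_normSum (hX : IsFKGField X P) (u : Fin d → ℕ+) : MemLp (normSum X u) 2 P := by
  rw [normSum_eq]
  exact (hX.memLp_boxSum _).const_mul _

lemma variance_normSum (X : (Fin d → ℤ) → Ω → ℝ) (u : Fin d → ℕ+) :
    Var[normSum X u; P] = Var[boxSum X (sides u); P] / boxVol u := by
  rw [normSum_eq, variance_const_mul, inv_pow, Real.sq_sqrt (Nat.cast_nonneg _)]
  ring

variable [IsProbabilityMeasure P]

lemma IsGaussianPerturbation.map_normSum (hZ : IsGaussianPerturbation X Z P) (τ : ℝ≥0)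
    (u : Fin d → ℕ+) : P.map (normSum (Z τ) u) = gaussianReal 0 τ := by
  have hp : IsProbabilityMeasure (P.map (normSum (Z τ) u)) :=
    Measure.isProbabilityMeasure_map (measurable_normSum (hZ.measurable τ) u).aemeasurable
  refine Measure.ext_of_charFun (funext fun s => ?_)
  rw [charFun_normSum _ (hZ.measurable τ)]
  have h1 := congrFun (((hZ.iIndep τ).restrict (gbox (sides u))).charFun_map_fun_finsetSum_eq_prod
    (fun y _ => (hZ.measurable τ y).aemeasurable)) (s / √(boxVol u : ℝ))
  unfold boxSum
  rw [h1]
  simp only [hZ.law, Finset.prod_apply, Finset.prod_const]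
  have hcard : (gbox (sides u)).card = boxVol u := card_box u
  have hpos : (0 : ℝ) < boxVol u := by exact_mod_cast boxVol_pos u
  rw [hcard, charFun_gaussianReal_zero, charFun_gaussianReal_zero, ← Complex.exp_nat_mul]
  congr 1
  have h2 : ((s / √(boxVol u : ℝ) : ℝ) : ℂ) ^ 2 = s ^ 2 / (boxVol u : ℂ) := by
    rw [← Complex.ofReal_pow, div_pow, Real.sq_sqrt hpos.le]
    push_cast; rfl
  have h3 : (boxVol u : ℂ) ≠ 0 := by exact_mod_cast (boxVol_pos u).ne'
  rw [h2]
  field_simp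

lemma IsGaussianPerturbation.map_V (hZ : IsGaussianPerturbation X Z P)
    (hX : ∀ y, Measurable (X y)) (τ : ℝ≥0) (u : Fin d → ℕ+) :
    P.map (V X Z τ u) = P.map (normSum X u) ∗ gaussianReal 0 τ := by
  have mX := measurable_normSum hX u
  have mZ := measurable_normSum (hZ.measurable τ) u
  have hV : V X Z τ u = normSum X u + normSum (Z τ) u := by
    ext ω
    simp [V, normSum, Finset.sum_add_distrib, add_div]
  have hg : Measurable fun x : (Fin d → ℤ) → ℝ => (∑ y ∈ box u, x y) / √(boxVol u : ℝ) :=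
    (Finset.measurable_sum _ fun y _ => measurable_pi_apply y).div_const _
  have hind : IndepFun (normSum X u) (normSum (Z τ) u) P := ((hZ.indep τ).comp hg hg).symm
  rw [hV, hind.map_add_eq_map_conv_map₀ mX.aemeasurable mZ.aemeasurable, hZ.map_normSum]

lemma charFun_V (hZ : IsGaussianPerturbation X Z P) (hX : ∀ y, Measurable (X y)) (τ : ℝ≥0)
    (u : Fin d → ℕ+) (s : ℝ) : charFun (P.map (V X Z τ u)) s =
      charFun (P.map (boxSum X (sides u))) (s / √(boxVol u : ℝ)) *
        (Real.exp (-(τ * s ^ 2 / 2)) : ℝ) := by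
  have := Measure.isProbabilityMeasure_map (μ := P) (measurable_normSum hX u).aemeasurable
  rw [hZ.map_V hX, charFun_conv, charFun_normSum _ hX, charFun_gaussianReal_zero]
  push_cast; rfl

lemma integral_normSum (hX : IsFKGField X P) (u : Fin d → ℕ+) : ∫ ω, normSum X u ω ∂P = 0 := by
  rw [normSum_eq, integral_const_mul, hX.integral_boxSum, mul_zero]

/-- Basic properties of `V`: square integrable, centred, with additive variance. -/
lemma V_moments (hZ : IsGaussianPerturbation X Z P) (hX : IsFKGField X P) (τ : ℝ≥0)
    (u : Fin d → ℕ+) : MemLp (V X Z τ u) 2 P ∧ ∫ ω, V X Z τ u ω ∂P = 0 ∧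
      ∫ ω, V X Z τ u ω ^ 2 ∂P = Var[normSum X u; P] + τ ∧
      Var[V X Z τ u; P] = Var[normSum X u; P] + τ := by
  have mX := measurable_normSum hX.meas u
  have mZ := measurable_normSum (hZ.measurable τ) u
  have hV : V X Z τ u = fun ω => normSum X u ω + normSum (Z τ) u ω := by
    ext ω
    simp [V, normSum, Finset.sum_add_distrib, add_div]
  have hZl : HasLaw (normSum (Z τ) u) (gaussianReal 0 τ) P :=
    ⟨mZ.aemeasurable, hZ.map_normSum τ u⟩
  have hg : Measurable fun x : (Fin d → ℤ) → ℝ => (∑ y ∈ box u, x y) / √(boxVol u : ℝ) :=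
    (Finset.measurable_sum _ fun y _ => measurable_pi_apply y).div_const _
  have hind : IndepFun (normSum X u) (normSum (Z τ) u) P := ((hZ.indep τ).comp hg hg).symm
  have hZL : MemLp (normSum (Z τ) u) 2 P := by
    have h1 : MemLp id 2 (P.map (normSum (Z τ) u)) := by
      rw [hZ.map_normSum]; exact memLp_id_gaussianReal' 2 (by simp)
    exact (memLp_map_measure_iff (by fun_prop) mZ.aemeasurable).1 h1
  have hXL := memLp_normSum hX u
  have hZm : ∫ ω, normSum (Z τ) u ω ∂P = 0 := by
    rw [hZl.integral_eq]; simp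
  have hVL : MemLp (V X Z τ u) 2 P := by rw [hV]; exact hXL.add hZL
  have hVm : ∫ ω, V X Z τ u ω ∂P = 0 := by
    rw [hV, integral_add (hXL.integrable one_le_two) (hZL.integrable one_le_two), hZm,
      integral_normSum hX, add_zero]
  have hVar : Var[V X Z τ u; P] = Var[normSum X u; P] + τ := by
    rw [hV, hind.variance_fun_add hXL hZL, hZl.variance_eq, variance_id_gaussianReal]
  refine ⟨hVL, hVm, ?_, hVar⟩
  rw [← variance_of_integral_eq_zero hVL.aemeasurable hVm, hVar]

end Perturbation

/-! ### A Lindeberg estimate -/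

/-- The series remainder serves |x| ≤ 1, the triangle inequality the rest. In the Lindeberg argument
the quadratic bound is used on the tail event and the cubic one off it. -/
lemma norm_cexp_taylor_le (x : ℝ) :
    ‖Complex.exp (x * Complex.I) - 1 - x * Complex.I + x ^ 2 / 2‖ ≤ 4 * x ^ 2 ∧
    ‖Complex.exp (x * Complex.I) - 1 - x * Complex.I + x ^ 2 / 2‖ ≤ 4 * |x| ^ 3 := by
  have hn : ‖(x : ℂ) * Complex.I‖ = |x| := by simp
  have hx0 := abs_nonneg x
  rcases le_or_gt |x| 1 with h | h
  · have hb := Complex.exp_bound (x := (x : ℂ) * Complex.I) (by rw [hn]; exact h) (n := 3)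
      (by norm_num)
    have e : ∑ m ∈ Finset.range 3, ((x : ℂ) * Complex.I) ^ m / (m.factorial : ℂ) =
        1 + x * Complex.I - x ^ 2 / 2 := by
      simp [Finset.sum_range_succ, mul_pow, Nat.factorial]
      ring
    rw [e, hn] at hb
    have e2 : Complex.exp (x * Complex.I) - 1 - x * Complex.I + x ^ 2 / 2 =
        Complex.exp (x * Complex.I) - (1 + x * Complex.I - x ^ 2 / 2) := by ring
    rw [e2]
    have hb' : ‖Complex.exp (x * Complex.I) - (1 + x * Complex.I - x ^ 2 / 2)‖ ≤ |x| ^ 3 := by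
      refine hb.trans ?_
      refine mul_le_of_le_one_right (by positivity) ?_
      norm_num [Nat.factorial]
    have h3 : |x| ^ 3 ≤ x ^ 2 := by
      rw [← sq_abs x]; exact pow_le_pow_of_le_one hx0 h (by norm_num)
    have h4 : 0 ≤ |x| ^ 3 := by positivity
    constructor <;> nlinarith
  · have h1 : ‖Complex.exp (x * Complex.I) - 1 - x * Complex.I + x ^ 2 / 2‖ ≤
        1 + 1 + |x| + x ^ 2 / 2 := by
      refine (norm_add_le _ _).trans ?_
      gcongr
      · refine (norm_sub_le _ _).trans ?_
        rw [hn]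
        gcongr
        refine (norm_sub_le _ _).trans ?_
        rw [Complex.norm_exp_ofReal_mul_I, norm_one]
      · rw [norm_div, norm_pow, Complex.norm_real, Real.norm_eq_abs, sq_abs]
        simp
    have h2 : x ^ 2 = |x| ^ 2 := (sq_abs x).symm
    have h3 : |x| ≤ x ^ 2 := by rw [h2]; nlinarith
    have h4 : x ^ 2 ≤ |x| ^ 3 := by rw [h2]; exact pow_le_pow_right₀ h.le (by norm_num)
    constructor <;> linarith

variable [IsProbabilityMeasure P]

lemma integrable_cexp {U : Ω → ℝ} (hU : AEMeasurable U P) (r : ℝ) :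
    Integrable (fun ω => Complex.exp (r * U ω * Complex.I)) P := by
  refine Integrable.of_bound (by fun_prop) 1 (.of_forall fun ω => ?_)
  rw [← Complex.ofReal_mul, Complex.norm_exp_ofReal_mul_I]

lemma charFun_sub_taylor {U : Ω → ℝ} (hL : MemLp U 2 P) (h0 : ∫ ω, U ω ∂P = 0) (r : ℝ) :
    charFun (P.map U) r - (1 - r ^ 2 * Var[U; P] / 2 : ℝ) =
      ∫ ω, (Complex.exp ((r * U ω : ℝ) * Complex.I) - 1 - (r * U ω : ℝ) * Complex.I +
        ((r * U ω : ℝ) : ℂ) ^ 2 / 2) ∂P := by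
  have i0 : Integrable (fun ω => Complex.exp ((r * U ω : ℝ) * Complex.I)) P := by
    simpa using integrable_cexp hL.aemeasurable r
  have iU : Integrable U P := hL.integrable one_le_two
  have iU2 : Integrable (fun ω => U ω ^ 2) P := hL.integrable_sq
  have i1 : Integrable (fun ω => ((r * U ω : ℝ) : ℂ) * Complex.I) P :=
    ((iU.const_mul r).ofReal).mul_const _
  have i2 : Integrable (fun ω => (((r * U ω : ℝ) : ℂ) ^ 2 / 2)) P := by
    have := ((iU2.const_mul (r ^ 2 / 2)).ofReal (𝕜 := ℂ))
    refine this.congr (.of_forall fun ω => ?_)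
    simp; ring
  have e1 : ∫ ω, ((r * U ω : ℝ) : ℂ) * Complex.I ∂P = 0 := by
    rw [integral_mul_const, integral_complex_ofReal, integral_const_mul, h0]; simp
  have e2 : ∫ ω, (((r * U ω : ℝ) : ℂ) ^ 2 / 2) ∂P = ((r ^ 2 * Var[U; P] / 2 : ℝ) : ℂ) := by
    rw [variance_of_integral_eq_zero hL.aemeasurable h0]
    have : ∀ ω, (((r * U ω : ℝ) : ℂ) ^ 2 / 2) = ((r ^ 2 / 2 * U ω ^ 2 : ℝ) : ℂ) := by
      intro ω; push_cast; ring
    simp_rw [this]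
    rw [integral_complex_ofReal, integral_const_mul]
    congr 1; ring
  have e3 : charFun (P.map U) r = ∫ ω, Complex.exp ((r * U ω : ℝ) * Complex.I) ∂P := by
    rw [charFun_map_eq_integral hL.aemeasurable]; simp
  have i3 : Integrable (fun ω => Complex.exp ((r * U ω : ℝ) * Complex.I) - 1) P :=
    i0.sub (integrable_const _)
  have i4 : Integrable (fun ω => Complex.exp ((r * U ω : ℝ) * Complex.I) - 1 -
      (r * U ω : ℝ) * Complex.I) P := i3.sub i1
  rw [integral_add i4 i2, integral_sub i3 i1, integral_sub i0 (integrable_const _), e1, e2, e3]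
  simp only [integral_const, probReal_univ, one_smul]
  push_cast; ring

lemma norm_charFun_sub_one_le {U : Ω → ℝ} (hL : MemLp U 2 P) (h0 : ∫ ω, U ω ∂P = 0) (r : ℝ) :
    ‖charFun (P.map U) r - 1‖ ≤ 5 * r ^ 2 * Var[U; P] := by
  have iU2 : Integrable (fun ω => U ω ^ 2) P := hL.integrable_sq
  have h1 : ‖charFun (P.map U) r - (1 - r ^ 2 * Var[U; P] / 2 : ℝ)‖ ≤ 4 * r ^ 2 * Var[U; P] := by
    rw [charFun_sub_taylor hL h0, variance_of_integral_eq_zero hL.aemeasurable h0,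
      ← integral_const_mul]
    refine norm_integral_le_of_norm_le (iU2.const_mul _) (.of_forall fun ω => ?_)
    refine (norm_cexp_taylor_le (r * U ω)).1.trans_eq ?_
    ring
  have hv := variance_nonneg U P
  have h2 : charFun (P.map U) r - 1 = (charFun (P.map U) r - (1 - r ^ 2 * Var[U; P] / 2 : ℝ)) -
      ((r ^ 2 * Var[U; P] / 2 : ℝ) : ℂ) := by push_cast; ring
  rw [h2]
  refine (norm_sub_le _ _).trans ?_
  rw [Complex.norm_real, Real.norm_of_nonneg (by positivity)]
  have : 0 ≤ r ^ 2 * Var[U; P] := by positivity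
  linarith

/-- Split at |U| = Rσ: on the tail the quadratic Taylor bound meets ψ(R), below it one factor |U| of
the cubic bound is at most Rσ. -/
lemma norm_charFun_sub_le_of_inClass {U : Ω → ℝ} {ψ : ℝ → ℝ} (hm : Measurable U)
    (hU : InClass ψ U P) (h0 : ∫ ω, U ω ∂P = 0) (r R : ℝ) (hR : 0 ≤ R) :
    ‖charFun (P.map U) r - (1 - r ^ 2 * Var[U; P] / 2 : ℝ)‖ ≤
      4 * r ^ 2 * (Var[U; P] * ψ R) + 4 * |r| ^ 3 * (R * √Var[U; P] * Var[U; P]) := by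
  obtain ⟨hL, hψ⟩ := hU
  have iU2 : Integrable (fun ω => U ω ^ 2) P := hL.integrable_sq
  set A : Set Ω := {ω | R * √(Var[U; P]) ≤ |U ω|} with hA
  have hAm : MeasurableSet A := measurableSet_le measurable_const hm.abs
  set v := Var[U; P] with hv
  have hv0 : 0 ≤ v := variance_nonneg U P
  have hR' : 0 ≤ R * √v := by positivity
  have hpt : ∀ ω, ‖Complex.exp ((r * U ω : ℝ) * Complex.I) - 1 - (r * U ω : ℝ) * Complex.I +
        ((r * U ω : ℝ) : ℂ) ^ 2 / 2‖ ≤ 4 * r ^ 2 * A.indicator (fun ω => U ω ^ 2) ω +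
          4 * |r| ^ 3 * (R * √v * U ω ^ 2) := by
    intro ω
    obtain ⟨h1, h2⟩ := norm_cexp_taylor_le (r * U ω)
    by_cases hω : ω ∈ A
    · rw [Set.indicator_of_mem hω]
      refine h1.trans ?_
      have : 0 ≤ 4 * |r| ^ 3 * (R * √v * U ω ^ 2) := by positivity
      rw [mul_pow]; linarith
    · rw [Set.indicator_of_notMem hω]
      refine h2.trans ?_
      have hlt : |U ω| ≤ R * √v := (not_le.1 hω).le
      rw [abs_mul, mul_pow, mul_zero, zero_add, ← mul_assoc]
      have e : |U ω| ^ 3 = |U ω| * U ω ^ 2 := by rw [← sq_abs (U ω)]; ring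
      rw [e]
      gcongr
  have i1 : Integrable (fun ω => 4 * r ^ 2 * A.indicator (fun ω => U ω ^ 2) ω) P :=
    (iU2.indicator hAm).const_mul _
  have i2 : Integrable (fun ω => 4 * |r| ^ 3 * (R * √v * U ω ^ 2)) P :=
    (iU2.const_mul _).const_mul _
  rw [hv, charFun_sub_taylor hL h0]
  refine (norm_integral_le_of_norm_le (i1.add i2) (.of_forall hpt)).trans ?_
  simp only [Pi.add_apply]
  rw [integral_add i1 i2, integral_const_mul, integral_const_mul, integral_const_mul,
    integral_indicator hAm, ← variance_of_integral_eq_zero hL.aemeasurable h0, ← hv]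
  gcongr
  exact hψ R

lemma norm_pow_sub_pow_le_mul {a b : ℂ} (ha : ‖a‖ ≤ 1) (hb : ‖b‖ ≤ 1) (M : ℕ) :
    ‖a ^ M - b ^ M‖ ≤ M * ‖a - b‖ := by
  induction M with
  | zero => simp
  | succ M ih =>
    have e : a ^ (M + 1) - b ^ (M + 1) = (a ^ M - b ^ M) * a + b ^ M * (a - b) := by ring
    rw [e]
    refine (norm_add_le _ _).trans ?_
    rw [norm_mul, norm_mul, norm_pow]
    have h1 : ‖a ^ M - b ^ M‖ * ‖a‖ ≤ ‖a ^ M - b ^ M‖ := mul_le_of_le_one_right (norm_nonneg _) ha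
    have h2 : ‖b‖ ^ M * ‖a - b‖ ≤ ‖a - b‖ :=
      mul_le_of_le_one_left (norm_nonneg _) (pow_le_one₀ (norm_nonneg _) hb)
    push_cast; linarith

end

section

/-! ### The central limit theorem for box sums -/

lemma abs_exp_neg_sub_le {x y : ℝ} (hx : 0 ≤ x) (hy : 0 ≤ y) :
    |Real.exp (-x) - Real.exp (-y)| ≤ |x - y| := by
  have := abs_exp_sub_exp_le (N := 0) (x := -x) (y := -y) (by linarith) (by linarith)
  rw [Real.exp_zero, one_mul] at this
  refine this.trans_eq ?_
  rw [← abs_neg]; congr 1; ring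

lemma abs_exp_neg_sub_taylor_le {x : ℝ} (hx : 0 ≤ x) : |Real.exp (-x) - (1 - x)| ≤ x ^ 2 := by
  have h1 := Real.add_one_le_exp (-x)
  rw [abs_of_nonneg (by linarith)]
  rcases le_or_gt x 1 with h | h
  · have h2 := Real.add_one_le_exp x
    have h3 : Real.exp (-x) * Real.exp x = 1 := by rw [← Real.exp_add]; simp
    have h4 : 0 < Real.exp (-x) := Real.exp_pos _
    have h5 : Real.exp (-x) * (x + 1) ≤ 1 := by nlinarith
    nlinarith
  · have : Real.exp (-x) ≤ 1 := Real.exp_le_one_iff.2 (by linarith)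
    nlinarith

/-- Comparison of the `M`-th power of an approximately Gaussian characteristic function with a
Gaussian. -/
lemma norm_pow_sub_gaussian_le {y : ℂ} (hy : ‖y‖ ≤ 1) {M : ℕ} (hM : 0 < M)
    {s p v K R η : ℝ} (hp : 0 ≤ p) (hpM : M * p ≤ 1) (hv : 0 ≤ v) (hvK : v ≤ K) (hR : 0 ≤ R)
    (h : ‖y - (1 - s ^ 2 * p * v / 2 : ℝ)‖ ≤
      4 * (s ^ 2 * p) * (v * η) + 4 * (|s| ^ 3 * (p * √p)) * (R * √v * v)) :
    ‖y ^ M - (Real.exp (-(M * p * v * s ^ 2 / 2)) : ℝ)‖ ≤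
      4 * s ^ 2 * K * |η| + 4 * |s| ^ 3 * R * (K * √K) / √M + s ^ 4 * K ^ 2 / M := by
  have hM0 : (0 : ℝ) < M := by exact_mod_cast hM
  have hK : 0 ≤ K := hv.trans hvK
  have hpM' : p ≤ 1 / M := by rw [le_div_iff₀ hM0]; linarith
  set w := s ^ 2 * p * v / 2 with hw
  have hw0 : 0 ≤ w := by positivity
  set g : ℂ := ((Real.exp (-w) : ℝ) : ℂ) with hg
  have hg1 : ‖g‖ ≤ 1 := by
    rw [hg, Complex.norm_real, Real.norm_of_nonneg (Real.exp_nonneg _), Real.exp_le_one_iff]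
    linarith
  have e1 : ((Real.exp (-(M * p * v * s ^ 2 / 2)) : ℝ) : ℂ) = g ^ M := by
    rw [hg, ← Complex.ofReal_pow, ← Real.exp_nat_mul]
    congr 2; rw [hw]; ring
  have h1 : ‖y - g‖ ≤ 4 * (s ^ 2 * p) * (v * η) + 4 * (|s| ^ 3 * (p * √p)) * (R * √v * v) +
      w ^ 2 := by
    have e2 : y - g = (y - (1 - w : ℝ)) - (g - (1 - w : ℝ)) := by ring
    rw [e2]
    refine (norm_sub_le _ _).trans (add_le_add h ?_)
    rw [hg, ← Complex.ofReal_sub, Complex.norm_real]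
    exact abs_exp_neg_sub_taylor_le hw0
  rw [e1]
  refine (norm_pow_sub_pow_le_mul hy hg1 M).trans ?_
  refine (mul_le_mul_of_nonneg_left h1 hM0.le).trans ?_
  -- As M p ≤ 1, the M errors add up to at most one error of unit scale. This first term gains
  -- nothing from M and is small only through η; the next two gain √p ≤ 1/√M and p ≤ 1/M.
  have t1 : M * (4 * (s ^ 2 * p) * (v * η)) ≤ 4 * s ^ 2 * K * |η| := by
    calc M * (4 * (s ^ 2 * p) * (v * η)) = (M * p) * (4 * s ^ 2 * v * η) := by ring
      _ ≤ (M * p) * (4 * s ^ 2 * v * |η|) := by gcongr; exact le_abs_self η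
      _ ≤ 1 * (4 * s ^ 2 * v * |η|) := by gcongr
      _ ≤ _ := by rw [one_mul]; gcongr
  have t2 : M * (4 * (|s| ^ 3 * (p * √p)) * (R * √v * v)) ≤
      4 * |s| ^ 3 * R * (K * √K) / √M := by
    have q1 : √p ≤ 1 / √M := by
      have := Real.sqrt_le_sqrt hpM'
      rwa [Real.sqrt_div zero_le_one, Real.sqrt_one] at this
    calc M * (4 * (|s| ^ 3 * (p * √p)) * (R * √v * v))
        = (M * p) * (4 * |s| ^ 3 * R * (v * √v) * √p) := by ring
      _ ≤ 1 * (4 * |s| ^ 3 * R * (v * √v) * √p) := by gcongr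
      _ ≤ 1 * (4 * |s| ^ 3 * R * (K * √K) * (1 / √M)) := by gcongr
      _ = _ := by ring
  have t3 : M * w ^ 2 ≤ s ^ 4 * K ^ 2 / M := by
    calc M * w ^ 2 = (M * p) * (s ^ 4 * v ^ 2 * p / 4) := by rw [hw]; ring
      _ ≤ 1 * (s ^ 4 * v ^ 2 * p / 4) := by gcongr
      _ ≤ 1 * (s ^ 4 * K ^ 2 * (1 / M) / 4) := by gcongr
      _ ≤ _ := by
        have : 0 ≤ s ^ 4 * K ^ 2 / M := by positivity
        have e : 1 * (s ^ 4 * K ^ 2 * (1 / M) / 4) = s ^ 4 * K ^ 2 / M / 4 := by ring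
        rw [e]; linarith
  rw [mul_add, mul_add]
  linarith

variable {Ω : Type*} [MeasurableSpace Ω] {P : Measure Ω} {d : ℕ} [IsProbabilityMeasure P]
  {X : (Fin d → ℤ) → Ω → ℝ} {Z : ℝ≥0 → (Fin d → ℤ) → Ω → ℝ}

/-- The sum of all covariances `Cov(X₀, X_h)`. -/
def suscept (X : (Fin d → ℤ) → Ω → ℝ) (P : Measure Ω) : ℝ := ∑' h, cov[X 0, X h; P]

lemma variance_V_le (hX : IsFKGField X P) (hZ : IsGaussianPerturbation X Z P) (τ : ℝ≥0)
    (u : Fin d → ℕ+) : Var[V X Z τ u; P] ≤ suscept X P + τ := by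
  have hpos : (0 : ℝ) < boxVol u := by exact_mod_cast boxVol_pos u
  rw [(V_moments hZ hX τ u).2.2.2, variance_normSum]
  gcongr
  rw [div_le_iff₀ hpos]
  refine (hX.variance_boxSum_le (sides u)).trans_eq ?_
  rw [suscept]; congr 1
  simp [boxVol, sides]

variable [Nonempty (Fin d)]

set_option maxHeartbeats 1000000 in
/-- Quantitative comparison of `V` with a normal law of the same variance. -/
lemma norm_charFun_V_sub_le (hX : IsFKGField X P) (hZ : IsGaussianPerturbation X Z P) (τ : ℝ≥0)
    {ψ : ℝ → ℝ} (hψ : ∀ u, InClass ψ (V X Z τ u) P) (s : ℝ) {R : ℝ} (hR : 0 ≤ R) {M : ℕ}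
    (hM : 0 < M) (u : Fin d → ℕ+) (hu : M ≤ side u) :
    ‖charFun (P.map (V X Z τ u)) s - (Real.exp (-(Var[V X Z τ u; P] * s ^ 2 / 2)) : ℝ)‖ ≤
      6 * s ^ 2 * (|(Var[boxSum X (sides u); P] - M * Var[boxSum X
        (Function.update (sides u) (longest u) (side u / M)); P]) / boxVol u| +
          τ * (M / side u)) +
      (4 * s ^ 2 * (suscept X P + τ) * |ψ R| +
        4 * |s| ^ 3 * R * ((suscept X P + τ) * √(suscept X P + τ)) / √M +
        s ^ 4 * (suscept X P + τ) ^ 2 / M) := by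
  set i := longest u with hi
  set q := side u / M with hq
  set a := side u % M with ha
  have hq0 : 0 < q := Nat.div_pos hu hM
  -- A slab is again a box with positive sides, since M ≤ `side u` makes q positive, so the class
  -- hypothesis applies to it directly.
  set u' : Fin d → ℕ+ := Function.update u i (q.toPNat hq0) with hu'
  have hsides : sides u' = Function.update (sides u) i q := by
    ext k
    change ((Function.update u i (q.toPNat hq0) k : ℕ+) : ℕ) = _
    by_cases hk : k = i
    · rw [hk, Function.update_self, Function.update_self]; rfl
    · rw [Function.update_of_ne hk, Function.update_of_ne hk]; rfl
  have hside : Function.update (sides u) i (a + M * q) = sides u := by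
    rw [Nat.mod_add_div]; exact Function.update_eq_self i (sides u)
  have hvol : boxVol u' * side u = boxVol u * q := by
    have e1 : boxVol u' = q * ∏ k ∈ Finset.univ.erase i, sides u k := by
      have : boxVol u' = ∏ k, sides u' k := rfl
      rw [this, hsides, ← Finset.mul_prod_erase _ _ (Finset.mem_univ i), Function.update_self]
      congr 1
      refine Finset.prod_congr rfl fun k hk => ?_
      rw [Function.update_of_ne (Finset.ne_of_mem_erase hk)]
    have e2 : boxVol u = side u * ∏ k ∈ Finset.univ.erase i, sides u k :=
      (Finset.mul_prod_erase _ _ (Finset.mem_univ i)).symm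
    rw [e1, e2]; ring
  have hv0 : (0 : ℝ) < boxVol u := by exact_mod_cast boxVol_pos u
  have hv0' : (0 : ℝ) < boxVol u' := by exact_mod_cast boxVol_pos u'
  have hs0 : (0 : ℝ) < side u := by exact_mod_cast hM.trans_le hu
  have hM0 : (0 : ℝ) < M := by exact_mod_cast hM
  -- The volume ratio of slab to box: frequency s for the box corresponds to s√p for the normalised
  -- slab.
  set p : ℝ := q / side u with hp
  have hp0 : 0 < p := by have : (0 : ℝ) < q := by exact_mod_cast hq0
                         positivity
  have hpv : (boxVol u' : ℝ) = p * boxVol u := by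
    have : (boxVol u' : ℝ) * side u = boxVol u * q := by exact_mod_cast hvol
    rw [hp]; field_simp; linarith
  have hsq : (side u : ℝ) = a + M * q := by exact_mod_cast (Nat.mod_add_div (side u) M).symm
  have hMp : 1 - M * p = a / side u := by
    rw [hp]; field_simp; linarith
  have haM : (a : ℝ) ≤ M := by exact_mod_cast (Nat.mod_lt _ hM).le
  have hMp0 : 0 ≤ 1 - M * p := by rw [hMp]; positivity
  have hMp1 : 1 - M * p ≤ M / side u := by rw [hMp]; gcongr
  -- the three box sums
  set W := boxSum X (sides u) with hW
  set W' := boxSum X (Function.update (sides u) i q) with hW'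
  set Wa := boxSum X (Function.update (sides u) i a) with hWa
  set ρ := s / √(boxVol u : ℝ) with hρ
  have hρ2 : ρ ^ 2 = s ^ 2 / boxVol u := by rw [hρ, div_pow, Real.sq_sqrt hv0.le]
  set x := charFun (P.map W) ρ with hx
  set y := charFun (P.map W') ρ with hy
  set z := charFun (P.map Wa) ρ with hz
  have hN := hX.norm_charFun_boxSum_sub_le (sides u) i a q ρ M
  rw [hside] at hN
  have hN2 := norm_charFun_sub_one_le (hX.memLp_boxSum (Function.update (sides u) i a))
    (hX.integral_boxSum _) ρ
  have hy1 : ‖y‖ ≤ 1 := by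
    have := Measure.isProbabilityMeasure_map (μ := P) (hX.measurable_boxSum
      (Function.update (sides u) i q)).aemeasurable
    exact norm_charFun_le_one ρ
  set δ := (Var[W; P] - M * Var[W'; P]) / boxVol u with hδ
  -- Replacing the characteristic function z of the remainder slab by 1 costs 5ρ² Var(Wa), while the
  -- Newman bound has 2ρ² times a nonnegative defect from which Var(Wa) is already subtracted.
  -- Raising 2 to 5 cancels Var(Wa).
  have hxy : ‖x - y ^ M‖ ≤ 5 * s ^ 2 * |δ| := by
    have e : x - y ^ M = (x - z * y ^ M) + (z - 1) * y ^ M := by ring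
    rw [e]
    refine (norm_add_le _ _).trans ?_
    have h2 : ‖(z - 1) * y ^ M‖ ≤ ‖z - 1‖ := by
      rw [norm_mul, norm_pow]
      exact mul_le_of_le_one_right (norm_nonneg _) (pow_le_one₀ (norm_nonneg _) hy1)
    have h3 : 0 ≤ 2 * ρ ^ 2 * (Var[W; P] - Var[Wa; P] - M * Var[W'; P]) :=
      (norm_nonneg _).trans hN
    have h4 : 5 * ρ ^ 2 * (Var[W; P] - M * Var[W'; P]) = 5 * s ^ 2 * δ := by
      rw [hρ2, hδ]; ring
    have h5 : 5 * s ^ 2 * δ ≤ 5 * s ^ 2 * |δ| := by gcongr; exact le_abs_self δ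
    have hN' : ‖x - z * y ^ M‖ ≤ 2 * ρ ^ 2 * (Var[W; P] - Var[Wa; P] - M * Var[W'; P]) := hN
    have hN2' : ‖z - 1‖ ≤ 5 * ρ ^ 2 * Var[Wa; P] := hN2
    nlinarith
  -- pass to the perturbed variables
  set e1 : ℝ := Real.exp (-(τ * s ^ 2 / 2)) with he1
  set e2 : ℝ := Real.exp (-(τ * (s ^ 2 * p) / 2)) with he2
  have hVu : charFun (P.map (V X Z τ u)) s = x * e1 := charFun_V hZ hX.meas τ u s
  have hs' : s * √p / √(boxVol u' : ℝ) = ρ := by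
    rw [hpv, Real.sqrt_mul hp0.le, hρ]
    have : √p ≠ 0 := by positivity
    field_simp
  have hVu' : charFun (P.map (V X Z τ u')) (s * √p) = y * e2 := by
    rw [charFun_V hZ hX.meas, hs', hsides, mul_pow, Real.sq_sqrt hp0.le]
  have he1le : e1 ≤ 1 := Real.exp_le_one_iff.2 (by
    have : 0 ≤ (τ : ℝ) * s ^ 2 / 2 := by positivity
    linarith)
  have he10 : 0 ≤ e1 := Real.exp_nonneg _
  -- The M slabs carry only the fraction M p of the added Gaussian variance; the missing part 1 - M
  -- p is at most M divided by the longest side.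
  have he2M : |e1 - e2 ^ M| ≤ τ * s ^ 2 / 2 * (1 - M * p) := by
    rw [he1, he2, ← Real.exp_nat_mul, mul_neg]
    refine (abs_exp_neg_sub_le (by positivity) (by positivity)).trans_eq ?_
    have : τ * s ^ 2 / 2 - M * (τ * (s ^ 2 * p) / 2) = τ * s ^ 2 / 2 * (1 - M * p) := by ring
    rw [this, abs_of_nonneg (mul_nonneg (by positivity) hMp0)]
  have hstep : ‖charFun (P.map (V X Z τ u)) s - charFun (P.map (V X Z τ u')) (s * √p) ^ M‖ ≤
      5 * s ^ 2 * |δ| + τ * s ^ 2 / 2 * (1 - M * p) := by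
    rw [hVu, hVu']
    have e : x * e1 - (y * e2) ^ M = (x - y ^ M) * (e1 : ℂ) + y ^ M * ((e1 - e2 ^ M : ℝ) : ℂ) := by
      push_cast; ring
    rw [e]
    refine (norm_add_le _ _).trans (add_le_add ?_ ?_)
    · rw [norm_mul, Complex.norm_real, Real.norm_of_nonneg he10]
      exact (mul_le_of_le_one_right (norm_nonneg _) he1le).trans hxy
    · rw [norm_mul, Complex.norm_real, norm_pow]
      exact (mul_le_of_le_one_left (norm_nonneg _) (pow_le_one₀ (norm_nonneg _) hy1)).trans he2M
  -- the Lindeberg estimate for the slab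
  set v' := Var[V X Z τ u'; P] with hv'
  have hm' := V_moments hZ hX τ u'
  have hlin := norm_charFun_sub_le_of_inClass (measurable_V hZ hX.meas τ u') (hψ u') hm'.2.1
    (s * √p) R hR
  have hcf1 : ‖charFun (P.map (V X Z τ u')) (s * √p)‖ ≤ 1 := by
    have := Measure.isProbabilityMeasure_map (μ := P) (measurable_V hZ hX.meas τ u').aemeasurable
    exact norm_charFun_le_one _
  have hsp2 : (s * √p) ^ 2 = s ^ 2 * p := by rw [mul_pow, Real.sq_sqrt hp0.le]
  have hsp3 : |s * √p| ^ 3 = |s| ^ 3 * (p * √p) := by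
    rw [abs_mul, abs_of_nonneg (Real.sqrt_nonneg p), mul_pow]
    congr 1
    calc √p ^ 3 = √p ^ 2 * √p := by ring
      _ = _ := by rw [Real.sq_sqrt hp0.le]
  rw [hsp2, hsp3, ← hv'] at hlin
  have hpow := norm_pow_sub_gaussian_le hcf1 hM hp0.le (by linarith) (variance_nonneg _ _)
    (variance_V_le hX hZ τ u') hR hlin
  rw [← hv'] at hpow
  -- comparison of the variances
  have hvar : Var[V X Z τ u; P] - M * p * v' = δ + τ * (1 - M * p) := by
    rw [hv', hm'.2.2.2, (V_moments hZ hX τ u).2.2.2, variance_normSum, variance_normSum, hsides,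
      hpv, hδ]
    field_simp
    ring
  have hlast : ‖((Real.exp (-(M * p * v' * s ^ 2 / 2)) : ℝ) : ℂ) -
      (Real.exp (-(Var[V X Z τ u; P] * s ^ 2 / 2)) : ℝ)‖ ≤
      s ^ 2 / 2 * (|δ| + τ * (1 - M * p)) := by
    rw [← Complex.ofReal_sub, Complex.norm_real]
    have hv1 := variance_nonneg (V X Z τ u) P
    have hv2 := variance_nonneg (V X Z τ u') P
    refine (abs_exp_neg_sub_le (by positivity) (by positivity)).trans ?_
    have : M * p * v' * s ^ 2 / 2 - Var[V X Z τ u; P] * s ^ 2 / 2 =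
        -(s ^ 2 / 2 * (δ + τ * (1 - M * p))) := by rw [← hvar]; ring
    rw [this, abs_neg, abs_mul, abs_of_nonneg (by positivity : 0 ≤ s ^ 2 / 2)]
    gcongr
    refine (abs_add_le _ _).trans ?_
    rw [abs_of_nonneg (mul_nonneg τ.coe_nonneg hMp0)]
  set cV := charFun (P.map (V X Z τ u)) s
  set cV' := charFun (P.map (V X Z τ u')) (s * √p)
  set G : ℂ := ((Real.exp (-(M * p * v' * s ^ 2 / 2)) : ℝ) : ℂ)
  set GV : ℂ := ((Real.exp (-(Var[V X Z τ u; P] * s ^ 2 / 2)) : ℝ) : ℂ)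
  have e : cV - GV = (cV - cV' ^ M) + (cV' ^ M - G) + (G - GV) := by ring
  rw [e]
  refine (norm_add₃_le).trans ?_
  have f1 : (τ : ℝ) * (1 - M * p) ≤ τ * (M / side u) := by gcongr
  have f2 : 0 ≤ (τ : ℝ) * (1 - M * p) := mul_nonneg τ.coe_nonneg hMp0
  have f3 : s ^ 2 * (τ * (1 - M * p)) ≤ s ^ 2 * (τ * (M / side u)) := by gcongr
  have f4 : 0 ≤ s ^ 2 * (τ * (1 - M * p)) := mul_nonneg (sq_nonneg s) f2
  have f5 : 0 ≤ s ^ 2 * |δ| := by positivity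
  have g1 : 5 * s ^ 2 * |δ| + τ * s ^ 2 / 2 * (1 - M * p) =
      5 * (s ^ 2 * |δ|) + s ^ 2 * (τ * (1 - M * p)) / 2 := by ring
  have g2 : s ^ 2 / 2 * (|δ| + τ * (1 - M * p)) =
      s ^ 2 * |δ| / 2 + s ^ 2 * (τ * (1 - M * p)) / 2 := by ring
  have g3 : 6 * s ^ 2 * (|δ| + τ * (M / side u)) =
      6 * (s ^ 2 * |δ|) + 6 * (s ^ 2 * (τ * (M / side u))) := by ring
  rw [g1] at hstep
  rw [g2] at hlast
  rw [g3]
  linarith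

/-- The order of choices matters: R makes the tail term small, then M depends on R, then u is taken
large for that M. The comparison Gaussian moves with u because the variances are not shown to
converge. -/
theorem tendsto_charFun_V_sub (hX : IsFKGField X P) (hZ : IsGaussianPerturbation X Z P) (τ : ℝ≥0)
    (hUI : UniformIntegrability X Z P τ) (s : ℝ) :
    Tendsto (fun u : Fin d → ℕ+ => charFun (P.map (V X Z τ u)) s -
      (Real.exp (-(Var[V X Z τ u; P] * s ^ 2 / 2)) : ℝ)) (comap boxVol atTop) (𝓝 0) := by
  obtain ⟨ψ, hψ0, hψ⟩ := hUI
  set K := suscept X P + τ with hK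
  rw [Metric.tendsto_nhds]
  intro ε hε
  -- choose the truncation level
  obtain ⟨R, hR0, hR⟩ : ∃ R : ℝ, 0 ≤ R ∧ 4 * s ^ 2 * K * |ψ R| < ε / 4 := by
    have h1 : Tendsto (fun R => 4 * s ^ 2 * K * |ψ R|) atTop (𝓝 (4 * s ^ 2 * K * |0|)) :=
      hψ0.abs.const_mul _
    rw [abs_zero, mul_zero] at h1
    exact ((eventually_ge_atTop 0).and (h1.eventually (gt_mem_nhds (by positivity)))).exists
  -- choose the number of slabs
  obtain ⟨M, hM0, hM⟩ : ∃ M : ℕ, 0 < M ∧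
      4 * |s| ^ 3 * R * (K * √K) / √M + s ^ 4 * K ^ 2 / M < ε / 4 := by
    have hc : Tendsto (fun M : ℕ => (M : ℝ)) atTop atTop := tendsto_natCast_atTop_atTop
    have h1 : Tendsto (fun M : ℕ => 4 * |s| ^ 3 * R * (K * √K) / √(M : ℝ) + s ^ 4 * K ^ 2 / (M : ℝ))
        atTop (𝓝 (0 + 0)) :=
      (tendsto_const_nhds.div_atTop (Real.tendsto_sqrt_atTop.comp hc)).add
        (tendsto_const_nhds.div_atTop hc)
    rw [add_zero] at h1
    exact ((eventually_gt_atTop 0).and (h1.eventually (gt_mem_nhds (by positivity)))).exists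
  have hs : Tendsto (fun u : Fin d → ℕ+ => (side u : ℝ)) (comap boxVol atTop) atTop :=
    tendsto_natCast_atTop_atTop.comp tendsto_side
  have h2 : Tendsto (fun u : Fin d → ℕ+ => 6 * s ^ 2 * (|(Var[boxSum X (sides u); P] - M *
      Var[boxSum X (Function.update (sides u) (longest u) (side u / M)); P]) / boxVol u| +
          τ * (M / side u))) (comap boxVol atTop) (𝓝 (6 * s ^ 2 * (|0| + τ * 0))) :=
    (((hX.tendsto_variance_defect hM0).abs).add
      ((tendsto_const_nhds.div_atTop hs).const_mul _)).const_mul _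
  rw [abs_zero, mul_zero, add_zero, mul_zero] at h2
  filter_upwards [tendsto_side.eventually (eventually_ge_atTop M),
    h2.eventually (gt_mem_nhds (by positivity : 0 < ε / 4))] with u hu1 hu2
  rw [dist_zero_right]
  have := norm_charFun_V_sub_le hX hZ τ hψ s hR0 hM0 u hu1
  linarith

end

section

/-! ### Uniform integrability implies convergence of the relative entropy -/

variable {Ω : Type*} [MeasurableSpace Ω] {P : Measure Ω} {d : ℕ} [IsProbabilityMeasure P]
  {X : (Fin d → ℤ) → Ω → ℝ} {Z : ℝ≥0 → (Fin d → ℤ) → Ω → ℝ}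

/-- Zero variance would concentrate the law on a point, which an absolutely continuous law does not
charge. -/
lemma variance_pos_of_hasPDF {U : Ω → ℝ} (hU : MemLp U 2 P) (hd : HasPDF U P volume) :
    0 < Var[U; P] := by
  refine lt_of_le_of_ne (variance_nonneg _ _) fun h => ?_
  have hc := ae_eq_integral_of_variance_eq_zero hU h.symm
  have h0 : P.map U {∫ ω, U ω ∂P} = 0 := hd.absolutelyContinuous Real.volume_singleton
  rw [Measure.map_apply_of_aemeasurable hd.aemeasurable (measurableSet_singleton _)] at h0
  have h1 : ∀ᵐ ω ∂P, ω ∉ U ⁻¹' {∫ ω, U ω ∂P} := measure_eq_zero_iff_ae_notMem.1 h0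
  obtain ⟨ω, h2, h3⟩ := (h1.and hc).exists
  exact h2 h3

lemma le_variance_V (hX : IsFKGField X P) (hZ : IsGaussianPerturbation X Z P) (τ : ℝ≥0)
    (u : Fin d → ℕ+) : Var[X 0; P] + τ ≤ Var[V X Z τ u; P] := by
  have hpos : (0 : ℝ) < boxVol u := by exact_mod_cast boxVol_pos u
  rw [(V_moments hZ hX τ u).2.2.2, variance_normSum]
  gcongr
  rw [le_div_iff₀ hpos]
  refine le_trans (le_of_eq ?_) (hX.le_variance_boxSum (sides u))
  simp [boxVol, sides]

lemma map_V_add (hX : IsFKGField X P) (hZ : IsGaussianPerturbation X Z P) (τ t : ℝ≥0)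
    (u : Fin d → ℕ+) : P.map (V X Z (τ + t) u) = P.map (V X Z τ u) ∗ gaussianReal 0 t := by
  have := Measure.isProbabilityMeasure_map (μ := P) (measurable_normSum hX.meas u).aemeasurable
  rw [hZ.map_V hX.meas, hZ.map_V hX.meas, Measure.conv_assoc, gaussianReal_conv_gaussianReal,
    add_zero]

/-- Heat flow for time t raises the perturbation parameter from τ to τ + t, in law. This links the
entropy bound to `kappa`. -/
lemma excess_fisher_V (hX : IsFKGField X P) (hZ : IsGaussianPerturbation X Z P) (τ : ℝ≥0)
    (u : Fin d → ℕ+) {t : ℝ} (ht : 0 < t) :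
    ENNReal.ofReal (fisher (P.map (V X Z τ u)) t - 1 / (Var[V X Z τ u; P] + t)) =
      stdFisherInfo (V X Z (τ + t.toNNReal) u) P / ENNReal.ofReal (Var[V X Z τ u; P] + t) := by
  have := Measure.isProbabilityMeasure_map (μ := P) (measurable_V hZ hX.meas τ u).aemeasurable
  have ht' : t.toNNReal ≠ 0 := by simpa using ht
  have hv := variance_nonneg (V X Z τ u) P
  have hvar : Var[V X Z (τ + t.toNNReal) u; P] = Var[V X Z τ u; P] + t := by
    rw [(V_moments hZ hX _ u).2.2.2, (V_moments hZ hX τ u).2.2.2, NNReal.coe_add,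
      Real.coe_toNNReal _ ht.le]
    ring
  have hpos : 0 < Var[V X Z τ u; P] + t := by linarith
  rw [stdFisherInfo, hvar, map_V_add hX hZ, fisherInfo_conv_gaussianReal _ ht',
    Real.coe_toNNReal _ ht.le, ← ENNReal.ofReal_mul hpos.le, ← ENNReal.ofReal_one,
    ← ENNReal.ofReal_sub _ zero_le_one, ← ENNReal.ofReal_div_of_pos hpos]
  congr 1
  field_simp

/-- The integrable majorant, uniform over boxes of volume at least n. With v = Var X₀ > 0 the
denominator is at least v + τ + t, and (1 + 1/v)(v + τ + t) ≥ 1 + τ + t. -/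
lemma excess_fisher_V_le (hX : IsFKGField X P) (hZ : IsGaussianPerturbation X Z P) (τ : ℝ≥0)
    (hv : 0 < Var[X 0; P]) {n : ℕ} (u : Fin d → ℕ+) (hu : n ≤ boxVol u) {t : ℝ} (ht : 0 < t) :
    ENNReal.ofReal (fisher (P.map (V X Z τ u)) t - 1 / (Var[V X Z τ u; P] + t)) ≤
      ENNReal.ofReal (1 + 1 / Var[X 0; P]) *
        (kappa X Z P n (t + τ).toNNReal / ENNReal.ofReal (1 + (t + τ))) := by
  rw [excess_fisher_V hX hZ τ u ht]
  have e : (t + τ).toNNReal = τ + t.toNNReal := by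
    rw [Real.toNNReal_add ht.le τ.coe_nonneg, Real.toNNReal_coe, add_comm]
  have h1 : stdFisherInfo (V X Z (τ + t.toNNReal) u) P ≤ kappa X Z P n (τ + t.toNNReal) :=
    le_iSup₂_of_le (f := fun (u : Fin d → ℕ+) (_ : n ≤ boxVol u) =>
      stdFisherInfo (V X Z (τ + t.toNNReal) u) P) u hu le_rfl
  have hle := le_variance_V hX hZ τ u
  have hτ := τ.coe_nonneg
  have hpos : 0 < Var[V X Z τ u; P] + t := by linarith
  have h2 : (ENNReal.ofReal (Var[V X Z τ u; P] + t))⁻¹ ≤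
      ENNReal.ofReal (1 + 1 / Var[X 0; P]) * (ENNReal.ofReal (1 + (t + τ)))⁻¹ := by
    rw [← ENNReal.ofReal_inv_of_pos hpos, ← ENNReal.ofReal_inv_of_pos (by linarith),
      ← ENNReal.ofReal_mul (by positivity)]
    apply ENNReal.ofReal_le_ofReal
    rw [← div_eq_mul_inv, inv_eq_one_div, div_le_div_iff₀ hpos (by linarith), one_mul]
    have h3 : (1 + 1 / Var[X 0; P]) * (Var[X 0; P] + τ + t) ≤
      (1 + 1 / Var[X 0; P]) * (Var[V X Z τ u; P] + t) := by gcongr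
    refine le_trans ?_ h3
    have h4 : (1 + 1 / Var[X 0; P]) * (Var[X 0; P] + τ + t) =
        Var[X 0; P] + τ + t + 1 + (τ + t) / Var[X 0; P] := by field_simp; ring
    have h5 : 0 ≤ (τ + t) / Var[X 0; P] := by positivity
    rw [h4]; linarith
  rw [e, ENNReal.div_eq_inv_mul, ENNReal.div_eq_inv_mul, ← mul_assoc]
  exact mul_le_mul' h2 h1

lemma lintegral_Ioi_add_le (g : ℝ → ℝ≥0∞) {τ : ℝ} (hτ : 0 ≤ τ) :
    ∫⁻ t in Set.Ioi (0 : ℝ), g (t + τ) ≤ ∫⁻ t in Set.Ioi (0 : ℝ), g t := by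
  rw [← lintegral_indicator measurableSet_Ioi, ← lintegral_indicator measurableSet_Ioi,
    ← lintegral_add_right_eq_self (fun t => Set.indicator (Set.Ioi (0 : ℝ)) g t) τ]
  refine lintegral_mono fun t => ?_
  by_cases ht : t ∈ Set.Ioi (0 : ℝ)
  · have h2 : t + τ ∈ Set.Ioi (0 : ℝ) := by
      rw [Set.mem_Ioi] at *; linarith
    rw [Set.indicator_of_mem ht, Set.indicator_of_mem h2]
  · rw [Set.indicator_of_notMem ht]; exact zero_le

/-- The variances stay in a compact interval of positive numbers, so every sequence of boxes has a
subsequence along which they converge. Along it the limit law is a fixed nondegenerate normal and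
`tendsto_excess_fisher` applies. -/
lemma tendsto_excess_fisher_V [Nonempty (Fin d)] (hX : IsFKGField X P)
    (hZ : IsGaussianPerturbation X Z P) (τ : ℝ≥0) (hv : 0 < Var[X 0; P])
    (hUI : UniformIntegrability X Z P τ) {t : ℝ} (ht : 0 < t) :
    Tendsto (fun u : Fin d → ℕ+ => ENNReal.ofReal
      (fisher (P.map (V X Z τ u)) t - 1 / (Var[V X Z τ u; P] + t)))
      (comap boxVol atTop) (𝓝 0) := by
  refine tendsto_of_subseq_tendsto fun ns hns => ?_
  have hmem : ∀ n, Var[V X Z τ (ns n); P] ∈ Set.Icc (Var[X 0; P] + τ) (suscept X P + τ) :=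
    fun n => ⟨le_variance_V hX hZ τ _, variance_V_le hX hZ τ _⟩
  obtain ⟨a, ha, φ, hφ, hlim⟩ := isCompact_Icc.tendsto_subseq hmem
  have ha0 : 0 < a := by
    have := τ.coe_nonneg
    linarith [ha.1]
  have hprob : ∀ n, IsProbabilityMeasure (P.map (V X Z τ (ns (φ n)))) := fun n =>
    Measure.isProbabilityMeasure_map (measurable_V hZ hX.meas τ _).aemeasurable
  refine ⟨φ, tendsto_excess_fisher (v := a.toNNReal) (by simpa using ha0) (fun s => ?_)
    (s := fun n => Var[V X Z τ (ns (φ n)); P]) ?_ ht⟩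
  · have h1 := (tendsto_charFun_V_sub hX hZ τ hUI s).comp (hns.comp hφ.tendsto_atTop)
    have hc : Continuous fun v : ℝ => ((Real.exp (-(v * s ^ 2 / 2)) : ℝ) : ℂ) := by fun_prop
    have h2 := (hc.tendsto a).comp hlim
    have h3 := h1.add h2
    rw [zero_add] at h3
    refine (h3.congr fun n => ?_).trans (le_of_eq ?_)
    · simp
    · rw [charFun_gaussianReal_zero]
      congr 1
      push_cast
      rw [Real.coe_toNNReal _ ha0.le]
  · rw [Real.coe_toNNReal _ ha0.le]; exact hlim

theorem tendsto_relEntropy_of_uniformIntegrability [Nonempty (Fin d)] (hX : IsFKGField X P)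
    (hZ : IsGaussianPerturbation X Z P) (hv : 0 < Var[X 0; P])
    (hκ : ∃ n : ℕ, ∫⁻ t in Set.Ioi (0 : ℝ),
      kappa X Z P n t.toNNReal / ENNReal.ofReal (1 + t) < ∞)
    (τ : ℝ≥0) (hUI : UniformIntegrability X Z P τ) :
    Tendsto (fun u : Fin d → ℕ+ => relEntropy (V X Z τ u) P) (comap boxVol atTop) (𝓝 0) := by
  obtain ⟨n, hn⟩ := hκ
  have hprob : ∀ u, IsProbabilityMeasure (P.map (V X Z τ u)) := fun u =>
    Measure.isProbabilityMeasure_map (measurable_V hZ hX.meas τ u).aemeasurable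
  have hlim : Tendsto (fun u : Fin d → ℕ+ => ∫⁻ t in Set.Ioi (0 : ℝ), ENNReal.ofReal
      (fisher (P.map (V X Z τ u)) t - 1 / (Var[V X Z τ u; P] + t)))
      (comap boxVol atTop) (𝓝 (∫⁻ _ in Set.Ioi (0 : ℝ), 0)) := by
    refine tendsto_lintegral_filter_of_dominated_convergence
      (fun t => ENNReal.ofReal (1 + 1 / Var[X 0; P]) *
        (kappa X Z P n (t + τ).toNNReal / ENNReal.ofReal (1 + (t + τ)))) ?_ ?_ ?_ ?_
    · refine Eventually.of_forall fun u => ?_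
      have := measurable_fisher (P.map (V X Z τ u))
      fun_prop
    · filter_upwards [tendsto_comap.eventually (eventually_ge_atTop n)] with u hu
      filter_upwards [ae_restrict_mem measurableSet_Ioi] with t ht
      exact excess_fisher_V_le hX hZ τ hv u hu ht
    · rw [lintegral_const_mul' _ _ ENNReal.ofReal_ne_top]
      refine ENNReal.mul_ne_top ENNReal.ofReal_ne_top (ne_top_of_le_ne_top hn.ne ?_)
      exact lintegral_Ioi_add_le
        (fun t => kappa X Z P n t.toNNReal / ENNReal.ofReal (1 + t)) τ.coe_nonneg
    · filter_upwards [ae_restrict_mem measurableSet_Ioi] with t ht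
      exact tendsto_excess_fisher_V hX hZ τ hv hUI ht
  rw [lintegral_zero] at hlim
  refine tendsto_of_tendsto_of_tendsto_of_le_of_le tendsto_const_nhds hlim (fun _ => zero_le)
    fun u => ?_
  obtain ⟨m1, m2, m3, m4⟩ := V_moments hZ hX τ u
  have hm := (measurable_V hZ hX.meas τ u).aemeasurable (μ := P)
  refine klDiv_gaussianReal_le_lintegral _ ?_ ?_ (variance_nonneg _ _)
  · exact (memLp_map_measure_iff (by fun_prop) hm).2 m1
  · rw [integral_map hm (by fun_prop), m4, ← m3]

end

section

/-! ### Convergence of the relative entropy implies uniform integrability -/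

/-- The truncated quadratic `x² / 4 · 1(|x| ≥ R)`. -/
def tailQuad (R x : ℝ) : ℝ := Set.indicator {x : ℝ | R ≤ |x|} (fun x => x ^ 2 / 4) x

lemma tailQuad_nonneg (R x : ℝ) : 0 ≤ tailQuad R x :=
  Set.indicator_nonneg (fun _ _ => by positivity) x

lemma tailQuad_le (R x : ℝ) : tailQuad R x ≤ x ^ 2 / 4 :=
  Set.indicator_le_self' (fun _ _ => by positivity) x

lemma measurable_tailQuad (R : ℝ) : Measurable (tailQuad R) :=
  (by fun_prop : Measurable fun x : ℝ => x ^ 2 / 4).indicator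
    (measurableSet_le measurable_const (by fun_prop))

lemma tendsto_tailQuad (x : ℝ) : Tendsto (fun R => tailQuad R x) atTop (𝓝 0) := by
  refine tendsto_const_nhds.congr' ?_
  filter_upwards [eventually_gt_atTop |x|] with R hR
  exact (Set.indicator_of_notMem (by simpa using hR) _).symm

/-- The coefficient 1/4 is below the Gaussian exponent 1/2, so a factor exp(-x²/4) remains. -/
lemma integrable_exp_sq_gaussianReal :
    Integrable (fun x : ℝ => Real.exp (x ^ 2 / 4)) (gaussianReal 0 1) := by
  rw [gaussianReal_of_var_ne_zero _ one_ne_zero,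
    integrable_withDensity_iff (measurable_gaussianPDF _ _)
      (ae_of_all _ fun _ => gaussianPDF_lt_top)]
  have h := (integrable_exp_neg_mul_sq (b := 1 / 4) (by norm_num)).const_mul (√(2 * Real.pi))⁻¹
  refine h.congr (ae_of_all _ fun x => ?_)
  simp only [toReal_gaussianPDF, gaussianPDFReal, NNReal.coe_one, mul_one, sub_zero]
  rw [mul_left_comm, ← Real.exp_add]
  congr 2; ring

lemma integrable_exp_tailQuad (R : ℝ) :
    Integrable (fun x : ℝ => Real.exp (tailQuad R x)) (gaussianReal 0 1) := by
  refine integrable_exp_sq_gaussianReal.mono' (measurable_tailQuad R).exp.aestronglyMeasurable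
    (ae_of_all _ fun x => ?_)
  rw [Real.norm_of_nonneg (Real.exp_nonneg _)]
  exact Real.exp_le_exp.2 (tailQuad_le R x)

lemma tendsto_integral_exp_tailQuad :
    Tendsto (fun R => ∫ x, (Real.exp (tailQuad R x) - 1) ∂(gaussianReal 0 1)) atTop (𝓝 0) := by
  have h : Tendsto (fun R => ∫ x, (Real.exp (tailQuad R x) - 1) ∂(gaussianReal 0 1)) atTop
      (𝓝 (∫ _, (0 : ℝ) ∂(gaussianReal 0 1))) := by
    refine tendsto_integral_filter_of_dominated_convergence (fun x => Real.exp (x ^ 2 / 4))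
      (Eventually.of_forall fun R =>
        ((measurable_tailQuad R).exp.sub_const 1).aestronglyMeasurable)
      (Eventually.of_forall fun R => ae_of_all _ fun x => ?_) integrable_exp_sq_gaussianReal
      (ae_of_all _ fun x => ?_)
    · have h1 := Real.one_le_exp (tailQuad_nonneg R x)
      have h2 := Real.exp_le_exp.2 (tailQuad_le R x)
      rw [Real.norm_of_nonneg (by linarith)]
      linarith
    · have := ((Real.continuous_exp.tendsto 0).comp (tendsto_tailQuad x)).sub_const 1
      simpa using this
  simpa using h

variable {Ω : Type*} [MeasurableSpace Ω] {P : Measure Ω}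

/-- The normalized tail second moment `E[U² 1(|U| ≥ R σ)] / σ²`. -/
def tailRatio (U : Ω → ℝ) (P : Measure Ω) (R : ℝ) : ℝ :=
  (∫ ω in {ω | R * √(Var[U; P]) ≤ |U ω|}, U ω ^ 2 ∂P) / Var[U; P]

lemma tailRatio_nonneg (U : Ω → ℝ) (R : ℝ) : 0 ≤ tailRatio U P R :=
  div_nonneg (integral_nonneg fun _ => sq_nonneg _) (variance_nonneg _ _)

lemma tailRatio_le_one {U : Ω → ℝ} (hm : Measurable U) (hU : MemLp U 2 P)
    (h0 : ∫ ω, U ω ∂P = 0) (R : ℝ) : tailRatio U P R ≤ 1 := by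
  refine div_le_one_of_le₀ ?_ (variance_nonneg _ _)
  rw [variance_of_integral_eq_zero hm.aemeasurable h0]
  exact setIntegral_le_integral hU.integrable_sq (ae_of_all _ fun _ => sq_nonneg _)

lemma tendsto_tailRatio {U : Ω → ℝ} (hm : Measurable U) (hU : MemLp U 2 P)
    (hv : 0 < Var[U; P]) : Tendsto (tailRatio U P) atTop (𝓝 0) := by
  have hs : ∀ R : ℝ, MeasurableSet {ω | R * √(Var[U; P]) ≤ |U ω|} := fun R =>
    measurableSet_le measurable_const (by fun_prop)
  have h : Tendsto (fun R => ∫ ω in {ω | R * √(Var[U; P]) ≤ |U ω|}, U ω ^ 2 ∂P) atTop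
      (𝓝 (∫ _, (0 : ℝ) ∂P)) := by
    simp_rw [← integral_indicator (hs _)]
    refine tendsto_integral_filter_of_dominated_convergence (fun ω => U ω ^ 2)
      (Eventually.of_forall fun R =>
        ((hm.pow_const 2).indicator (hs R)).aestronglyMeasurable)
      (Eventually.of_forall fun R => ae_of_all _ fun ω => ?_) hU.integrable_sq
      (ae_of_all _ fun ω => ?_)
    · refine (norm_indicator_le_norm_self _ _).trans_eq ?_
      exact Real.norm_of_nonneg (sq_nonneg _)
    · refine tendsto_const_nhds.congr' ?_
      filter_upwards [(tendsto_id.atTop_mul_const (Real.sqrt_pos.2 hv)).eventually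
        (eventually_gt_atTop |U ω|)] with R hR
      exact (Set.indicator_of_notMem (by simpa using hR) _).symm
  have h2 := h.div_const (Var[U; P])
  rwa [integral_zero, zero_div] at h2

variable [IsProbabilityMeasure P]

/-- The tail second moment is controlled by the relative entropy. -/
lemma tailRatio_le_relEntropy {U : Ω → ℝ} (hm : Measurable U) (hU : MemLp U 2 P)
    (hv : 0 < Var[U; P]) (hkl : relEntropy U P ≠ ∞) (R : ℝ) :
    tailRatio U P R ≤ 4 * ((relEntropy U P).toReal +
      ∫ x, (Real.exp (tailQuad R x) - 1) ∂(gaussianReal 0 1)) := by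
  set v := Var[U; P] with hvdef
  set σ := √v with hσ
  have hσ0 : 0 < σ := Real.sqrt_pos.2 hv
  have hσ2 : σ ^ 2 = v := Real.sq_sqrt hv.le
  have hmq : Measurable fun x => tailQuad R (x / σ) := by
    have := measurable_tailQuad R
    fun_prop
  have hgauss : gaussianReal 0 v.toNNReal = (gaussianReal 0 1).map (σ * ·) := by
    rw [gaussianReal_map_const_mul]
    congr 1
    · simp
    · ext; simp [hσ2, hv.le]
  have hval : ∀ ω, tailQuad R (U ω / σ) =
      Set.indicator {ω | R * σ ≤ |U ω|} (fun ω => U ω ^ 2) ω * (1 / (4 * v)) := by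
    intro ω
    have hiff : R ≤ |U ω / σ| ↔ R * σ ≤ |U ω| := by
      rw [abs_div, abs_of_pos hσ0, le_div_iff₀ hσ0]
    rw [tailQuad]
    by_cases h : R * σ ≤ |U ω|
    · rw [Set.indicator_of_mem (s := {x : ℝ | R ≤ |x|}) (hiff.2 h),
        Set.indicator_of_mem (s := {ω | R * σ ≤ |U ω|}) h, div_pow, hσ2]
      field_simp
    · rw [Set.indicator_of_notMem (s := {x : ℝ | R ≤ |x|}) (fun h' => h (hiff.1 h')),
        Set.indicator_of_notMem (s := {ω | R * σ ≤ |U ω|}) h, zero_mul]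
  have hs : MeasurableSet {ω | R * σ ≤ |U ω|} := measurableSet_le measurable_const (by fun_prop)
  have hint : Integrable (fun ω => tailQuad R (U ω / σ)) P := by
    simp_rw [hval]
    exact (hU.integrable_sq.indicator hs).mul_const _
  have := Measure.isProbabilityMeasure_map (μ := P) hm.aemeasurable
  -- The test function is rescaled by σ, so the reference law becomes N(0, 1) and the exponential
  -- term depends on R alone, uniformly over U.
  have key := integral_le_klDiv_add (h := fun x => tailQuad R (x / σ)) hkl
    ((integrable_map_measure hmq.aestronglyMeasurable hm.aemeasurable).2 hint) (by
      rw [hgauss, integrable_map_measure hmq.exp.aestronglyMeasurable (by fun_prop)]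
      refine (integrable_exp_tailQuad R).congr (ae_of_all _ fun x => ?_)
      simp [mul_div_cancel_left₀ x hσ0.ne'])
  rw [integral_map hm.aemeasurable hmq.aestronglyMeasurable, hgauss,
    integral_map (φ := (σ * ·)) (by fun_prop) (hmq.exp.sub_const 1).aestronglyMeasurable,
    ← hgauss] at key
  simp_rw [mul_div_cancel_left₀ _ hσ0.ne', hval, integral_mul_const, integral_indicator hs] at key
  change _ ≤ (relEntropy U P).toReal + _ at key
  have he : tailRatio U P R = 4 * ((∫ ω in {ω | R * σ ≤ |U ω|}, U ω ^ 2 ∂P) * (1 / (4 * v))) := by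
    rw [tailRatio, ← hvdef, ← hσ]; field_simp
  rw [he]
  linarith

lemma finite_setOf_boxVol_lt {d : ℕ} (N : ℕ) : {u : Fin d → ℕ+ | boxVol u < N}.Finite := by
  rcases Nat.eq_zero_or_pos N with rfl | hN
  · simp
  refine (Set.finite_Iic (fun _ : Fin d => N.toPNat hN)).subset fun u hu k => ?_
  have h1 : (u k : ℕ) ≤ boxVol u :=
    Nat.le_of_dvd (boxVol_pos u) (Finset.dvd_prod_of_mem (fun i => (u i : ℕ)) (Finset.mem_univ k))
  exact PNat.coe_le_coe _ _ |>.1 (h1.trans (le_of_lt hu))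

variable {d : ℕ} {X : (Fin d → ℤ) → Ω → ℝ} {Z : ℝ≥0 → (Fin d → ℤ) → Ω → ℝ}

theorem uniformIntegrability_of_tendsto_relEntropy (hX : IsFKGField X P)
    (hZ : IsGaussianPerturbation X Z P) (hv : 0 < Var[X 0; P]) (τ : ℝ≥0)
    (h : Tendsto (fun u : Fin d → ℕ+ => relEntropy (V X Z τ u) P) (comap boxVol atTop) (𝓝 0)) :
    UniformIntegrability X Z P τ := by
  have hvV : ∀ u, 0 < Var[V X Z τ u; P] := fun u => by
    have := le_variance_V hX hZ τ u
    have := τ.coe_nonneg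
    linarith
  have hm := measurable_V hZ hX.meas τ
  have hbdd : ∀ R, BddAbove (Set.range fun u => tailRatio (V X Z τ u) P R) := fun R =>
    ⟨1, by
      rintro _ ⟨u, rfl⟩
      obtain ⟨m1, m2, -, -⟩ := V_moments hZ hX τ u
      exact tailRatio_le_one (hm u) m1 m2 R⟩
  -- The smallest admissible ψ is the supremum of the tail ratios, finite since each ratio is at
  -- most 1.
  refine ⟨fun R => ⨆ u, tailRatio (V X Z τ u) P R, ?_, fun u =>
    ⟨(V_moments hZ hX τ u).1, fun R => ?_⟩⟩
  · rw [Metric.tendsto_nhds]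
    intro ε hε
    -- Entropy and Gaussian term are each kept below ε/16, so that the factor 4 gives ε/2 in total
    -- for the large boxes.
    obtain ⟨N, hN⟩ : ∃ N, ∀ u : Fin d → ℕ+, N ≤ boxVol u →
        relEntropy (V X Z τ u) P < ENNReal.ofReal (ε / 16) := by
      have := h.eventually (gt_mem_nhds (ENNReal.ofReal_pos.2 (by positivity : 0 < ε / 16)))
      rw [eventually_comap, eventually_atTop] at this
      obtain ⟨N, hN⟩ := this
      exact ⟨N, fun u hu => hN _ hu u rfl⟩
    have hfin : ∀ᶠ R in atTop, ∀ u ∈ {u : Fin d → ℕ+ | boxVol u < N},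
        tailRatio (V X Z τ u) P R < ε / 2 :=
      (eventually_all_finite (finite_setOf_boxVol_lt N)).2 fun u _ =>
        (tendsto_tailRatio (hm u) (V_moments hZ hX τ u).1 (hvV u)).eventually
          (gt_mem_nhds (by positivity))
    filter_upwards [hfin, tendsto_integral_exp_tailQuad.eventually
      (gt_mem_nhds (by positivity : 0 < ε / 16))] with R h1 h2
    rw [dist_zero_right, Real.norm_of_nonneg (Real.iSup_nonneg fun u => tailRatio_nonneg _ R)]
    refine lt_of_le_of_lt (ciSup_le fun u => ?_) (half_lt_self hε)
    rcases lt_or_ge (boxVol u) N with hu | hu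
    · exact (h1 u hu).le
    · have h3 := hN u hu
      have h4 : (relEntropy (V X Z τ u) P).toReal < ε / 16 :=
        (ENNReal.lt_ofReal_iff_toReal_lt h3.ne_top).1 h3
      have := tailRatio_le_relEntropy (hm u) (V_moments hZ hX τ u).1 (hvV u) h3.ne_top R
      linarith
  · have := le_ciSup (hbdd R) u
    exact (div_le_iff₀' (hvV u)).1 this

end

end FKGEntropy

end

open FKGEntropy in
theorem theorem1p9 {Ω : Type*} [MeasurableSpace Ω] (P : Measure Ω) [IsProbabilityMeasure P]
    (d : ℕ) (hd : 1 ≤ d)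
    (X : (Fin d → ℤ) → Ω → ℝ)
    (hX_meas : ∀ y, Measurable (X y))
    (hX_L2 : ∀ y, MemLp (X y) 2 P)
    (hX_mean : ∀ y, ∫ ω, X y ω ∂P = 0)
    (hX_stat : IsStationary X P)
    (hX_dens : ∀ y, HasPDF (X y) P volume)
    (hX_fkg : IsFKG X P)
    (hX_susc : Summable (fun y : Fin d → ℤ => cov[X 0, X y; P]))
    (Z : ℝ≥0 → (Fin d → ℤ) → Ω → ℝ)
    (hZ : IsGaussianPerturbation X Z P)
    (hκ : ∃ n : ℕ, ∫⁻ t in Set.Ioi (0 : ℝ),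
      kappa X Z P n t.toNNReal / ENNReal.ofReal (1 + t) < ∞)
    (τ : ℝ≥0) :
    Tendsto (fun u : Fin d → ℕ+ => relEntropy (V X Z τ u) P) (comap boxVol atTop) (𝓝 0) ↔
      UniformIntegrability X Z P τ := by
  have : Nonempty (Fin d) := ⟨⟨0, hd⟩⟩
  have hX : IsFKGField X P := ⟨hX_meas, hX_L2, hX_mean, hX_stat, hX_fkg, hX_susc⟩
  -- The density of a single variable enters only through this strict positivity.
  have hv : 0 < Var[X 0; P] := variance_pos_of_hasPDF (hX_L2 0) (hX_dens 0)
  exact ⟨uniformIntegrability_of_tendsto_relEntropy hX hZ hv τ,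
    tendsto_relEntropy_of_uniformIntegrability hX hZ hv hκ τ⟩
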